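/- Let $k=\mathbb F_q$ be a finite field with $q$ elements and let $Q$ be a quiver whose underlying graph is a simply laced Dynkin diagram (a finite disjoint union of diagrams of type $A_n$, $D_n$, $E_6,E_7,E_8$, with arbitrary orientation). Let $\mathrm{Rep}(Q)$ be the abelian category of finite-dimensional representations of $Q$ over $k$ and let $K=K_0(\mathrm{Rep}(Q))$ be its Grothendieck group. Then all $\mathrm{Ext}^i(M,N)$ in $\mathrm{Rep}(Q)$ are finite-dimensional over $k$ and vanish for $i\ge 2$, and there is a bilinear form $\langle\cdot,\cdot\rangle\colon K\times K\to\mathbb Z$ (necessarily unique) with $$\langle [M],[N]\rangle=\sum_{i\ge 0}(-1)^i\dim_k\mathrm{Ext}^i(M,N)\qquad\text{for all representations } M,N .$$ Let $\mathrm{Vect}^K$ be the category of $K$-graded real vector spaces and grade-preserving linear maps, with the usual tensor product, graded by $(V\otimes W)_d=\bigoplus_{n+m=d}V_n\otimes W_m$, and with the braiding $v\otimes w\mapsto q^{-\langle n,m\rangle}\,w\otimes v$ for $v\in V_n$, $w\in W_m$. For representations $M,N,E$ let $P^E_{MN}$ be the number of pairs $(f,g)$ for which $0\to N\xrightarrow{f}E\xrightarrow{g}M\to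 0$ is exact, and let $\mathrm{aut}(M)=|\mathrm{Aut}(M)|$. Let $\mathcal H$ be the real vector space with basis the isomorphism classes $[M]$ of representations, the degree of $[M]$ being the class of $M$ in $K$. Then $\mathcal H$ is a Hopf algebra object in the braided monoidal category $\mathrm{Vect}^K$, with multiplication and comultiplication $$[M]\cdot[N]=\sum_{[E]}\frac{P^E_{MN}}{\mathrm{aut}(M)\,\mathrm{aut}(N)}\,[E],\qquad \Delta([E])=\sum_{[M],[N]}\frac{P^E_{MN}}{\mathrm{aut}(E)}\,[N]\otimes[M]$$ (both sums being finite), unit $[0]$, and counit $\varepsilon([M])=1$ if $M=0$ and $\varepsilon([M])=0$ otherwise. Its antipode $S$ satisfies $S([M])=-[M]$ for every simple representation $M$. -/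

import Mathlib

open CategoryTheory MonoidalCategory
open scoped TensorProduct

universe u v w

noncomputable section

/-! ### Graded vector spaces with a braiding twisted by a bilinear form -/

/-- A real vector space `V = ⨁ n : K, V_n` graded by an abelian group `K`. The bilinear form `χ` and
the nonzero scalar `q` do not enter the data of an object; they are parameters of the type because
the braiding of the category depends on them. -/
structure KVect {K : Type w} [AddCommGroup K] (χ : K →+ K →+ ℤ) (q : ℝˣ) where
  carrier : Type w
  [addCommGroup : AddCommGroup carrier]
  [module : Module ℝ carrier]
  /-- the homogeneous pieces -/
  piece : K → Submodule ℝ carrier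
  indep : iSupIndep piece
  iSup_eq_top : iSup piece = ⊤

namespace KVect

attribute [instance] KVect.addCommGroup KVect.module

section Criterion

variable {K : Type w} {V : Type w} [AddCommGroup V] [Module ℝ V]

theorem iSupIndep_of_coaction (P : K → Submodule ℝ V) (δ : V →ₗ[ℝ] (K →₀ V))
    (h : ∀ n, ∀ x ∈ P n, δ x = Finsupp.single n x) : iSupIndep P := by
  intro n
  rw [Submodule.disjoint_def]
  intro x hx hx'
  have key : (⨆ (j) (_ : j ≠ n), P j) ≤ LinearMap.ker (Finsupp.lapply n ∘ₗ δ) := by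
    refine iSup₂_le fun j hj y hy => ?_
    simp [h j y hy, hj]
  have := key hx'
  simpa [h n x hx] using this

end Criterion

variable {K : Type w} [AddCommGroup K] {χ : K →+ K →+ ℤ} {q : ℝˣ}

open Classical in
theorem isInternal (V : KVect χ q) : DirectSum.IsInternal V.piece :=
  (DirectSum.isInternal_submodule_iff_iSupIndep_and_iSup_eq_top _).2 ⟨V.indep, V.iSup_eq_top⟩

open Classical in
/-- The map that sends a vector to the family of its homogeneous components. -/
def components (V : KVect χ q) : V.carrier →ₗ[ℝ] (K →₀ V.carrier) :=
  (DirectSum.toModule ℝ K (K →₀ V.carrier)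
      fun n => Finsupp.lsingle n ∘ₗ (V.piece n).subtype) ∘ₗ
    (LinearEquiv.ofBijective (DirectSum.coeLinearMap V.piece) V.isInternal).symm.toLinearMap

theorem components_of_mem (V : KVect χ q) {n : K} {x : V.carrier} (hx : x ∈ V.piece n) :
    V.components x = Finsupp.single n x := by
  classical
  have : (LinearEquiv.ofBijective (DirectSum.coeLinearMap V.piece) V.isInternal).symm x
      = DirectSum.lof ℝ K (fun i => V.piece i) n ⟨x, hx⟩ := by
    rw [LinearEquiv.symm_apply_eq]
    exact (DirectSum.coeLinearMap_lof V.piece n ⟨x, hx⟩).symm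
  have h2 : V.components x = (DirectSum.toModule ℝ K (K →₀ V.carrier)
      fun n => Finsupp.lsingle n ∘ₗ (V.piece n).subtype)
      ((LinearEquiv.ofBijective (DirectSum.coeLinearMap V.piece) V.isInternal).symm x) := by
    unfold components
    rw [LinearMap.comp_apply]
    congr!
  rw [h2, this, DirectSum.toModule_lof]
  rfl

theorem homogeneous_induction (V : KVect χ q) {p : V.carrier → Prop} (x : V.carrier)
    (hom : ∀ n, ∀ y ∈ V.piece n, p y) (zero : p 0) (add : ∀ y z, p y → p z → p (y + z)) : p x :=
  Submodule.iSup_induction V.piece (motive := p)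
    (by rw [V.iSup_eq_top]; trivial) hom zero add

theorem lin_ext {V : KVect χ q} {M : Type*} [AddCommGroup M] [Module ℝ M]
    {f g : V.carrier →ₗ[ℝ] M} (h : ∀ n, ∀ x ∈ V.piece n, f x = g x) : f = g := by
  ext x
  refine V.homogeneous_induction x h (by simp) fun y z hy hz => by simp [hy, hz]

/-- A morphism of graded vector spaces: a linear map that preserves the grading. -/
@[ext]
structure Hom (V W : KVect χ q) where
  lin : V.carrier →ₗ[ℝ] W.carrier
  map_mem : ∀ n, ∀ x ∈ V.piece n, lin x ∈ W.piece n

instance : Category (KVect χ q) where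
  Hom := Hom
  id V := ⟨LinearMap.id, fun _ _ h => h⟩
  comp f g := ⟨g.lin ∘ₗ f.lin, fun n x h => g.map_mem n _ (f.map_mem n x h)⟩

/-- The linear map underlying a morphism. -/
abbrev lin {V W : KVect χ q} (f : V ⟶ W) : V.carrier →ₗ[ℝ] W.carrier := Hom.lin f

theorem hom_ext {V W : KVect χ q} {f g : V ⟶ W} (h : lin f = lin g) : f = g := Hom.ext h

theorem lin_comp {V W U : KVect χ q} (f : V ⟶ W) (g : W ⟶ U) :
    lin (f ≫ g) = lin g ∘ₗ lin f := rfl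

theorem lin_id (V : KVect χ q) : lin (𝟙 V) = LinearMap.id := rfl

/-- `(V ⊗ W)_d` is spanned by the `v ⊗ w` with `v ∈ V_n`, `w ∈ W_m`, `n + m = d`. -/
def tensorPiece (V W : KVect χ q) (d : K) : Submodule ℝ (V.carrier ⊗[ℝ] W.carrier) :=
  Submodule.span ℝ {t | ∃ n m : K, n + m = d ∧ ∃ x ∈ V.piece n, ∃ y ∈ W.piece m, t = x ⊗ₜ[ℝ] y}

theorem tmul_mem_tensorPiece {V W : KVect χ q} {n m : K} {x : V.carrier} {y : W.carrier}
    (hx : x ∈ V.piece n) (hy : y ∈ W.piece m) : x ⊗ₜ[ℝ] y ∈ tensorPiece V W (n + m) :=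
  Submodule.subset_span ⟨n, m, rfl, x, hx, y, hy, rfl⟩

theorem mapsTo_of_tmul {V W : KVect χ q} {M : Type*} [AddCommGroup M] [Module ℝ M]
    (f : V.carrier ⊗[ℝ] W.carrier →ₗ[ℝ] M) (P : K → Submodule ℝ M)
    (h : ∀ n m, ∀ x ∈ V.piece n, ∀ y ∈ W.piece m, f (x ⊗ₜ y) ∈ P (n + m)) (d : K) :
    ∀ t ∈ tensorPiece V W d, f t ∈ P d := by
  intro t ht
  have : tensorPiece V W d ≤ (P d).comap f := by
    refine Submodule.span_le.2 ?_
    rintro _ ⟨n, m, rfl, x, hx, y, hy, rfl⟩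
    exact h n m x hx y hy
  exact this ht

/-- Bihomogeneous components of a tensor. -/
def components₂ (V W : KVect χ q) :
    V.carrier ⊗[ℝ] W.carrier →ₗ[ℝ] (K × K →₀ V.carrier ⊗[ℝ] W.carrier) :=
  (finsuppTensorFinsupp ℝ ℝ V.carrier W.carrier K K).toLinearMap ∘ₗ
    TensorProduct.map V.components W.components

theorem components₂_tmul {V W : KVect χ q} {n m : K} {x : V.carrier} {y : W.carrier}
    (hx : x ∈ V.piece n) (hy : y ∈ W.piece m) :
    components₂ V W (x ⊗ₜ y) = Finsupp.single (n, m) (x ⊗ₜ y) := by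
  simp [components₂, components_of_mem _ hx, components_of_mem _ hy]

theorem tmul_induction {V W : KVect χ q} {p : V.carrier ⊗[ℝ] W.carrier → Prop}
    (t : V.carrier ⊗[ℝ] W.carrier)
    (hom : ∀ n m, ∀ x ∈ V.piece n, ∀ y ∈ W.piece m, p (x ⊗ₜ y)) (zero : p 0)
    (add : ∀ s t, p s → p t → p (s + t)) : p t := by
  induction t with
  | zero => exact zero
  | add s t hs ht => exact add s t hs ht
  | tmul x y =>
    refine V.homogeneous_induction (p := fun x => p (x ⊗ₜ y)) x (fun n x hx => ?_) (by simpa using zero)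
      (fun a b ha hb => by rw [TensorProduct.add_tmul]; exact add _ _ ha hb)
    refine W.homogeneous_induction (p := fun y => p (x ⊗ₜ y)) y (fun m y hy => hom n m x hx y hy) (by simpa using zero)
      (fun a b ha hb => by rw [TensorProduct.tmul_add]; exact add _ _ ha hb)

/-- The tensor product of graded vector spaces. -/
@[reducible]
def tensor (V W : KVect χ q) : KVect χ q where
  carrier := V.carrier ⊗[ℝ] W.carrier
  piece := tensorPiece V W
  indep := by
    refine iSupIndep_of_coaction _
      (Finsupp.lmapDomain _ ℝ (fun p : K × K => p.1 + p.2) ∘ₗ components₂ V W) ?_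
    intro d t ht
    have : tensorPiece V W d ≤ LinearMap.eqLocus
        (Finsupp.lmapDomain _ ℝ (fun p : K × K => p.1 + p.2) ∘ₗ components₂ V W)
        (Finsupp.lsingle d) := by
      refine Submodule.span_le.2 ?_
      rintro _ ⟨n, m, rfl, x, hx, y, hy, rfl⟩
      simp [components₂_tmul hx hy]
    exact this ht
  iSup_eq_top := by
    rw [eq_top_iff]
    rintro t -
    exact tmul_induction t
      (fun n m x hx y hy => Submodule.mem_iSup_of_mem (n + m) (tmul_mem_tensorPiece hx hy))
      (zero_mem _) (fun _ _ => add_mem)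

/-- The unit object: the ground field, in degree `0`. -/
@[reducible]
def unit : KVect χ q where
  carrier := ULift.{w} ℝ
  piece n := ⨆ _ : n = 0, ⊤
  indep := by
    refine iSupIndep_of_coaction _ (Finsupp.lsingle 0) ?_
    intro n x hx
    by_cases h : n = 0
    · subst h; rfl
    · have : x = 0 := by simpa [h] using hx
      simp [this]
  iSup_eq_top := by simp

/-- A graded linear isomorphism gives an isomorphism of graded vector spaces. -/
def mkIso {V W : KVect χ q} (e : V.carrier ≃ₗ[ℝ] W.carrier)
    (h : ∀ n, ∀ x ∈ V.piece n, e x ∈ W.piece n)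
    (h' : ∀ n, ∀ x ∈ W.piece n, e.symm x ∈ V.piece n) : V ≅ W where
  hom := ⟨e.toLinearMap, h⟩
  inv := ⟨e.symm.toLinearMap, h'⟩
  hom_inv_id := hom_ext (LinearMap.ext fun x => e.symm_apply_apply x)
  inv_hom_id := hom_ext (LinearMap.ext fun x => e.apply_symm_apply x)

/-- The tensor product of two morphisms. -/
def tensorMap {V V' W W' : KVect χ q} (f : V ⟶ V') (g : W ⟶ W') : tensor V W ⟶ tensor V' W' :=
  ⟨TensorProduct.map (lin f) (lin g), mapsTo_of_tmul (V := V) (W := W) _ (tensorPiece V' W')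
    fun n m x hx y hy => tmul_mem_tensorPiece (f.map_mem n x hx) (g.map_mem m y hy)⟩

/-- The associativity constraint `(x ⊗ y) ⊗ z ↦ x ⊗ (y ⊗ z)`. -/
def assocIso (V W U : KVect χ q) : tensor (tensor V W) U ≅ tensor V (tensor W U) :=
  mkIso (V := tensor (tensor V W) U) (W := tensor V (tensor W U))
    (TensorProduct.assoc ℝ V.carrier W.carrier U.carrier)
    (by
      refine mapsTo_of_tmul (V := tensor V W) (W := U) _ (tensorPiece V (tensor W U)) ?_
      intro d p t ht z hz
      refine mapsTo_of_tmul (V := V) (W := W)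
        ((TensorProduct.assoc ℝ V.carrier W.carrier U.carrier).toLinearMap ∘ₗ
          (TensorProduct.mk ℝ _ _).flip z)
        (fun d => tensorPiece V (tensor W U) (d + p)) ?_ d t ht
      intro n m x hx y hy
      rw [add_assoc]
      exact tmul_mem_tensorPiece (W := tensor W U) hx (tmul_mem_tensorPiece hy hz))
    (by
      refine mapsTo_of_tmul (V := V) (W := tensor W U)
        (TensorProduct.assoc ℝ V.carrier W.carrier U.carrier).symm.toLinearMap
        (tensorPiece (tensor V W) U) ?_
      intro n d x hx t ht
      refine mapsTo_of_tmul (V := W) (W := U)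
        ((TensorProduct.assoc ℝ V.carrier W.carrier U.carrier).symm.toLinearMap ∘ₗ
          TensorProduct.mk ℝ _ _ x)
        (fun d => tensorPiece (tensor V W) U (n + d)) ?_ d t ht
      intro m p y hy z hz
      rw [← add_assoc]
      exact tmul_mem_tensorPiece (V := tensor V W) (tmul_mem_tensorPiece hx hy) hz)

theorem mem_unit_piece_zero (x : (unit : KVect χ q).carrier) :
    x ∈ (unit : KVect χ q).piece 0 := by
  change x ∈ ⨆ _ : (0 : K) = 0, (⊤ : Submodule ℝ (ULift.{w} ℝ))
  rw [iSup_pos rfl]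
  trivial

theorem unit_piece_of_ne {n : K} (h : n ≠ 0) : (unit : KVect χ q).piece n = ⊥ := by
  change (⨆ _ : n = 0, (⊤ : Submodule ℝ (ULift.{w} ℝ))) = ⊥
  rw [iSup_neg h]

/-- The linear map `a ⊗ x ↦ a • x`. -/
def leftLin (V : KVect χ q) : (unit : KVect χ q).carrier ⊗[ℝ] V.carrier ≃ₗ[ℝ] V.carrier :=
  (TensorProduct.congr ULift.moduleEquiv (LinearEquiv.refl ℝ V.carrier)).trans
    (TensorProduct.lid ℝ V.carrier)

/-- The linear map `x ⊗ a ↦ a • x`. -/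
def rightLin (V : KVect χ q) : V.carrier ⊗[ℝ] (unit : KVect χ q).carrier ≃ₗ[ℝ] V.carrier :=
  (TensorProduct.congr (LinearEquiv.refl ℝ V.carrier) ULift.moduleEquiv).trans
    (TensorProduct.rid ℝ V.carrier)

/-- The left unit constraint. -/
def leftIso (V : KVect χ q) : tensor unit V ≅ V :=
  mkIso (V := tensor unit V) (W := V) (leftLin V)
    (by
      refine mapsTo_of_tmul (V := unit) (W := V) (leftLin V).toLinearMap V.piece ?_
      intro n m x hx y hy
      by_cases h : n = 0
      · subst h
        rw [zero_add]
        exact (V.piece m).smul_mem _ hy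
      · rw [unit_piece_of_ne h, Submodule.mem_bot] at hx
        subst hx
        rw [TensorProduct.zero_tmul, map_zero]
        exact zero_mem _)
    (by
      intro n x hx
      have := tmul_mem_tensorPiece (V := unit) (W := V)
        (mem_unit_piece_zero (ULift.up (1 : ℝ))) hx
      rw [zero_add] at this
      exact this)

/-- The right unit constraint. -/
def rightIso (V : KVect χ q) : tensor V unit ≅ V :=
  mkIso (V := tensor V unit) (W := V) (rightLin V)
    (by
      refine mapsTo_of_tmul (V := V) (W := unit) (rightLin V).toLinearMap V.piece ?_
      intro n m x hx y hy
      by_cases h : m = 0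
      · subst h
        rw [add_zero]
        exact (V.piece n).smul_mem _ hx
      · rw [unit_piece_of_ne h, Submodule.mem_bot] at hy
        subst hy
        rw [TensorProduct.tmul_zero, map_zero]
        exact zero_mem _)
    (by
      intro n x hx
      have := tmul_mem_tensorPiece (V := V) (W := unit) hx
        (mem_unit_piece_zero (ULift.up (1 : ℝ)))
      rw [add_zero] at this
      exact this)

instance : MonoidalCategoryStruct (KVect χ q) where
  tensorObj := tensor
  whiskerLeft V _ _ f := tensorMap (𝟙 V) f
  whiskerRight f W := tensorMap f (𝟙 W)
  tensorHom f g := tensorMap f g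
  tensorUnit := unit
  associator := assocIso
  leftUnitor := leftIso
  rightUnitor := rightIso

instance : MonoidalCategory (KVect χ q) where
  tensorHom_def _ _ := hom_ext (TensorProduct.ext' fun _ _ => rfl)
  id_tensorHom_id _ _ := hom_ext (TensorProduct.ext' fun _ _ => rfl)
  tensorHom_comp_tensorHom _ _ _ _ := hom_ext (TensorProduct.ext' fun _ _ => rfl)
  whiskerLeft_id _ _ := hom_ext (TensorProduct.ext' fun _ _ => rfl)
  id_whiskerRight _ _ := hom_ext (TensorProduct.ext' fun _ _ => rfl)
  associator_naturality _ _ _ := hom_ext (TensorProduct.ext_threefold fun _ _ _ => rfl)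
  leftUnitor_naturality f := hom_ext (TensorProduct.ext' fun a x =>
    ((lin f).map_smul (ULift.down a) x).symm)
  rightUnitor_naturality f := hom_ext (TensorProduct.ext' fun x a =>
    ((lin f).map_smul (ULift.down a) x).symm)
  pentagon _ _ _ _ := hom_ext (TensorProduct.ext_fourfold fun _ _ _ _ => rfl)
  triangle _ _ := hom_ext (TensorProduct.ext_threefold fun x a y =>
    (TensorProduct.smul_tmul (ULift.down a) x y).symm)

/-- The linear map underlying the braiding; see `braidLin_tmul`. -/
def braidLin (b : K → K → ℝ) (V W : KVect χ q) :
    V.carrier ⊗[ℝ] W.carrier →ₗ[ℝ] W.carrier ⊗[ℝ] V.carrier :=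
  Finsupp.lsum ℝ (fun p : K × K =>
    b p.1 p.2 • (TensorProduct.comm ℝ V.carrier W.carrier).toLinearMap) ∘ₗ components₂ V W

theorem braidLin_tmul (b : K → K → ℝ) {V W : KVect χ q} {n m : K} {x : V.carrier} {y : W.carrier}
    (hx : x ∈ V.piece n) (hy : y ∈ W.piece m) :
    braidLin b V W (x ⊗ₜ y) = b n m • (y ⊗ₜ x) := by
  simp [braidLin, components₂_tmul hx hy]

theorem tmul_ext {V W : KVect χ q} {M : Type*} [AddCommGroup M] [Module ℝ M]
    {f g : V.carrier ⊗[ℝ] W.carrier →ₗ[ℝ] M}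
    (h : ∀ n m, ∀ x ∈ V.piece n, ∀ y ∈ W.piece m, f (x ⊗ₜ y) = g (x ⊗ₜ y)) : f = g :=
  LinearMap.ext fun t => tmul_induction (p := fun t => f t = g t) t h (by simp)
    (fun s t hs ht => by simp only [map_add, hs, ht])

theorem tmul_ext₃ {V W U : KVect χ q} {M : Type*} [AddCommGroup M] [Module ℝ M]
    {f g : (V.carrier ⊗[ℝ] W.carrier) ⊗[ℝ] U.carrier →ₗ[ℝ] M}
    (h : ∀ n m p, ∀ x ∈ V.piece n, ∀ y ∈ W.piece m, ∀ z ∈ U.piece p,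
      f ((x ⊗ₜ y) ⊗ₜ z) = g ((x ⊗ₜ y) ⊗ₜ z)) : f = g := by
  refine TensorProduct.ext (tmul_ext fun n m x hx y hy => lin_ext fun p z hz => ?_)
  exact h n m p x hx y hy z hz

theorem tmul_ext₃' {V W U : KVect χ q} {M : Type*} [AddCommGroup M] [Module ℝ M]
    {f g : V.carrier ⊗[ℝ] (W.carrier ⊗[ℝ] U.carrier) →ₗ[ℝ] M}
    (h : ∀ n m p, ∀ x ∈ V.piece n, ∀ y ∈ W.piece m, ∀ z ∈ U.piece p,
      f (x ⊗ₜ (y ⊗ₜ z)) = g (x ⊗ₜ (y ⊗ₜ z))) : f = g := by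
  refine TensorProduct.ext (lin_ext fun n x hx => tmul_ext fun m p y hy z hz => ?_)
  exact h n m p x hx y hy z hz

theorem braidLin_mem (b : K → K → ℝ) (V W : KVect χ q) (d : K)
    (t : V.carrier ⊗[ℝ] W.carrier) (ht : t ∈ tensorPiece V W d) :
    braidLin b V W t ∈ tensorPiece W V d := by
  refine mapsTo_of_tmul (braidLin b V W) (tensorPiece W V) (fun n m x hx y hy => ?_) d t ht
  rw [braidLin_tmul _ hx hy, add_comm]
  exact Submodule.smul_mem _ _ (tmul_mem_tensorPiece hy hx)

theorem braidLin_comp (b c : K → K → ℝ) (h : ∀ n m, b n m * c m n = 1) (V W : KVect χ q) :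
    braidLin c W V ∘ₗ braidLin b V W = LinearMap.id :=
  tmul_ext fun n m x hx y hy => by
    rw [LinearMap.comp_apply, braidLin_tmul _ hx hy, map_smul, braidLin_tmul _ hy hx, smul_smul,
      h, one_smul, LinearMap.id_apply]

variable (χ q) in
/-- The coefficient `q ^ (-χ(n, m))`. -/
def braidCoeff (n m : K) : ℝ := ((q ^ (-χ n m) : ℝˣ) : ℝ)

variable (χ q) in
/-- The coefficient `q ^ χ(n, m)` of the inverse braiding. -/
def braidCoeffInv (m n : K) : ℝ := ((q ^ χ n m : ℝˣ) : ℝ)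

theorem braidCoeff_mul (n m : K) : braidCoeff χ q n m * braidCoeffInv χ q m n = 1 := by
  rw [braidCoeff, braidCoeffInv, ← Units.val_mul, ← zpow_add, neg_add_cancel, zpow_zero,
    Units.val_one]

theorem braidCoeffInv_mul (m n : K) : braidCoeffInv χ q m n * braidCoeff χ q n m = 1 := by
  rw [mul_comm, braidCoeff_mul]

/-- The braiding `v ⊗ w ↦ q ^ (-χ(n, m)) • w ⊗ v` for `v ∈ V_n`, `w ∈ W_m`;
its inverse is `w ⊗ v ↦ q ^ χ(n, m) • v ⊗ w`. -/
def braidIso (V W : KVect χ q) : tensor V W ≅ tensor W V where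
  hom := ⟨braidLin (braidCoeff χ q) V W, braidLin_mem (braidCoeff χ q) V W⟩
  inv := ⟨braidLin (braidCoeffInv χ q) W V, braidLin_mem (braidCoeffInv χ q) W V⟩
  hom_inv_id := hom_ext (braidLin_comp (braidCoeff χ q) (braidCoeffInv χ q) braidCoeff_mul V W)
  inv_hom_id := hom_ext
    (braidLin_comp (braidCoeffInv χ q) (braidCoeff χ q) braidCoeffInv_mul W V)

theorem braidIso_tmul {V W : KVect χ q} {n m : K} {x : V.carrier} {y : W.carrier}
    (hx : x ∈ V.piece n) (hy : y ∈ W.piece m) :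
    lin (braidIso V W).hom (x ⊗ₜ y) = ((q ^ (-χ n m) : ℝˣ) : ℝ) • (y ⊗ₜ x) :=
  braidLin_tmul _ hx hy

instance : BraidedCategory (KVect χ q) where
  braiding := braidIso
  braiding_naturality_right V W W' f := hom_ext (tmul_ext fun n m x hx y hy => by
    change lin (braidIso V W').hom (x ⊗ₜ lin f y) =
      TensorProduct.map (lin f) LinearMap.id (lin (braidIso V W).hom (x ⊗ₜ y))
    rw [braidIso_tmul hx hy, braidIso_tmul hx (f.map_mem _ _ hy), map_smul]
    rfl)
  braiding_naturality_left f W := hom_ext (tmul_ext fun n m x hx y hy => by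
    change lin (braidIso _ W).hom (lin f x ⊗ₜ y) =
      TensorProduct.map LinearMap.id (lin f) (lin (braidIso _ W).hom (x ⊗ₜ y))
    rw [braidIso_tmul hx hy, braidIso_tmul (f.map_mem _ _ hx) hy, map_smul]
    rfl)
  hexagon_forward V W U := hom_ext (tmul_ext₃ fun n m p x hx y hy z hz => by
    change TensorProduct.assoc ℝ W.carrier U.carrier V.carrier
        (lin (braidIso V (tensor W U)).hom (x ⊗ₜ (y ⊗ₜ z))) =
      TensorProduct.map LinearMap.id (lin (braidIso V U).hom)
        (TensorProduct.assoc ℝ W.carrier V.carrier U.carrier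
          (lin (braidIso V W).hom (x ⊗ₜ y) ⊗ₜ z))
    rw [braidIso_tmul (W := tensor W U) hx (tmul_mem_tensorPiece hy hz), braidIso_tmul hx hy,
      map_smul, ← TensorProduct.smul_tmul', map_smul, map_smul, TensorProduct.assoc_tmul,
      TensorProduct.assoc_tmul, TensorProduct.map_tmul, braidIso_tmul hx hz,
      TensorProduct.tmul_smul, smul_smul, ← Units.val_mul, ← zpow_add, map_add, neg_add]
    rfl)
  hexagon_reverse V W U := hom_ext (tmul_ext₃' fun n m p x hx y hy z hz => by
    change (TensorProduct.assoc ℝ U.carrier V.carrier W.carrier).symm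
        (lin (braidIso (tensor V W) U).hom ((x ⊗ₜ y) ⊗ₜ z)) =
      TensorProduct.map (lin (braidIso V U).hom) LinearMap.id
        ((TensorProduct.assoc ℝ V.carrier U.carrier W.carrier).symm
          (x ⊗ₜ lin (braidIso W U).hom (y ⊗ₜ z)))
    rw [braidIso_tmul (V := tensor V W) (tmul_mem_tensorPiece hx hy) hz, braidIso_tmul hy hz,
      map_smul, TensorProduct.tmul_smul, map_smul, map_smul, TensorProduct.assoc_symm_tmul,
      TensorProduct.assoc_symm_tmul, TensorProduct.map_tmul, braidIso_tmul hx hz,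
      ← TensorProduct.smul_tmul', smul_smul, ← Units.val_mul, ← zpow_add, map_add,
      AddMonoidHom.add_apply, neg_add, add_comm (-(χ m) p)]
    rfl)

end KVect

/-! ### Isomorphism classes, the Grothendieck group and the Hall algebra -/

section Hall

variable (C : Type w) [Category.{v} C]

/-- The set of isomorphism classes of objects. -/
abbrev IsoClass : Type w := Quotient (isIsomorphicSetoid C)

variable {C} in
/-- The isomorphism class of an object. -/
abbrev isoClass (M : C) : IsoClass C := Quotient.mk (isIsomorphicSetoid C) M

variable [Abelian C]

/-- The Grothendieck group: the abelian group generated by the isomorphism classes of objects, with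
a relation `[S₂] = [S₁] + [S₃]` for each short exact sequence `0 ⟶ S₁ ⟶ S₂ ⟶ S₃ ⟶ 0`. -/
abbrev K0 : Type w :=
  FreeAbelianGroup (IsoClass C) ⧸ AddSubgroup.closure
    {x | ∃ S : ShortComplex C, S.ShortExact ∧
      x = FreeAbelianGroup.of (isoClass S.X₁) + FreeAbelianGroup.of (isoClass S.X₃) -
        FreeAbelianGroup.of (isoClass S.X₂)}

variable {C}

/-- The image in the Grothendieck group of an isomorphism class. -/
def K0.ofClass (x : IsoClass C) : K0 C := QuotientAddGroup.mk (FreeAbelianGroup.of x)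

/-- The class in the Grothendieck group of an object. -/
def K0.of (M : C) : K0 C := K0.ofClass (isoClass M)

/-- The number of pairs `(f, g)` such that `0 ⟶ N ⟶ E ⟶ M ⟶ 0`, with maps `f` and `g`, is exact. -/
def hallP (M N E : C) : ℕ :=
  Nat.card {p : (N ⟶ E) × (E ⟶ M) //
    ∃ h : p.1 ≫ p.2 = 0, (ShortComplex.mk p.1 p.2 h).ShortExact}

/-- The number of automorphisms of an object. -/
def autCard (M : C) : ℕ := Nat.card (Aut M)

theorem components_supported (x : IsoClass C →₀ ℝ) (d : K0 C)
    (hx : x ∈ Finsupp.supported ℝ ℝ {c : IsoClass C | K0.ofClass c = d}) :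
    Finsupp.lsum ℝ (fun c => (Finsupp.lsingle (K0.ofClass c) :
        (IsoClass C →₀ ℝ) →ₗ[ℝ] (K0 C →₀ (IsoClass C →₀ ℝ))) ∘ₗ Finsupp.lsingle c) x =
      Finsupp.single d x := by
  rw [Finsupp.supported_eq_span_single] at hx
  have : Submodule.span ℝ ((fun i => Finsupp.single i (1 : ℝ)) ''
      {c : IsoClass C | K0.ofClass c = d}) ≤ LinearMap.eqLocus
        (Finsupp.lsum ℝ (fun c => (Finsupp.lsingle (K0.ofClass c) :
          (IsoClass C →₀ ℝ) →ₗ[ℝ] (K0 C →₀ (IsoClass C →₀ ℝ))) ∘ₗ Finsupp.lsingle c))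
        (Finsupp.lsingle d) := by
    refine Submodule.span_le.2 ?_
    rintro _ ⟨c, rfl, rfl⟩
    simp
  exact this hx

/-- The vector space with basis the isomorphism classes of objects, in which the basis vector of
`M` has as its degree the class of `M` in the Grothendieck group. -/
@[reducible]
def hallObj (χ : K0 C →+ K0 C →+ ℤ) (q : ℝˣ) : KVect χ q where
  carrier := IsoClass C →₀ ℝ
  piece d := Finsupp.supported ℝ ℝ {c | K0.ofClass c = d}
  indep := KVect.iSupIndep_of_coaction _ _ fun d x hx => components_supported x d hx
  iSup_eq_top := by
    rw [← Finsupp.supported_iUnion, ← Finsupp.supported_univ]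
    congr 1
    ext c
    simp

/-- The basis vector of the Hall algebra given by an object. -/
def hallBasis (M : C) : IsoClass C →₀ ℝ := Finsupp.single (isoClass M) 1

end Hall

/-! ### Quivers and their representations -/

/-- The connected simply laced Dynkin diagrams. -/
inductive ADEType
  | A (n : ℕ) (hn : 1 ≤ n)
  | D (n : ℕ) (hn : 4 ≤ n)
  | E₆
  | E₇
  | E₈

/-- The number of vertices. -/
def ADEType.rank : ADEType → ℕ
  | .A n _ => n
  | .D n _ => n
  | .E₆ => 6
  | .E₇ => 7
  | .E₈ => 8

/-- The Cartan matrix. -/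
def ADEType.cartan : (t : ADEType) → Matrix (Fin t.rank) (Fin t.rank) ℤ
  | .A n _ => CartanMatrix.A n
  | .D n _ => CartanMatrix.D n
  | .E₆ => CartanMatrix.E₆
  | .E₇ => CartanMatrix.E₇
  | .E₈ => CartanMatrix.E₈

/-- The underlying graph of the quiver is a finite disjoint union of Dynkin diagrams of type
`A`, `D`, `E`: there are no loops, and the number of arrows, in either direction, between
two distinct vertices is the negative of the entry of the Cartan matrix. -/
def IsSimplyLacedDynkin (V : Type u) [Quiver.{u} V] : Prop :=
  (∀ x y : V, Finite (x ⟶ y)) ∧ (∀ x : V, IsEmpty (x ⟶ x)) ∧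
    ∃ (r : ℕ) (t : Fin r → ADEType) (e : V ≃ Σ i, Fin (t i).rank), ∀ x y : V, x ≠ y →
      (Nat.card (x ⟶ y) + Nat.card (y ⟶ x) : ℤ) =
        -Matrix.blockDiagonal' (fun i => (t i).cartan) (e x) (e y)

/-- Finite-dimensional representations of a quiver: functors from its path category to
finite-dimensional vector spaces. -/
abbrev QuiverRep (k : Type u) [Field k] (V : Type u) [Quiver.{u} V] : Type (u + 1) :=
  Paths V ⥤ FGModuleCat.{u} k

section Euler

variable {k : Type u} [Field k] {V : Type u} [Quiver.{u} V]

instance QuiverRep.hasExt : HasExt.{u + 1} (QuiverRep k V) := HasExt.standard _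

/-- The `k`-vector space `Ext^i(M, N)` in the category of representations. -/
abbrev repExt (M N : QuiverRep k V) (i : ℕ) : Type (u + 1) := Abelian.Ext.{u + 1} M N i

/-- The Euler form `∑ i, (-1)^i dim Ext^i(M, N)`. -/
def eulerForm (M N : QuiverRep k V) : ℤ :=
  ∑ᶠ i : ℕ, (-1) ^ i * (Module.finrank k (repExt M N i) : ℤ)

variable (k) in
/-- The number of elements of a finite field, as a nonzero real number. -/
def cardUnit [Finite k] : ℝˣ := Units.mk0 (Nat.card k : ℝ) (Nat.cast_ne_zero.2 Nat.card_pos.ne')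

end Euler

end

/-!
Over a finite field the structure constants of the multiplication and of the comultiplication both
count short exact sequences, and associativity and coassociativity say that a two-step filtration
can be counted from either end. In terms of these counts the compatibility of the two structures is
Green's formula: count the pairs of short exact sequences `N ⟶ E ⟶ M`, `B ⟶ E ⟶ A` with the same
middle term by the four corners of the three by three diagram which they generate. Given the four
outer sequences of such a diagram, the completions are the liftings of an extension along a map, and
in a hereditary category their number is `|Ext¹| / |Hom|` for the two opposite corners that the
braiding interchanges. By the definition of the Euler form this is `q ^ (-⟨·, ·⟩)`, the coefficient
of the braiding. Representations of a finite quiver without oriented cycles are hereditary by the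
standard two-term resolution, and a quiver whose underlying graph is a forest has no oriented cycle.

The antipode is the inverse of the identity under convolution; it is found by recursion on the
number of subobjects. On a simple object only the two trivial short exact sequences contribute, so
that `S([M]) + [M] = 0`.
-/

/-! ### Finiteness of the set of paths -/

/-- A numbering of the index set of a symmetric integer matrix with off-diagonal entries in
`{0, -1}`, for which every index has at most one neighbour (in the graph of nonzero entries) with a
smaller number. Such a numbering exists exactly when the graph is a forest. -/
structure IsForestNumbering {ι : Type*} (A : Matrix ι ι ℤ) (o : ι → ℕ) : Prop where
  neg_one_le : ∀ {i j}, i ≠ j → -1 ≤ A i j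
  ne_of_apply_ne_zero : ∀ {i j}, i ≠ j → A i j ≠ 0 → o i ≠ o j
  eq_of_lt : ∀ {i₁ i₂ j}, o i₁ < o j → o i₂ < o j → A i₁ j ≠ 0 → A i₂ j ≠ 0 → i₁ = i₂

namespace IsForestNumbering

theorem comp_of_injective {ι κ : Type*} {A : Matrix ι ι ℤ} {o : ι → ℕ}
    (h : IsForestNumbering A o) {e : κ → ι} (he : Function.Injective e) :
    IsForestNumbering (A.submatrix e e) (o ∘ e) where
  neg_one_le hij := h.neg_one_le (he.ne hij)
  ne_of_apply_ne_zero hij := h.ne_of_apply_ne_zero (he.ne hij)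
  eq_of_lt h₁ h₂ a₁ a₂ := he (h.eq_of_lt h₁ h₂ a₁ a₂)

theorem blockDiagonal' {ι : Type*} [DecidableEq ι] {κ : ι → Type*}
    {A : ∀ i, Matrix (κ i) (κ i) ℤ} {o : ∀ i, κ i → ℕ}
    (h : ∀ i, IsForestNumbering (A i) (o i)) :
    IsForestNumbering (Matrix.blockDiagonal' A) fun p => o p.1 p.2 where
  neg_one_le := by
    rintro ⟨i, a⟩ ⟨j, b⟩ hab
    obtain rfl | hij := eq_or_ne i j
    · rw [Matrix.blockDiagonal'_apply_eq]
      exact (h i).neg_one_le (by rintro rfl; exact hab rfl)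
    · rw [Matrix.blockDiagonal'_apply_ne _ _ _ hij]
      norm_num
  ne_of_apply_ne_zero := by
    rintro ⟨i, a⟩ ⟨j, b⟩ hab hA
    obtain rfl | hij := eq_or_ne i j
    · rw [Matrix.blockDiagonal'_apply_eq] at hA
      exact (h i).ne_of_apply_ne_zero (by rintro rfl; exact hab rfl) hA
    · exact absurd (Matrix.blockDiagonal'_apply_ne _ _ _ hij) hA
  eq_of_lt := by
    rintro ⟨i₁, a₁⟩ ⟨i₂, a₂⟩ ⟨j, b⟩ h₁ h₂ hA₁ hA₂
    obtain rfl | hi₁ := eq_or_ne i₁ j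
    · obtain rfl | hi₂ := eq_or_ne i₂ i₁
      · rw [Matrix.blockDiagonal'_apply_eq] at hA₁ hA₂
        exact congrArg (Sigma.mk _) ((h _).eq_of_lt h₁ h₂ hA₁ hA₂)
      · exact absurd (Matrix.blockDiagonal'_apply_ne _ _ _ hi₂) hA₂
    · exact absurd (Matrix.blockDiagonal'_apply_ne _ _ _ hi₁) hA₁

end IsForestNumbering

/-- A numbering of the vertices of a Dynkin diagram that exhibits it as a tree. In Mathlib's
(Bourbaki's) labelling of `E₆`, `E₇` and `E₈` the branch vertex has two neighbours with smaller
labels, so there the labels are reversed. -/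
def ADEType.numbering : (t : ADEType) → Fin t.rank → ℕ
  | .A _ _ => fun i => i.val
  | .D _ _ => fun i => i.val
  | .E₆ => fun i => (Fin.rev i).val
  | .E₇ => fun i => (Fin.rev i).val
  | .E₈ => fun i => (Fin.rev i).val

theorem ADEType.numbering_injective (t : ADEType) : Function.Injective t.numbering := by
  cases t
  case A | D => exact Fin.val_injective
  all_goals exact Fin.val_injective.comp Fin.rev_injective

theorem ADEType.neg_one_le_cartan (t : ADEType) :
    ∀ j i : Fin t.rank, i ≠ j → -1 ≤ t.cartan i j := by
  cases t with
  | A n =>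
    intro (j : Fin n) (i : Fin n) hij
    change -1 ≤ CartanMatrix.A n i j
    simp only [CartanMatrix.A, Matrix.of_apply]
    grind
  | D n =>
    intro (j : Fin n) (i : Fin n) hij
    change -1 ≤ CartanMatrix.D n i j
    simp only [CartanMatrix.D, Matrix.of_apply]
    grind
  | E₆ =>
    change ∀ j i : Fin 6, i ≠ j → -1 ≤ CartanMatrix.E₆ i j
    decide
  | E₇ =>
    change ∀ j i : Fin 7, i ≠ j → -1 ≤ CartanMatrix.E₇ i j
    decide
  | E₈ =>
    change ∀ j i : Fin 8, i ≠ j → -1 ≤ CartanMatrix.E₈ i j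
    decide

theorem ADEType.eq_of_numbering_lt (t : ADEType) :
    ∀ j i₁ i₂ : Fin t.rank, t.numbering i₁ < t.numbering j → t.numbering i₂ < t.numbering j →
      t.cartan i₁ j ≠ 0 → t.cartan i₂ j ≠ 0 → i₁ = i₂ := by
  cases t with
  | A n =>
    intro (j : Fin n) (i₁ : Fin n) (i₂ : Fin n) (h₁ : i₁.val < j.val) (h₂ : i₂.val < j.val)
      (a₁ : CartanMatrix.A n i₁ j ≠ 0) (a₂ : CartanMatrix.A n i₂ j ≠ 0)
    simp only [CartanMatrix.A, Matrix.of_apply] at a₁ a₂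
    ext
    grind
  | D n =>
    intro (j : Fin n) (i₁ : Fin n) (i₂ : Fin n) (h₁ : i₁.val < j.val) (h₂ : i₂.val < j.val)
      (a₁ : CartanMatrix.D n i₁ j ≠ 0) (a₂ : CartanMatrix.D n i₂ j ≠ 0)
    simp only [CartanMatrix.D, Matrix.of_apply] at a₁ a₂
    ext
    grind
  | E₆ =>
    change ∀ j i₁ i₂ : Fin 6, i₁.rev.val < j.rev.val → i₂.rev.val < j.rev.val →
      CartanMatrix.E₆ i₁ j ≠ 0 → CartanMatrix.E₆ i₂ j ≠ 0 → i₁ = i₂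
    decide
  | E₇ =>
    change ∀ j i₁ i₂ : Fin 7, i₁.rev.val < j.rev.val → i₂.rev.val < j.rev.val →
      CartanMatrix.E₇ i₁ j ≠ 0 → CartanMatrix.E₇ i₂ j ≠ 0 → i₁ = i₂
    decide
  | E₈ =>
    change ∀ j i₁ i₂ : Fin 8, i₁.rev.val < j.rev.val → i₂.rev.val < j.rev.val →
      CartanMatrix.E₈ i₁ j ≠ 0 → CartanMatrix.E₈ i₂ j ≠ 0 → i₁ = i₂
    decide

theorem ADEType.isForestNumbering (t : ADEType) : IsForestNumbering t.cartan t.numbering where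
  neg_one_le := t.neg_one_le_cartan _ _
  ne_of_apply_ne_zero hij _ := t.numbering_injective.ne hij
  eq_of_lt := t.eq_of_numbering_lt _ _ _

section Quiver

variable {V : Type*} [Quiver V]

/-- Two vertices of a quiver are linked if there is an arrow between them, in either direction. -/
def Linked (x y : V) : Prop := Nonempty (x ⟶ y) ∨ Nonempty (y ⟶ x)

open Classical in
/-- The potential is defined by recursion along the order: it is propagated from the unique smaller
vertex that is linked to the given one. -/
theorem exists_potential {α : Type*} [LinearOrder α] [WellFoundedLT α] (o : V → α)
    (ne_of_hom : ∀ x y : V, (x ⟶ y) → o x ≠ o y)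
    (isEmpty_of_hom : ∀ x y : V, (x ⟶ y) → IsEmpty (y ⟶ x))
    (eq_of_lt : ∀ x₁ x₂ y : V, o x₁ < o y → o x₂ < o y → Linked x₁ y → Linked x₂ y → x₁ = x₂) :
    ∃ h : V → ℤ, ∀ x y : V, (x ⟶ y) → h y = h x + 1 := by
  let step (y : V) (ih : ∀ x : V, o x < o y → ℤ) : ℤ :=
    if hy : ∃ x : V, o x < o y ∧ Linked x y then
      ih hy.choose hy.choose_spec.1 + if Nonempty (hy.choose ⟶ y) then 1 else -1
    else 0
  have wf : WellFounded fun x y : V => o x < o y := InvImage.wf o wellFounded_lt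
  let h : V → ℤ := wf.fix step
  have h_of_lt (x y : V) (hxy : o x < o y) (hl : Linked x y) :
      h y = h x + if Nonempty (x ⟶ y) then 1 else -1 := by
    have hy : ∃ x : V, o x < o y ∧ Linked x y := ⟨x, hxy, hl⟩
    have hx : hy.choose = x := eq_of_lt _ _ y hy.choose_spec.1 hxy hy.choose_spec.2 hl
    have fix_eq : h y = step y fun z _ => h z := wf.fix_eq step y
    rw [fix_eq]
    simp only [step, dif_pos hy, hx]
  refine ⟨h, fun x y a => ?_⟩
  obtain hlt | hgt := lt_or_gt_of_ne (ne_of_hom x y a)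
  · rw [h_of_lt x y hlt (.inl ⟨a⟩), if_pos ⟨a⟩]
  · have := isEmpty_of_hom x y a
    rw [h_of_lt y x hgt (.inr ⟨a⟩), if_neg (not_nonempty_iff.2 this), neg_add_cancel_right]

theorem IsForestNumbering.exists_potential {A : Matrix V V ℤ} {o : V → ℕ}
    (hA : IsForestNumbering A o) [∀ x y : V, Finite (x ⟶ y)] [∀ x : V, IsEmpty (x ⟶ x)]
    (hcard : ∀ x y : V, x ≠ y → (Nat.card (x ⟶ y) + Nat.card (y ⟶ x) : ℤ) = -A x y) :
    ∃ h : V → ℤ, ∀ x y : V, (x ⟶ y) → h y = h x + 1 := by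
  have ne_of_linked (x y : V) (h : Linked x y) : x ≠ y := by
    rintro rfl
    exact h.elim not_isEmpty_iff.2 not_isEmpty_iff.2 inferInstance
  have card_pos (x y : V) (a : x ⟶ y) : 0 < Nat.card (x ⟶ y) :=
    have : Nonempty (x ⟶ y) := ⟨a⟩
    Nat.card_pos
  have apply_ne_zero (x y : V) (h : Linked x y) : A x y ≠ 0 := by
    have := hcard x y (ne_of_linked x y h)
    obtain ⟨⟨a⟩⟩ | ⟨⟨a⟩⟩ := h <;> have := card_pos _ _ a <;> omega
  refine _root_.exists_potential o (fun x y a => ?_) (fun x y a => ⟨fun b => ?_⟩)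
    fun x₁ x₂ y h₁ h₂ l₁ l₂ => ?_
  · exact hA.ne_of_apply_ne_zero (ne_of_linked x y (.inl ⟨a⟩)) (apply_ne_zero x y (.inl ⟨a⟩))
  · have hxy := ne_of_linked x y (.inl ⟨a⟩)
    have := hcard x y hxy
    have := hA.neg_one_le hxy
    have := card_pos x y a
    have := card_pos y x b
    omega
  · exact hA.eq_of_lt h₁ h₂ (apply_ne_zero x₁ y l₁) (apply_ne_zero x₂ y l₂)

theorem finite_path_of_lt [Finite V] [∀ x y : V, Finite (x ⟶ y)] {α : Type*} [Preorder α]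
    (h : V → α) (lt_of_hom : ∀ x y : V, (x ⟶ y) → h x < h y) (x y : V) :
    Finite (Quiver.Path x y) := by
  have : IsTrans V (h · < h ·) := ⟨fun _ _ _ => lt_trans⟩
  have : Std.Irrefl fun a b : V => h a < h b := ⟨fun _ => lt_irrefl _⟩
  induction y using (Finite.wellFounded_of_trans_of_irrefl fun a b : V => h a < h b).induction with
  | _ y ih =>
    let W := {z : V // Nonempty (z ⟶ y)}
    have (z : W) : Finite (Quiver.Path x z.1) := z.2.elim fun a => ih z.1 (lt_of_hom z.1 y a)
    let split : PLift (x = y) ⊕ (Σ z : W, Quiver.Path x z.1 × (z.1 ⟶ y)) → Quiver.Path x y :=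
      Sum.elim (fun e => e.down ▸ Quiver.Path.nil) fun s => s.2.1.cons s.2.2
    refine Finite.of_surjective split ?_
    rintro (_ | ⟨p, a⟩)
    · exact ⟨.inl ⟨rfl⟩, rfl⟩
    · exact ⟨.inr ⟨⟨_, ⟨a⟩⟩, p, a⟩, rfl⟩

end Quiver

namespace IsSimplyLacedDynkin

variable {V : Type u} [Quiver.{u} V]

theorem finite_vertices (hQ : IsSimplyLacedDynkin V) : Finite V := by
  obtain ⟨-, -, r, t, e, -⟩ := hQ
  exact Finite.of_equiv _ e.symm

theorem finite_path (hQ : IsSimplyLacedDynkin V) (x y : V) : Finite (Quiver.Path x y) := by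
  have := hQ.finite_vertices
  obtain ⟨_, _, r, t, e, hcard⟩ := hQ
  have hA := (IsForestNumbering.blockDiagonal' fun i => (t i).isForestNumbering).comp_of_injective
    e.injective
  obtain ⟨h, hh⟩ := hA.exists_potential hcard
  exact finite_path_of_lt h (fun x y a => by rw [hh x y a]; exact lt_add_one _) x y

end IsSimplyLacedDynkin

/-! ### Representations of a quiver form a hereditary category -/

section FGModule

variable {k : Type u} [Field k]

theorem injective_of_mono_fgModuleCat {A B : FGModuleCat.{u} k} (f : A ⟶ B) [Mono f] :
    Function.Injective f.hom.hom :=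
  (ModuleCat.mono_iff_injective _).1
    (inferInstanceAs (Mono ((forget₂ (FGModuleCat k) (ModuleCat.{u} k)).map f)))

theorem surjective_of_epi_fgModuleCat {A B : FGModuleCat.{u} k} (f : A ⟶ B) [Epi f] :
    Function.Surjective f.hom.hom :=
  (ModuleCat.epi_iff_surjective _).1
    (inferInstanceAs (Epi ((forget₂ (FGModuleCat k) (ModuleCat.{u} k)).map f)))

instance injective_fgModuleCat (W : FGModuleCat.{u} k) : Injective W where
  factors g f _ := by
    obtain ⟨r, hr⟩ := LinearMap.exists_leftInverse_of_injective f.hom.hom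
      (LinearMap.ker_eq_bot.2 (injective_of_mono_fgModuleCat f))
    refine ⟨ObjectProperty.homMk (ModuleCat.ofHom (g.hom.hom ∘ₗ r)), ?_⟩
    ext x
    exact congrArg g.hom.hom (LinearMap.congr_fun hr x)

instance projective_fgModuleCat (W : FGModuleCat.{u} k) : Projective W where
  factors g f _ := by
    obtain ⟨s, hs⟩ := Module.projective_lifting_property f.hom.hom g.hom.hom
      (surjective_of_epi_fgModuleCat f)
    refine ⟨ObjectProperty.homMk (ModuleCat.ofHom s), ?_⟩
    ext x
    exact LinearMap.congr_fun hs x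

end FGModule

section PathFunctor

open Limits

variable {V : Type u} [Quiver.{u} V] {D : Type v} [Category.{w} D] [Abelian D]

/-- The arrows of the quiver between two objects of its path category. -/
abbrev QuiverArrow (x y : Paths V) : Type u := @Quiver.Hom V _ x y

/-- An arrow of the quiver as a morphism of its path category. -/
def QuiverArrow.path {x y : Paths V} (a : QuiverArrow x y) : x ⟶ y := Quiver.Hom.toPath a

/-- A family of morphisms `C_x ⟶ Q_y` indexed by the arrows `x ⟶ y` of the quiver is the cocycle of
an extension of `C` by `Q` whose components are the direct sums `Q_x ⊞ C_x`; it is a coboundary if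
the extension splits. -/
def IsCoboundary {C Q : Paths V ⥤ D}
    (φ : ∀ x y : Paths V, QuiverArrow x y → (C.obj x ⟶ Q.obj y)) : Prop :=
  ∃ h : ∀ x : Paths V, C.obj x ⟶ Q.obj x, ∀ (x y : Paths V) (a : QuiverArrow x y),
    φ x y a = h x ≫ Q.map a.path - C.map a.path ≫ h y

theorem isCoboundary_of_injective {C Q : Paths V ⥤ D} [Injective Q]
    (φ : ∀ x y : Paths V, QuiverArrow x y → (C.obj x ⟶ Q.obj y)) : IsCoboundary φ := by
  let E : Paths V ⥤ D := Paths.lift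
    { obj := fun x => Q.obj x ⊞ C.obj x
      map := fun {x y} (a : QuiverArrow x y) =>
        biprod.desc (Q.map a.path ≫ biprod.inl) (biprod.lift (φ x y a) (C.map a.path)) }
  have map_E {x y : Paths V} (a : QuiverArrow x y) : E.map a.path =
      (biprod.desc (Q.map a.path ≫ biprod.inl) (biprod.lift (φ x y a) (C.map a.path)) :
        Q.obj x ⊞ C.obj x ⟶ Q.obj y ⊞ C.obj y) := Paths.lift_toPath _ a
  let inl (x : Paths V) : Q.obj x ⟶ E.obj x := (biprod.inl : Q.obj x ⟶ Q.obj x ⊞ C.obj x)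
  let inr (x : Paths V) : C.obj x ⟶ E.obj x := (biprod.inr : C.obj x ⟶ Q.obj x ⊞ C.obj x)
  have inl_map {x y : Paths V} (a : QuiverArrow x y) :
      Q.map a.path ≫ inl y = inl x ≫ E.map a.path := by
    rw [map_E]
    exact biprod.inl_desc _ _ |>.symm
  have inr_map {x y : Paths V} (a : QuiverArrow x y) :
      inr x ≫ E.map a.path = φ x y a ≫ inl y + C.map a.path ≫ inr y := by
    rw [map_E]
    exact (biprod.inr_desc _ _).trans biprod.lift_eq
  let ι : Q ⟶ E := Paths.liftNatTrans inl inl_map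
  have : ∀ x, Mono (ι.app x) := fun x =>
    inferInstanceAs (Mono (biprod.inl : Q.obj x ⟶ Q.obj x ⊞ C.obj x))
  have : Mono ι := NatTrans.mono_of_mono_app ι
  let r : E ⟶ Q := Injective.factorThru (𝟙 Q) ι
  have inl_r (x : Paths V) : inl x ≫ r.app x = 𝟙 _ :=
    congrArg (fun t => NatTrans.app t x) (Injective.comp_factorThru (𝟙 Q) ι)
  refine ⟨fun x => inr x ≫ r.app x, fun x y a => ?_⟩
  rw [Category.assoc, ← r.naturality, reassoc_of% (inr_map a)]
  simp [inl_r]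

theorem IsCoboundary.comp {C I Q : Paths V ⥤ D}
    {φ : ∀ x y : Paths V, QuiverArrow x y → (C.obj x ⟶ I.obj y)} (hφ : IsCoboundary φ)
    (p : I ⟶ Q) : IsCoboundary fun x y a => φ x y a ≫ p.app y := by
  obtain ⟨h, hh⟩ := hφ
  exact ⟨fun x => h x ≫ p.app x, fun x y a => by simp [hh x y a]⟩

theorem isCoboundary_of_epi [∀ X : D, Projective X] {C I Q : Paths V ⥤ D} [Injective I]
    (p : I ⟶ Q) [Epi p] (φ : ∀ x y : Paths V, QuiverArrow x y → (C.obj x ⟶ Q.obj y)) :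
    IsCoboundary φ := by
  simpa only [Projective.factorThru_comp] using (isCoboundary_of_injective
    fun x y (a : QuiverArrow x y) => Projective.factorThru (φ x y a) (p.app y)).comp p

theorem exists_retraction_of_isCoboundary [∀ X : D, Projective X] {Q E : Paths V ⥤ D}
    (u : Q ⟶ E) [Mono u]
    (H : ∀ φ : ∀ x y : Paths V, QuiverArrow x y → ((cokernel u).obj x ⟶ Q.obj y),
      IsCoboundary φ) :
    ∃ r : E ⟶ Q, u ≫ r = 𝟙 Q := by
  let T : ShortComplex (Paths V ⥤ D) := ShortComplex.mk u (cokernel.π u) (cokernel.condition u)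
  have hT : T.ShortExact :=
    ShortComplex.ShortExact.mk' (ShortComplex.exact_cokernel u) inferInstance inferInstance
  let S (x : Paths V) : ShortComplex D := T.map ((evaluation _ _).obj x)
  have exact_app (x : Paths V) : (S x).ShortExact := hT.map_of_exact _
  let σ (x : Paths V) : (S x).Splitting :=
    have := (exact_app x).epi_g
    ShortComplex.Splitting.ofExactOfSection _ (exact_app x).exact
      (Projective.factorThru (𝟙 _) _) (Projective.factorThru_comp _ _) (exact_app x).mono_f
  let π : E ⟶ cokernel u := cokernel.π u
  let s (x : Paths V) : (cokernel u).obj x ⟶ E.obj x := (σ x).s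
  let ρ (x : Paths V) : E.obj x ⟶ Q.obj x := (σ x).r
  have u_ρ (x : Paths V) : u.app x ≫ ρ x = 𝟙 _ := (σ x).f_r
  have u_π (x : Paths V) : u.app x ≫ π.app x = 0 := (S x).zero
  have id_eq (x : Paths V) : ρ x ≫ u.app x + π.app x ≫ s x = 𝟙 _ := (σ x).id
  obtain ⟨h, coboundary : ∀ (x y : Paths V) (a : QuiverArrow x y), s x ≫ E.map a.path ≫ ρ y =
      h x ≫ Q.map a.path - (cokernel u).map a.path ≫ h y⟩ :=
    H fun x y a => s x ≫ E.map a.path ≫ ρ y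
  have naturality {x y : Paths V} (a : QuiverArrow x y) : E.map a.path ≫ (ρ y + π.app y ≫ h y) =
      (ρ x + π.app x ≫ h x) ≫ Q.map a.path := by
    have map_ρ : E.map a.path ≫ ρ y =
        ρ x ≫ Q.map a.path + π.app x ≫ s x ≫ E.map a.path ≫ ρ y := by
      nth_rw 1 [← Category.id_comp (E.map a.path), ← id_eq x]
      simp only [Preadditive.add_comp, Category.assoc, ← u.naturality_assoc, u_ρ, Category.comp_id]
    rw [Preadditive.comp_add, map_ρ, coboundary x y a, π.naturality_assoc]
    simp only [Preadditive.comp_sub, Preadditive.add_comp, Category.assoc]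
    abel
  refine ⟨Paths.liftNatTrans (fun x => ρ x + π.app x ≫ h x) naturality, ?_⟩
  ext x
  change u.app x ≫ (ρ x + π.app x ≫ h x) = 𝟙 _
  rw [Preadditive.comp_add, u_ρ, reassoc_of% (u_π x), zero_comp, add_zero]

theorem injective_pathFunctor_of_epi [∀ X : D, Projective X] {I Q : Paths V ⥤ D} [Injective I]
    (p : I ⟶ Q) [Epi p] : Injective Q where
  factors g f _ := by
    obtain ⟨r, hr⟩ := exists_retraction_of_isCoboundary (pushout.inl g f) (isCoboundary_of_epi p)
    exact ⟨pushout.inr g f ≫ r, by rw [← pushout.condition_assoc, hr, Category.comp_id]⟩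

theorem hasInjectiveDimensionLT_two_pathFunctor [EnoughInjectives (Paths V ⥤ D)]
    [∀ X : D, Projective X] (M : Paths V ⥤ D) : HasInjectiveDimensionLT M 2 := by
  have : Injective (cokernel (Injective.ι M)) :=
    injective_pathFunctor_of_epi (cokernel.π (Injective.ι M))
  have hS : (ShortComplex.mk _ _ (cokernel.condition (Injective.ι M))).ShortExact :=
    ShortComplex.ShortExact.mk' (ShortComplex.exact_cokernel _) inferInstance inferInstance
  exact (hS.hasInjectiveDimensionLT_X₃_iff 0 inferInstance).1
    (inferInstanceAs (HasInjectiveDimensionLT (cokernel (Injective.ι M)) 1))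

end PathFunctor

section EnoughInjectives

open Limits

theorem enoughInjectives_functor {J : Type u} [Category.{v} J] [Finite J]
    [∀ a b : J, Finite (a ⟶ b)] {D : Type*} [Category* D] [Abelian D] [EnoughInjectives D] :
    EnoughInjectives (J ⥤ D) where
  presentation M := by
    let coind (x : J) : J ⥤ D := (evaluationRightAdjoint D x).obj (Injective.under (M.obj x))
    have (x : J) : Injective (coind x) :=
      Injective.injective_of_adjoint (evaluationAdjunctionLeft D x) _
    let η (x : J) : M ⟶ coind x :=
      (evaluationAdjunctionLeft D x).homEquiv _ _ (Injective.ι (M.obj x))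
    refine ⟨⟨∏ᶜ coind, inferInstance, Pi.lift η, ?_⟩⟩
    refine Preadditive.mono_of_cancel_zero _ fun {T} g hg => ?_
    ext x
    have comp_η : g ≫ η x = 0 := by simpa using hg =≫ Pi.π coind x
    have app_comp_ι : g.app x ≫ Injective.ι (M.obj x) = 0 := by
      refine ((evaluationAdjunctionLeft D x).homEquiv _ _).injective ?_
      refine ((evaluationAdjunctionLeft D x).homEquiv_naturality_left _ _).trans ?_
      exact comp_η.trans ((evaluationAdjunctionLeft D x).homAddEquiv_zero _ _).symm
    exact zero_of_comp_mono _ app_comp_ι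

end EnoughInjectives
/-! ### Short exact sequences with given end terms -/

section Extensions

open Limits Abelian

variable {C : Type u} [Category.{v} C] [Abelian C]

/-- The sequence `0 ⟶ N ⟶ E ⟶ M ⟶ 0` with maps `f` and `g` is exact. -/
def IsExt {N E M : C} (f : N ⟶ E) (g : E ⟶ M) : Prop :=
  ∃ h : f ≫ g = 0, (ShortComplex.mk f g h).ShortExact

/-- A short exact sequence `0 ⟶ N ⟶ E ⟶ M ⟶ 0`; these are what `hallP M N E` counts. -/
@[ext]
structure HallPair (M N E : C) : Type v where
  ι : N ⟶ E
  π : E ⟶ M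
  isExt : IsExt ι π

instance {M N E : C} [Finite (N ⟶ E)] [Finite (E ⟶ M)] : Finite (HallPair M N E) :=
  Finite.of_injective (fun z => (z.ι, z.π)) fun _ _ h =>
    HallPair.ext (congrArg Prod.fst h) (congrArg Prod.snd h)

theorem hallP_eq_card_hallPair (M N E : C) : hallP M N E = Nat.card (HallPair M N E) :=
  Nat.card_congr ⟨fun p => ⟨p.1.1, p.1.2, p.2⟩, fun z => ⟨(z.ι, z.π), z.isExt⟩,
    fun _ => rfl, fun _ => rfl⟩

namespace IsExt

variable {N E M : C} {f : N ⟶ E} {g : E ⟶ M}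

theorem zero (h : IsExt f g) : f ≫ g = 0 := h.1

theorem shortExact (h : IsExt f g) : (ShortComplex.mk f g h.zero).ShortExact := h.2

theorem mono (h : IsExt f g) : Mono f := h.2.mono_f

theorem epi (h : IsExt f g) : Epi g := h.2.epi_g

theorem exists_lift (h : IsExt f g) {T : C} (t : T ⟶ E) (ht : t ≫ g = 0) :
    ∃ s : T ⟶ N, s ≫ f = t :=
  have := h.mono
  ⟨h.2.exact.lift t ht, h.2.exact.lift_f t ht⟩

theorem exists_desc (h : IsExt f g) {T : C} (t : E ⟶ T) (ht : f ≫ t = 0) :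
    ∃ s : M ⟶ T, g ≫ s = t :=
  have := h.epi
  ⟨h.2.exact.desc t ht, h.2.exact.g_desc t ht⟩

theorem of_isLimit_kernelFork {hz : f ≫ g = 0} (h : IsLimit (KernelFork.ofι f hz)) [Epi g] :
    IsExt f g :=
  ⟨hz, ShortComplex.ShortExact.mk' (ShortComplex.exact_of_f_is_kernel (.mk f g hz) h)
    (mono_of_isLimit_fork h) inferInstance⟩

theorem of_isColimit_cokernelCofork {hz : f ≫ g = 0} (h : IsColimit (CokernelCofork.ofπ g hz))
    [Mono f] : IsExt f g :=
  ⟨hz, ShortComplex.ShortExact.mk' (ShortComplex.exact_of_g_is_cokernel (.mk f g hz) h)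
    inferInstance (epi_of_isColimit_cofork h)⟩

theorem of_exists_lift [Mono f] [Epi g] (hz : f ≫ g = 0)
    (hl : ∀ (T : C) (t : T ⟶ E), t ≫ g = 0 → ∃ s : T ⟶ N, s ≫ f = t) : IsExt f g := by
  choose l hl using hl
  exact of_isLimit_kernelFork (hz := hz)
    (KernelFork.IsLimit.ofι' f hz fun t ht => ⟨l _ t ht, hl _ t ht⟩)

theorem of_exists_desc [Mono f] [Epi g] (hz : f ≫ g = 0)
    (hd : ∀ (T : C) (t : E ⟶ T), f ≫ t = 0 → ∃ s : M ⟶ T, g ≫ s = t) : IsExt f g := by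
  choose d hd using hd
  exact of_isColimit_cokernelCofork (hz := hz)
    (CokernelCofork.IsColimit.ofπ' g hz fun t ht => ⟨d _ t ht, hd _ t ht⟩)

theorem biprod (N M : C) : IsExt (biprod.inl : N ⟶ N ⊞ M) biprod.snd :=
  of_isLimit_kernelFork (hz := biprod.inl_snd) (biprod.isKernelSndKernelFork N M)

theorem of_mono (f : N ⟶ E) [Mono f] : IsExt f (cokernel.π f) :=
  of_isColimit_cokernelCofork (hz := cokernel.condition f) (cokernelIsCokernel f)

theorem comp_isos {N' E' M' : C} (h : IsExt f g) (a : N' ≅ N) (e : E ≅ E') (b : M ≅ M') :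
    IsExt (a.hom ≫ f ≫ e.hom) (e.inv ≫ g ≫ b.hom) := by
  refine ⟨by simp [reassoc_of% h.zero], ShortComplex.shortExact_of_iso ?_ h.shortExact⟩
  exact ShortComplex.isoMk a.symm e b (by simp) (by simp)

theorem iso_left {N' : C} (h : IsExt f g) (a : N' ≅ N) : IsExt (a.hom ≫ f) g := by
  simpa using h.comp_isos a (Iso.refl _) (Iso.refl _)

theorem iso_middle {E' : C} (h : IsExt f g) (e : E ≅ E') : IsExt (f ≫ e.hom) (e.inv ≫ g) := by
  simpa using h.comp_isos (Iso.refl _) e (Iso.refl _)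

theorem iso_right {M' : C} (h : IsExt f g) (b : M ≅ M') : IsExt f (g ≫ b.hom) := by
  simpa using h.comp_isos (Iso.refl _) (Iso.refl _) b

theorem exists_isos {N' M' : C} {f' : N' ⟶ E} {g' : E ⟶ M'} (h : IsExt f g) (h' : IsExt f' g')
    (h₁ : f ≫ g' = 0) (h₂ : f' ≫ g = 0) :
    ∃ (a : N' ≅ N) (b : M ≅ M'), a.hom ≫ f = f' ∧ g ≫ b.hom = g' := by
  have := h.mono
  have := h'.mono
  have := h.epi
  have := h'.epi
  obtain ⟨s, hs⟩ := h.exists_lift f' h₂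
  obtain ⟨t, ht⟩ := h'.exists_lift f h₁
  obtain ⟨s', hs'⟩ := h.exists_desc g' h₁
  obtain ⟨t', ht'⟩ := h'.exists_desc g h₂
  exact ⟨⟨s, t, by simp [← cancel_mono f', ht, hs], by simp [← cancel_mono f, ht, hs]⟩,
    ⟨s', t', by simp [← cancel_epi g, ht', reassoc_of% hs'],
      by simp [← cancel_epi g', hs', reassoc_of% ht']⟩, hs, hs'⟩

theorem exists_iso_left {N' : C} {f' : N' ⟶ E} (h : IsExt f g) (h' : IsExt f' g) :
    ∃ a : N' ≅ N, a.hom ≫ f = f' :=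
  let ⟨a, _, ha, _⟩ := h.exists_isos h' h.zero h'.zero
  ⟨a, ha⟩

theorem exists_iso_right {M' : C} {g' : E ⟶ M'} (h : IsExt f g) (h' : IsExt f g') :
    ∃ b : M ≅ M', g ≫ b.hom = g' :=
  let ⟨_, b, _, hb⟩ := h.exists_isos h' h'.zero h.zero
  ⟨b, hb⟩

theorem of_isPullback (h : IsExt f g) {P M' : C} {p : P ⟶ E} {g' : P ⟶ M'} {c : M' ⟶ M}
    (sq : IsPullback p g' g c) {f' : N ⟶ P} (h₁ : f' ≫ p = f) (h₂ : f' ≫ g' = 0) :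
    IsExt f' g' := by
  have := h.mono
  have := h.epi
  have : Mono f' := mono_of_mono_fac h₁
  have : Epi g' := epi_snd_of_isLimit _ _ sq.isLimit
  refine of_exists_lift h₂ fun T t ht => ?_
  obtain ⟨s, hs⟩ := h.exists_lift (t ≫ p) (by rw [Category.assoc, sq.w, reassoc_of% ht, zero_comp])
  exact ⟨s, sq.hom_ext (by rw [Category.assoc, h₁, hs]) (by rw [Category.assoc, h₂, comp_zero, ht])⟩

theorem of_isPushout (h : IsExt f g) {P N' : C} {p : E ⟶ P} {f' : N' ⟶ P} {c : N ⟶ N'}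
    (sq : IsPushout f c p f') {g' : P ⟶ M} (h₁ : p ≫ g' = g) (h₂ : f' ≫ g' = 0) :
    IsExt f' g' := by
  have := h.mono
  have := h.epi
  have : Mono f' := mono_inr_of_isColimit _ _ sq.isColimit
  have : Epi g' := epi_of_epi_fac h₁
  refine of_exists_desc h₂ fun T t ht => ?_
  obtain ⟨s, hs⟩ := h.exists_desc (p ≫ t) (by rw [reassoc_of% sq.w, ht, comp_zero])
  exact ⟨s, sq.hom_ext (by rw [reassoc_of% h₁, hs]) (by rw [reassoc_of% h₂, zero_comp, ht])⟩

theorem of_isPullback_image (h : IsExt f g) {P B I : C} {b : B ⟶ E} {p : P ⟶ B} {p' : P ⟶ N}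
    (sq : IsPullback p p' b f) {e : B ⟶ I} {m : I ⟶ M} [Epi e] [Mono m]
    (fac : e ≫ m = b ≫ g) : IsExt p e := by
  have := h.mono
  have : Mono p := MorphismProperty.of_isPullback (P := .monomorphisms C) sq.flip ‹_›
  refine of_exists_lift ?_ fun T t ht => ?_
  · rw [← cancel_mono m, Category.assoc, fac, reassoc_of% sq.w, h.zero, comp_zero, zero_comp]
  · obtain ⟨s, hs⟩ := h.exists_lift (t ≫ b) (by
      rw [Category.assoc, ← fac, reassoc_of% ht, zero_comp])
    exact ⟨sq.lift t s hs.symm, sq.lift_fst _ _ _⟩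

theorem of_isPushout_image (h : IsExt f g) {P B I : C} {b : E ⟶ B} {p : B ⟶ P} {p' : M ⟶ P}
    (sq : IsPushout b g p p') {e : N ⟶ I} {m : I ⟶ B} [Epi e] [Mono m]
    (fac : e ≫ m = f ≫ b) : IsExt m p := by
  have := h.epi
  have : Epi p := MorphismProperty.of_isPushout (P := .epimorphisms C) sq ‹_›
  refine of_exists_desc ?_ fun T t ht => ?_
  · rw [← cancel_epi e, reassoc_of% fac, sq.w, reassoc_of% h.zero, zero_comp, comp_zero]
  · obtain ⟨s, hs⟩ := h.exists_desc (b ≫ t) (by rw [← reassoc_of% fac, ht, comp_zero])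
    exact ⟨sq.desc t s hs.symm, sq.inl_desc _ _ _⟩

theorem comp_iff {K P Q : C} {j : N ⟶ P} {u : P ⟶ K} {a : K ⟶ Q} {a' : Q ⟶ M} (hj : IsExt j u)
    (ha : IsExt a a') {i : P ⟶ E} {v : E ⟶ Q} (sq : i ≫ v = u ≫ a) :
    IsExt i (v ≫ a') ↔ IsExt (j ≫ i) v := by
  have := hj.mono
  have := hj.epi
  have := ha.mono
  have := ha.epi
  constructor <;> intro h
  · have := h.mono
    have := h.epi
    have : Epi v := Preadditive.epi_of_cancel_zero _ fun {T} t ht => by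
      obtain ⟨s, rfl⟩ := ha.exists_desc t (by rw [← cancel_epi u, ← reassoc_of% sq]; simp [ht])
      rw [(cancel_epi (v ≫ a')).1 (show (v ≫ a') ≫ s = (v ≫ a') ≫ 0 by simp [ht]), comp_zero]
    refine of_exists_lift (by rw [Category.assoc, sq, reassoc_of% hj.zero, zero_comp])
      fun T t ht => ?_
    obtain ⟨s, rfl⟩ := h.exists_lift t (by rw [reassoc_of% ht, zero_comp])
    obtain ⟨s', rfl⟩ := hj.exists_lift s (by
      rw [← cancel_mono a, Category.assoc, ← sq, zero_comp]
      simpa using ht)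
    exact ⟨s', (Category.assoc _ _ _).symm⟩
  · have := h.mono
    have := h.epi
    have : Mono i := Preadditive.mono_of_cancel_zero _ fun {T} t ht => by
      obtain ⟨s, rfl⟩ := hj.exists_lift t (by
        rw [← cancel_mono a, Category.assoc, ← sq, reassoc_of% ht, zero_comp, zero_comp])
      rw [(cancel_mono (j ≫ i)).1 (show s ≫ j ≫ i = 0 ≫ j ≫ i by simpa using ht), zero_comp]
    refine of_exists_desc (by rw [reassoc_of% sq, ha.zero, comp_zero]) fun T t ht => ?_
    obtain ⟨s, rfl⟩ := h.exists_desc t (by rw [Category.assoc, ht, comp_zero])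
    obtain ⟨s', rfl⟩ := ha.exists_desc s (by rw [← cancel_epi u, ← reassoc_of% sq, ht, comp_zero])
    exact ⟨s', Category.assoc _ _ _⟩

end IsExt

section Classes

variable [HasExt.{w} C]

/-- The class in `Ext¹(M, N)` of a short exact sequence `0 ⟶ N ⟶ E ⟶ M ⟶ 0`. -/
noncomputable def IsExt.extClass {N E M : C} {f : N ⟶ E} {g : E ⟶ M} (h : IsExt f g) :
    Ext.{w} M N 1 :=
  h.shortExact.extClass

/-- The class in `Ext¹(M, N)` of a short exact sequence with given middle term. -/
noncomputable abbrev HallPair.extClass {M N E : C} (z : HallPair M N E) : Ext.{w} M N 1 :=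
  z.isExt.extClass

namespace IsExt

variable {N E M : C} {f : N ⟶ E} {g : E ⟶ M}

theorem extClass_naturality {N' E' M' : C} {f' : N' ⟶ E'} {g' : E' ⟶ M'} (h : IsExt f g)
    (h' : IsExt f' g') {c : N ⟶ N'} {p : E ⟶ E'} {m : M ⟶ M'} (hc : f ≫ p = c ≫ f')
    (hm : p ≫ g' = g ≫ m) :
    h.extClass.comp (Ext.mk₀ c) (add_zero 1) = (Ext.mk₀ m).comp h'.extClass (zero_add 1) :=
  ShortComplex.ShortExact.extClass_naturality h.shortExact h'.shortExact ⟨c, p, m, hc.symm, hm⟩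

theorem exists_comp_eq_of_extClass_comp_eq_zero (h : IsExt f g) {T : C} (t : N ⟶ T)
    (ht : h.extClass.comp (Ext.mk₀ t) (add_zero 1) = 0) : ∃ p : E ⟶ T, f ≫ p = t := by
  obtain ⟨x, hx⟩ := Ext.contravariant_sequence_exact₁ h.shortExact _ _ (add_zero 1) ht
  obtain ⟨p, rfl⟩ := Ext.homEquiv₀.symm.surjective x
  exact ⟨p, Ext.homEquiv₀.symm.injective (by simpa using hx)⟩

theorem exists_comp_eq_of_comp_extClass_eq_zero (h : IsExt f g) {T : C} (t : T ⟶ M)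
    (ht : (Ext.mk₀ t).comp h.extClass (zero_add 1) = 0) : ∃ s : T ⟶ E, s ≫ g = t := by
  obtain ⟨x, hx⟩ := Ext.covariant_sequence_exact₃ _ h.shortExact _ (zero_add 1) ht
  obtain ⟨s, rfl⟩ := Ext.homEquiv₀.symm.surjective x
  exact ⟨s, Ext.homEquiv₀.symm.injective (by simpa using hx)⟩

theorem extClass_comp (h : IsExt f g) : h.extClass.comp (Ext.mk₀ f) (add_zero 1) = 0 :=
  h.shortExact.extClass_comp

end IsExt

theorem exists_extClass_eq [EnoughInjectives C] {M N : C} (ξ : Ext.{w} M N 1) :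
    ∃ (E : C) (z : HallPair M N E), z.extClass = ξ := by
  have hI := IsExt.of_mono (Injective.ι N)
  obtain ⟨x, hx⟩ := Ext.covariant_sequence_exact₁ _ hI.shortExact ξ (Ext.eq_zero_of_injective _)
    (zero_add 1)
  obtain ⟨c, rfl⟩ := Ext.homEquiv₀.symm.surjective x
  have sq := IsPullback.of_hasPullback (cokernel.π (Injective.ι N)) c
  have lift_fst := sq.lift_fst (Injective.ι N) 0 (by simp)
  have hE := hI.of_isPullback sq lift_fst (sq.lift_snd _ _ _)
  refine ⟨_, ⟨_, _, hE⟩, ?_⟩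
  have := hE.extClass_naturality hI (lift_fst.trans (Category.id_comp _).symm) sq.w
  exact (Ext.comp_mk₀_id _).symm.trans (this.trans hx)

end Classes

section Maps

/-- A map of short exact sequences which is the identity on the quotients and a given map on the
subobjects. -/
@[ext]
structure ExtHom {M N N' E E' : C} (z : HallPair M N E) (z' : HallPair M N' E') (c : N ⟶ N') :
    Type v where
  map : E ⟶ E'
  ι_map : z.ι ≫ map = c ≫ z'.ι
  map_π : map ≫ z'.π = z.π

namespace ExtHom

variable {M N N' E E' : C} {z : HallPair M N E} {z' : HallPair M N' E'} {c : N ⟶ N'}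

theorem isIso {z' : HallPair M N E'} (p : ExtHom z z' (𝟙 N)) : IsIso p.map := by
  let φ : ShortComplex.mk _ _ z.isExt.zero ⟶ ShortComplex.mk _ _ z'.isExt.zero :=
    ⟨𝟙 N, p.map, 𝟙 M, p.ι_map.symm, by simpa using p.map_π⟩
  have : IsIso φ.τ₁ := inferInstanceAs (IsIso (𝟙 N))
  have : IsIso φ.τ₃ := inferInstanceAs (IsIso (𝟙 M))
  exact ShortComplex.isIso₂_of_shortExact_of_isIso₁₃ φ z.isExt.shortExact z'.isExt.shortExact

/-- A map of short exact sequences can be changed by a map from the quotient to the subobject. -/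
theorem card_eq (h : Nonempty (ExtHom z z' c)) :
    Nat.card (ExtHom z z' c) = Nat.card (M ⟶ N') := by
  obtain ⟨p⟩ := h
  have := z.isExt.epi
  have := z'.isExt.mono
  let translate (h : M ⟶ N') : ExtHom z z' c :=
    ⟨p.map + z.π ≫ h ≫ z'.ι, by simp [p.ι_map, reassoc_of% z.isExt.zero],
      by simp [p.map_π, z'.isExt.zero]⟩
  refine (Nat.card_congr (Equiv.ofBijective translate ⟨fun h h' heq => ?_, fun p' => ?_⟩)).symm
  · simpa [translate, cancel_epi, cancel_mono] using congrArg ExtHom.map heq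
  · obtain ⟨t, ht⟩ := z.isExt.exists_desc (p'.map - p.map) (by simp [p.ι_map, p'.ι_map])
    obtain ⟨s, hs⟩ := z'.isExt.exists_lift t (by
      rw [← cancel_epi z.π, reassoc_of% ht]
      simp [p.map_π, p'.map_π])
    exact ⟨s, ExtHom.ext (by simp [translate, hs, ht])⟩

variable [HasExt.{w} C]

theorem extClass_comp_eq (p : ExtHom z z' c) :
    z.extClass.comp (Ext.mk₀ c) (add_zero 1) = z'.extClass :=
  (z.isExt.extClass_naturality z'.isExt (m := 𝟙 M) p.ι_map (by simpa using p.map_π)).trans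
    (Ext.mk₀_id_comp _)

theorem nonempty_of_extClass_comp_eq
    (h : z.extClass.comp (Ext.mk₀ c) (add_zero 1) = z'.extClass) : Nonempty (ExtHom z z' c) := by
  obtain ⟨f, g, hz⟩ := z
  obtain ⟨f', g', hz'⟩ := z'
  change hz.extClass.comp (Ext.mk₀ c) (add_zero 1) = hz'.extClass at h
  obtain ⟨p, hp⟩ := hz.exists_comp_eq_of_extClass_comp_eq_zero (c ≫ f') (by
    rw [← Ext.mk₀_comp_mk₀, ← Ext.comp_assoc_of_second_deg_zero, h, hz'.extClass_comp])
  obtain ⟨m, hm⟩ := hz.exists_desc (p ≫ g') (by rw [reassoc_of% hp, hz'.zero, comp_zero])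
  have comp_extClass : (Ext.mk₀ m).comp hz'.extClass (zero_add 1) = hz'.extClass := by
    rw [← hz.extClass_naturality hz' hp hm.symm, h]
  obtain ⟨s, hs⟩ := hz'.exists_comp_eq_of_comp_extClass_eq_zero (m - 𝟙 M) (by
    rw [sub_eq_add_neg, Ext.mk₀_add, Ext.mk₀_neg, Ext.add_comp, Ext.neg_comp, Ext.mk₀_id_comp,
      comp_extClass, add_neg_cancel])
  exact ⟨⟨p - g ≫ s, by simp [hp, reassoc_of% hz.zero], by simp [hs, hm]⟩⟩

theorem card_eq_ite [Decidable (z.extClass.comp (Ext.mk₀ c) (add_zero 1) = z'.extClass)] :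
    Nat.card (ExtHom z z' c) =
      if z.extClass.comp (Ext.mk₀ c) (add_zero 1) = z'.extClass
      then Nat.card (M ⟶ N') else 0 := by
  split_ifs with h
  · exact card_eq (nonempty_of_extClass_comp_eq h)
  · have : IsEmpty (ExtHom z z' c) := ⟨fun p => h p.extClass_comp_eq⟩
    exact Nat.card_of_isEmpty

end ExtHom

/-- An isomorphism of the middle term of a short exact sequence with `E'` amounts to a short exact
sequence with middle term `E'` and the same class, together with a map of sequences. -/
noncomputable def HallPair.isoEquiv [HasExt.{w} C] {M N E : C} (z : HallPair M N E) (E' : C) :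
    (E ≅ E') ≃ Σ z' : {z' : HallPair M N E' // z'.extClass = z.extClass}, ExtHom z z'.1 (𝟙 N) where
  toFun e :=
    let z' : HallPair M N E' := ⟨_, _, z.isExt.iso_middle e⟩
    let p : ExtHom z z' (𝟙 N) := ⟨e.hom, by simp [z'], by simp [z']⟩
    ⟨⟨z', by rw [← p.extClass_comp_eq, Ext.comp_mk₀_id]⟩, p⟩
  invFun s :=
    have := s.2.isIso
    asIso s.2.map
  left_inv e := by ext; rfl
  right_inv := by
    rintro ⟨⟨⟨f, g, h⟩, hc⟩, ⟨p, h₁, h₂⟩⟩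
    have : IsIso p := ExtHom.isIso (z := z) (z' := ⟨f, g, h⟩) ⟨p, h₁, h₂⟩
    have hf : f = z.ι ≫ p := by simpa using h₁.symm
    have hg : g = inv p ≫ z.π := by simp [← h₂]
    subst hf hg
    rfl

end Maps

end Extensions

/-! ### Counting over isomorphism classes -/

section Counting

open Limits Abelian

variable {C : Type u} [Category.{v} C]

theorem isoClass_eq_iff {X Y : C} : isoClass X = isoClass Y ↔ Nonempty (X ≅ Y) := Quotient.eq

theorem isoClass_out (e : IsoClass C) : isoClass e.out = e := Quotient.out_eq e

theorem nonempty_iso_out (X : C) : Nonempty ((isoClass X).out ≅ X) :=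
  isoClass_eq_iff.1 (isoClass_out _)

/-- Composition with isomorphisms on both sides, as an equivalence of sets of isomorphisms. -/
def isoCongr {X X' Y Y' : C} (a : X ≅ X') (b : Y ≅ Y') : (X ≅ Y) ≃ (X' ≅ Y') where
  toFun e := a.symm ≪≫ e ≪≫ b
  invFun e := a ≪≫ e ≪≫ b.symm
  left_inv e := by ext; simp
  right_inv e := by ext; simp

theorem autCard_congr {X Y : C} (e : X ≅ Y) : autCard X = autCard Y :=
  Nat.card_congr (isoCongr e e)

section Finite

variable [∀ M N : C, Finite (M ⟶ N)]

instance finite_iso (X Y : C) : Finite (X ≅ Y) :=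
  Finite.of_injective (fun e : X ≅ Y => e.hom) fun _ _ h => Iso.ext h

theorem autCard_ne_zero (X : C) : (autCard X : ℝ) ≠ 0 :=
  have : Finite (Aut X) := finite_iso X X
  have : Nonempty (Aut X) := ⟨Iso.refl X⟩
  Nat.cast_ne_zero.2 Nat.card_pos.ne'

theorem sum_card_iso_div (X : C) (Q : Finset (IsoClass C)) (hX : isoClass X ∈ Q) :
    ∑ e ∈ Q, (Nat.card (X ≅ e.out) : ℝ) / autCard e.out = 1 := by
  rw [Finset.sum_eq_single_of_mem _ hX]
  · obtain ⟨e⟩ := nonempty_iso_out X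
    rw [← Nat.card_congr (isoCongr e (Iso.refl _))]
    exact div_self (autCard_ne_zero _)
  · intro e _ he
    have : IsEmpty (X ≅ e.out) := ⟨fun i => he (by rw [isoClass_eq_iff.2 ⟨i⟩, isoClass_out])⟩
    simp

/-- The method of counting used throughout: a set of configurations with a marked object is
counted, weighted by automorphisms, by the set of the same configurations in which the marked
object has been replaced by a canonical one `Y t`. -/
theorem sum_card_div_of_equiv {T : Type*} [Finite T] (Y : T → C) (X : C → Type*)
    (eqv : ∀ E : C, Nonempty (X E ≃ Σ t, (Y t ≅ E))) (Q : Finset (IsoClass C))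
    (hQ : ∀ t, isoClass (Y t) ∈ Q) :
    ∑ e ∈ Q, (Nat.card (X e.out) : ℝ) / autCard e.out = Nat.card T := by
  have := Fintype.ofFinite T
  have card_div (e : IsoClass C) : (Nat.card (X e.out) : ℝ) / autCard e.out =
      ∑ t, (Nat.card (Y t ≅ e.out) : ℝ) / autCard e.out := by
    rw [Nat.card_congr (eqv e.out).some, Nat.card_sigma, Nat.cast_sum, Finset.sum_div]
  simp only [card_div]
  rw [Finset.sum_comm]
  simp [fun t => sum_card_iso_div (Y t) Q (hQ t)]

end Finite

variable [Abelian C]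

/-- Transport of short exact sequences along isomorphisms of the three objects. -/
@[simps]
def HallPair.congr {M M' N N' E E' : C} (a : M ≅ M') (b : N ≅ N') (c : E ≅ E') :
    HallPair M N E ≃ HallPair M' N' E' where
  toFun z := ⟨b.inv ≫ z.ι ≫ c.hom, c.inv ≫ z.π ≫ a.hom, z.isExt.comp_isos b.symm c a⟩
  invFun z := ⟨b.hom ≫ z.ι ≫ c.inv, c.hom ≫ z.π ≫ a.inv, z.isExt.comp_isos b c.symm a.symm⟩
  left_inv z := by ext <;> simp
  right_inv z := by ext <;> simp

theorem hallP_congr {M M' N N' E E' : C} (a : M ≅ M') (b : N ≅ N') (c : E ≅ E') :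
    hallP M N E = hallP M' N' E' := by
  simp only [hallP_eq_card_hallPair, Nat.card_congr (HallPair.congr a b c)]

theorem nonempty_hallPair_of_hallP_ne_zero {M N E : C} (h : hallP M N E ≠ 0) :
    Nonempty (HallPair M N E) :=
  (Nat.card_ne_zero.1 (hallP_eq_card_hallPair M N E ▸ h)).1

theorem hallP_ne_zero [∀ M N : C, Finite (M ⟶ N)] {M N E : C} (z : HallPair M N E) :
    hallP M N E ≠ 0 := by
  rw [hallP_eq_card_hallPair]
  exact Nat.card_ne_zero.2 ⟨⟨z⟩, inferInstance⟩

/-- A two-step filtration `L ⊆ Z ⊆ F` with `F / Z` identified with `M` and `Z / L` with `N`. It is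
encoded by the complex `L ⟶ F ⟶ M`, whose homology is `Z / L`. -/
structure Filtration (M N L F : C) where
  sub : L ⟶ F
  quot : F ⟶ M
  zero : sub ≫ quot = 0
  [mono : Mono sub]
  [epi : Epi quot]
  homologyIso : (ShortComplex.mk sub quot zero).homology ≅ N

namespace Filtration

attribute [instance] mono epi

variable {M N L F : C} (t : Filtration M N L F)

/-- The underlying complex. -/
abbrev complex : ShortComplex C := ShortComplex.mk t.sub t.quot t.zero

theorem isExt_pOpcycles : IsExt t.sub t.complex.pOpcycles :=
  .of_isColimit_cokernelCofork t.complex.opcyclesIsCokernel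

theorem isExt_iCycles : IsExt t.complex.iCycles t.quot :=
  .of_isLimit_kernelFork t.complex.cyclesIsKernel

theorem isExt_fromOpcycles :
    IsExt (t.homologyIso.inv ≫ t.complex.homologyι) t.complex.fromOpcycles :=
  have : Epi t.complex.fromOpcycles := epi_of_epi_fac t.complex.p_fromOpcycles
  (IsExt.of_isLimit_kernelFork t.complex.homologyIsKernel).iso_left t.homologyIso.symm

theorem isExt_toCycles :
    IsExt t.complex.toCycles (t.complex.homologyπ ≫ t.homologyIso.hom) :=
  have : Mono t.complex.toCycles := mono_of_mono_fac t.complex.toCycles_i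
  (IsExt.of_isColimit_cokernelCofork t.complex.homologyIsCokernel).iso_right t.homologyIso

instance [∀ M N : C, Finite (M ⟶ N)] : Finite (Filtration M N L F) := by
  refine Finite.of_injective (β := Σ p : {p : (L ⟶ F) × (F ⟶ M) // p.1 ≫ p.2 = 0},
    (ShortComplex.mk p.1.1 p.1.2 p.2).homology ≅ N)
    (fun t => ⟨⟨(t.sub, t.quot), t.zero⟩, t.homologyIso⟩) ?_
  rintro ⟨a, b, _, h⟩ ⟨a', b', _, h'⟩ heq
  obtain ⟨hab, hh⟩ := Sigma.mk.inj heq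
  obtain ⟨rfl, rfl⟩ := Prod.mk.inj (congrArg Subtype.val hab)
  cases hh
  rfl

/-- The short exact sequences `0 ⟶ N ⟶ F / L ⟶ M ⟶ 0` and `0 ⟶ L ⟶ F ⟶ F / L ⟶ 0` of a filtration
with `F / L` identified with `E`. -/
noncomputable def hallPairsOpcycles (E : C)
    (x : Σ t : Filtration M N L F, (t.complex.opcycles ≅ E)) : HallPair M N E × HallPair E L F :=
  ⟨⟨_, _, x.1.isExt_fromOpcycles.iso_middle x.2⟩, ⟨_, _, x.1.isExt_pOpcycles.iso_right x.2⟩⟩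

/-- The short exact sequences `0 ⟶ L ⟶ Z ⟶ N ⟶ 0` and `0 ⟶ Z ⟶ F ⟶ M ⟶ 0` of a filtration with `Z`
identified with `E`. -/
noncomputable def hallPairsCycles (E : C)
    (x : Σ t : Filtration M N L F, (t.complex.cycles ≅ E)) : HallPair N L E × HallPair M E F :=
  ⟨⟨_, _, x.1.isExt_toCycles.iso_middle x.2⟩, ⟨_, _, x.1.isExt_iCycles.iso_left x.2.symm⟩⟩

theorem hallPairsOpcycles_injective (E : C) :
    Function.Injective (hallPairsOpcycles (M := M) (N := N) (L := L) (F := F) E) := by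
  rintro ⟨⟨a, b, zero, h⟩, e⟩ ⟨⟨a', b', zero', h'⟩, e'⟩ heq
  simp only [hallPairsOpcycles, Prod.mk.injEq, HallPair.mk.injEq] at heq
  obtain ⟨⟨h_inv, e_inv⟩, rfl, e_hom⟩ := heq
  obtain rfl : b = b' := calc
    b = (_ ≫ e.hom) ≫ e.inv ≫ _ := by simp
    _ = (_ ≫ e'.hom) ≫ e'.inv ≫ _ := congrArg₂ _ e_hom e_inv
    _ = b' := by simp
  obtain rfl : e = e' := Iso.ext (by simpa [cancel_epi] using e_hom)
  obtain rfl : h = h' := Iso.symm_eq_iff.1 (Iso.ext (by simpa [cancel_mono] using h_inv))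
  rfl

theorem hallPairsCycles_injective (E : C) :
    Function.Injective (hallPairsCycles (M := M) (N := N) (L := L) (F := F) E) := by
  rintro ⟨⟨a, b, zero, h⟩, e⟩ ⟨⟨a', b', zero', h'⟩, e'⟩ heq
  simp only [hallPairsCycles, Prod.mk.injEq, HallPair.mk.injEq] at heq
  obtain ⟨⟨e_hom, h_hom⟩, e_inv, rfl⟩ := heq
  obtain rfl : a = a' := calc
    a = (_ ≫ e.hom) ≫ e.symm.hom ≫ _ := by simp
    _ = (_ ≫ e'.hom) ≫ e'.symm.hom ≫ _ := congrArg₂ _ e_hom e_inv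
    _ = a' := by simp
  obtain rfl : e = e' := Iso.symm_eq_iff.1 (Iso.ext (by simpa [cancel_mono] using e_inv))
  obtain rfl : h = h' := Iso.ext (by simpa [cancel_epi] using h_hom)
  rfl

theorem hallPairsOpcycles_surjective (E : C) :
    Function.Surjective (hallPairsOpcycles (M := M) (N := N) (L := L) (F := F) E) := by
  rintro ⟨⟨f, g, hfg⟩, ⟨a, b, hab⟩⟩
  have := hab.mono
  have := hab.epi
  have := hfg.epi
  let S := ShortComplex.mk a (b ≫ g) (by rw [reassoc_of% hab.zero, zero_comp])
  obtain ⟨e, he⟩ := (IsExt.of_isColimit_cokernelCofork S.opcyclesIsCokernel).exists_iso_right hab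
  have fromOpcycles_eq : S.fromOpcycles = e.hom ≫ g := by
    rw [← cancel_epi S.pOpcycles, S.p_fromOpcycles, reassoc_of% he]
  have : Epi S.fromOpcycles := epi_of_epi_fac S.p_fromOpcycles
  have isExt_fromOpcycles : IsExt (f ≫ e.inv) S.fromOpcycles := by
    rw [fromOpcycles_eq]
    exact hfg.iso_middle e.symm
  obtain ⟨h, hh⟩ :=
    isExt_fromOpcycles.exists_iso_left (IsExt.of_isLimit_kernelFork S.homologyIsKernel)
  refine ⟨⟨⟨a, b ≫ g, S.zero, h⟩, e⟩, Prod.ext (HallPair.ext ?_ ?_)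
    (HallPair.ext rfl he)⟩
  · change (h.inv ≫ S.homologyι) ≫ e.hom = f
    rw [← hh]
    simp
  · change e.inv ≫ S.fromOpcycles = g
    simp [fromOpcycles_eq]

theorem hallPairsCycles_surjective (E : C) :
    Function.Surjective (hallPairsCycles (M := M) (N := N) (L := L) (F := F) E) := by
  rintro ⟨⟨f, g, hfg⟩, ⟨a, b, hab⟩⟩
  have := hab.mono
  have := hab.epi
  have := hfg.mono
  let S := ShortComplex.mk (f ≫ a) b (by rw [Category.assoc, hab.zero, comp_zero])
  obtain ⟨e, he⟩ := (IsExt.of_isLimit_kernelFork S.cyclesIsKernel).exists_iso_left hab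
  have toCycles_eq : S.toCycles = f ≫ e.hom := by
    rw [← cancel_mono S.iCycles, S.toCycles_i, Category.assoc, he]
  have : Mono S.toCycles := mono_of_mono_fac S.toCycles_i
  have isExt_toCycles : IsExt S.toCycles (e.inv ≫ g) := by
    rw [toCycles_eq]
    exact hfg.iso_middle e
  obtain ⟨h, hh⟩ :=
    (IsExt.of_isColimit_cokernelCofork S.homologyIsCokernel).exists_iso_right isExt_toCycles
  refine ⟨⟨⟨f ≫ a, b, S.zero, h⟩, e.symm⟩, Prod.ext (HallPair.ext ?_ ?_)
    (HallPair.ext he rfl)⟩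
  · change S.toCycles ≫ e.inv = f
    simp [toCycles_eq]
  · change e.hom ≫ S.homologyπ ≫ h.hom = g
    simp [hh]

end Filtration

/-- Both sides count the filtrations of `F` with successive quotients `L`, `N` and `M`. -/
theorem hallP_assoc [∀ M N : C, Finite (M ⟶ N)] (M N L F : C) (Q Q' : Finset (IsoClass C))
    (hQ : ∀ e, hallP M N e.out ≠ 0 → e ∈ Q) (hQ' : ∀ e, hallP N L e.out ≠ 0 → e ∈ Q') :
    ∑ e ∈ Q, (hallP M N e.out * hallP e.out L F : ℝ) / autCard e.out =
      ∑ e ∈ Q', (hallP N L e.out * hallP M e.out F : ℝ) / autCard e.out := by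
  have left := sum_card_div_of_equiv (fun t : Filtration M N L F => t.complex.opcycles)
    (fun E => HallPair M N E × HallPair E L F)
    (fun E => ⟨(Equiv.ofBijective _ ⟨Filtration.hallPairsOpcycles_injective E,
      Filtration.hallPairsOpcycles_surjective E⟩).symm⟩) Q fun t => hQ _ (by
        obtain ⟨e⟩ := nonempty_iso_out t.complex.opcycles
        exact hallP_ne_zero ⟨_, _, t.isExt_fromOpcycles.iso_middle e.symm⟩)
  have right := sum_card_div_of_equiv (fun t : Filtration M N L F => t.complex.cycles)
    (fun E => HallPair N L E × HallPair M E F)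
    (fun E => ⟨(Equiv.ofBijective _ ⟨Filtration.hallPairsCycles_injective E,
      Filtration.hallPairsCycles_surjective E⟩).symm⟩) Q' fun t => hQ' _ (by
        obtain ⟨e⟩ := nonempty_iso_out t.complex.cycles
        exact hallP_ne_zero ⟨_, _, t.isExt_toCycles.iso_middle e.symm⟩)
  simpa only [Nat.card_prod, Nat.cast_mul, hallP_eq_card_hallPair] using left.trans right.symm

end Counting

/-! ### Three by three diagrams -/

section Frames

open Limits Abelian

variable {C : Type u} [Category.{v} C] [Abelian C]

/-- Two short exact sequences with the same middle term: the middle column and the middle row of a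
three by three diagram with exact rows and columns. -/
structure Cross (A B X D E : C) where
  column : HallPair A B E
  row : HallPair X D E

/-- The four outer short exact sequences of a three by three diagram with exact rows and columns
```
B₂ → B → B₁
↓         ↓
D         X
↓         ↓
A₂ → A → A₁
```
-/
structure Frame (A B X D A₁ A₂ B₁ B₂ : C) where
  top : HallPair B₁ B₂ B
  left : HallPair A₂ B₂ D
  right : HallPair A₁ B₁ X
  bottom : HallPair A₁ A₂ A

variable {A B X D E A₁ A₂ B₁ B₂ : C}

/-- A frame and a cross fit together to a commutative three by three diagram. -/
structure Compat (r : Frame A B X D A₁ A₂ B₁ B₂) (c : Cross A B X D E) : Prop where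
  topLeft : r.top.ι ≫ c.column.ι = r.left.ι ≫ c.row.ι
  topRight : c.column.ι ≫ c.row.π = r.top.π ≫ r.right.ι
  bottomLeft : c.row.ι ≫ c.column.π = r.left.π ≫ r.bottom.ι
  bottomRight : c.column.π ≫ r.bottom.π = c.row.π ≫ r.right.π

/-- A cross as a pair of short exact sequences. -/
def crossEquivProd : Cross A B X D E ≃ HallPair A B E × HallPair X D E where
  toFun c := (c.column, c.row)
  invFun p := ⟨p.1, p.2⟩

/-- A frame as a quadruple of short exact sequences. -/
def frameEquivProd : Frame A B X D A₁ A₂ B₁ B₂ ≃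
    (HallPair B₁ B₂ B × HallPair A₂ B₂ D) × (HallPair A₁ B₁ X × HallPair A₁ A₂ A) where
  toFun r := ((r.top, r.left), (r.right, r.bottom))
  invFun p := ⟨p.1.1, p.1.2, p.2.1, p.2.2⟩

theorem card_cross : Nat.card (Cross A B X D E) = hallP A B E * hallP X D E := by
  simp only [Nat.card_congr crossEquivProd, Nat.card_prod, hallP_eq_card_hallPair]

theorem card_frame : Nat.card (Frame A B X D A₁ A₂ B₁ B₂) =
    hallP B₁ B₂ B * hallP A₂ B₂ D * (hallP A₁ B₁ X * hallP A₁ A₂ A) := by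
  simp only [Nat.card_congr frameEquivProd, Nat.card_prod, hallP_eq_card_hallPair]

/-- The corners are the kernels, images and cokernels of the maps `B ⟶ X` and `D ⟶ A`. -/
theorem exists_compat_frame (c : Cross A B X D E) :
    ∃ (A₁ A₂ B₁ B₂ : C) (r : Frame A B X D A₁ A₂ B₁ B₂), Compat r c := by
  obtain ⟨⟨f, g, hf⟩, ⟨f', g', hf'⟩⟩ := c
  have pb := IsPullback.of_hasPullback f f'
  have po := IsPushout.of_hasPushout g g'
  have fac : Abelian.factorThruImage (f ≫ g') ≫ _ = _ := Abelian.image.fac (f ≫ g')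
  have fac' : Abelian.factorThruImage (f' ≫ g) ≫ _ = _ := Abelian.image.fac (f' ≫ g)
  exact ⟨_, _, _, _,
    { top := ⟨_, _, hf'.of_isPullback_image pb fac⟩
      left := ⟨_, _, hf.of_isPullback_image pb.flip fac'⟩
      right := ⟨_, _, hf.of_isPushout_image po.flip fac⟩
      bottom := ⟨_, _, hf'.of_isPushout_image po fac'⟩ }, pb.w, fac.symm, fac'.symm, po.w⟩

namespace Frame

section Corners

variable {A₁' A₂' B₁' B₂' : C}

/-- Transport of a frame along isomorphisms of the corners. -/
def congrCorners (r : Frame A B X D A₁ A₂ B₁ B₂)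
    (i : ((A₁ ≅ A₁') × (A₂ ≅ A₂')) × ((B₁ ≅ B₁') × (B₂ ≅ B₂'))) :
    Frame A B X D A₁' A₂' B₁' B₂' where
  top := HallPair.congr i.2.1 i.2.2 (Iso.refl _) r.top
  left := HallPair.congr i.1.2 i.2.2 (Iso.refl _) r.left
  right := HallPair.congr i.1.1 i.2.1 (Iso.refl _) r.right
  bottom := HallPair.congr i.1.1 i.1.2 (Iso.refl _) r.bottom

theorem compat_congrCorners {r : Frame A B X D A₁ A₂ B₁ B₂} {c : Cross A B X D E}
    (h : Compat r c) (i : ((A₁ ≅ A₁') × (A₂ ≅ A₂')) × ((B₁ ≅ B₁') × (B₂ ≅ B₂'))) :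
    Compat (r.congrCorners i) c :=
  ⟨by simp [congrCorners, h.topLeft], by simp [congrCorners, h.topRight],
    by simp [congrCorners, h.bottomLeft], by simp [congrCorners, reassoc_of% h.bottomRight]⟩

theorem congrCorners_injective (r : Frame A B X D A₁ A₂ B₁ B₂) :
    Function.Injective (r.congrCorners (A₁' := A₁') (A₂' := A₂') (B₁' := B₁') (B₂' := B₂')) := by
  have := r.top.isExt.mono
  have := r.top.isExt.epi
  have := r.left.isExt.epi
  have := r.bottom.isExt.epi
  rintro ⟨⟨a₁, a₂⟩, ⟨b₁, b₂⟩⟩ ⟨⟨a₁', a₂'⟩, ⟨b₁', b₂'⟩⟩ h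
  simp only [congrCorners, Frame.mk.injEq, HallPair.ext_iff, HallPair.congr_apply_ι,
    HallPair.congr_apply_π, Iso.refl_hom, Iso.refl_inv, Category.comp_id, Category.id_comp] at h
  obtain ⟨⟨hb₂, hb₁⟩, ⟨-, ha₂⟩, -, ⟨-, ha₁⟩⟩ := h
  rw [Iso.ext ((cancel_epi _).1 ha₁), Iso.ext ((cancel_epi _).1 ha₂),
    Iso.ext ((cancel_epi _).1 hb₁), Iso.ext_inv ((cancel_mono _).1 hb₂)]

theorem exists_congrCorners_eq {r : Frame A B X D A₁ A₂ B₁ B₂}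
    {s : Frame A B X D A₁' A₂' B₁' B₂'} {c : Cross A B X D E} (hr : Compat r c)
    (hs : Compat s c) : ∃ i, r.congrCorners i = s := by
  have := c.row.isExt.mono
  have := c.row.isExt.epi
  have := r.top.isExt.epi
  have := r.left.isExt.epi
  have := r.right.isExt.mono
  have := s.right.isExt.mono
  obtain ⟨b₂, b₁, hb₂, hb₁⟩ := r.top.isExt.exists_isos s.top.isExt
    (by rw [← cancel_mono s.right.ι, Category.assoc, ← hs.topRight, reassoc_of% hr.topLeft,
      c.row.isExt.zero, comp_zero, zero_comp])
    (by rw [← cancel_mono r.right.ι, Category.assoc, ← hr.topRight, reassoc_of% hs.topLeft,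
      c.row.isExt.zero, comp_zero, zero_comp])
  have left_ι : b₂.hom ≫ r.left.ι = s.left.ι := by
    rw [← cancel_mono c.row.ι, Category.assoc, ← hr.topLeft, reassoc_of% hb₂, hs.topLeft]
  have right_ι : b₁.inv ≫ r.right.ι = s.right.ι := by
    rw [Iso.inv_comp_eq, ← cancel_epi r.top.π, reassoc_of% hb₁, ← hs.topRight, hr.topRight]
  obtain ⟨a₂, ha₂⟩ := (r.left.isExt.iso_left b₂).exists_iso_right (left_ι ▸ s.left.isExt)
  have bottom_ι : a₂.inv ≫ r.bottom.ι = s.bottom.ι := by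
    rw [Iso.inv_comp_eq, ← cancel_epi r.left.π, reassoc_of% ha₂, ← hs.bottomLeft, hr.bottomLeft]
  obtain ⟨a₁, ha₁⟩ := (r.bottom.isExt.iso_left a₂.symm).exists_iso_right
    (bottom_ι ▸ s.bottom.isExt)
  have right_π : r.right.π ≫ a₁.hom = s.right.π := by
    rw [← cancel_epi c.row.π, ← reassoc_of% hr.bottomRight, ha₁, hs.bottomRight]
  exact ⟨((a₁, a₂), (b₁, b₂.symm)), by simp [congrCorners, HallPair.congr, *]⟩

theorem nonempty_compat_equiv {r : Frame A B X D A₁ A₂ B₁ B₂} {c : Cross A B X D E}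
    (hr : Compat r c) : Nonempty ({s : Frame A B X D A₁' A₂' B₁' B₂' // Compat s c} ≃
      ((A₁ ≅ A₁') × (A₂ ≅ A₂')) × ((B₁ ≅ B₁') × (B₂ ≅ B₂'))) :=
  ⟨(Equiv.ofBijective (fun i => ⟨r.congrCorners i, compat_congrCorners hr i⟩)
    ⟨fun _ _ h => r.congrCorners_injective (congrArg Subtype.val h), fun s =>
      let ⟨i, hi⟩ := exists_congrCorners_eq hr s.2
      ⟨i, Subtype.ext hi⟩⟩).symm⟩

end Corners

variable (r : Frame A B X D A₁ A₂ B₁ B₂)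

/-- The amalgamated sum of `B` and `D` over `B₂`; it is the subobject `B + D` of the centre `E` of
any completion of the frame. -/
noncomputable abbrev po : C := pushout r.top.ι r.left.ι

/-- The fibre product of `A` and `X` over `A₁`; it is the quotient of the centre `E` by `B ∩ D` for
any completion of the frame. -/
noncomputable abbrev pb : C := pullback r.bottom.π r.right.π

/-- The quotient map from `B + D` to `(B + D) / (B ∩ D)`. -/
noncomputable def toSum : r.po ⟶ B₁ ⊞ A₂ :=
  pushout.desc (r.top.π ≫ biprod.inl) (r.left.π ≫ biprod.inr)
    (by rw [reassoc_of% r.top.isExt.zero, reassoc_of% r.left.isExt.zero, zero_comp, zero_comp])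

/-- The inclusion of `(B + D) / (B ∩ D)` into `E / (B ∩ D)`. -/
noncomputable def ofSum : B₁ ⊞ A₂ ⟶ r.pb :=
  biprod.desc (pullback.lift 0 r.right.ι (by rw [r.right.isExt.zero, zero_comp]))
    (pullback.lift r.bottom.ι 0 (by rw [r.bottom.isExt.zero, zero_comp]))

theorem inl_toSum : pushout.inl _ _ ≫ r.toSum = r.top.π ≫ biprod.inl :=
  pushout.inl_desc _ _ _

theorem inr_toSum : pushout.inr _ _ ≫ r.toSum = r.left.π ≫ biprod.inr :=
  pushout.inr_desc _ _ _

theorem ofSum_fst : r.ofSum ≫ pullback.fst _ _ = biprod.snd ≫ r.bottom.ι := by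
  refine biprod.hom_ext' _ _ ?_ ?_ <;> simp [ofSum, pullback.lift_fst]

theorem ofSum_snd : r.ofSum ≫ pullback.snd _ _ = biprod.fst ≫ r.right.ι := by
  refine biprod.hom_ext' _ _ ?_ ?_ <;> simp [ofSum, pullback.lift_snd]

theorem isExt_inl : IsExt (pushout.inl _ _) (r.toSum ≫ biprod.snd) :=
  r.left.isExt.of_isPushout (IsPushout.of_hasPushout r.top.ι r.left.ι).flip
    (by simp [reassoc_of% r.inr_toSum]) (by simp [reassoc_of% r.inl_toSum])

theorem isExt_inr : IsExt (pushout.inr _ _) (r.toSum ≫ biprod.fst) :=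
  r.top.isExt.of_isPushout (IsPushout.of_hasPushout r.top.ι r.left.ι)
    (by simp [reassoc_of% r.inl_toSum]) (by simp [reassoc_of% r.inr_toSum])

theorem isExt_toSum : IsExt (r.top.ι ≫ pushout.inl _ _) r.toSum :=
  (r.top.isExt.comp_iff (IsExt.biprod _ _) r.inl_toSum).1 r.isExt_inl

theorem isExt_ofSum : IsExt r.ofSum (pullback.fst _ _ ≫ r.bottom.π) :=
  ((IsExt.biprod _ _).comp_iff r.bottom.isExt r.ofSum_fst).2
    (r.right.isExt.of_isPullback (IsPullback.of_hasPullback r.bottom.π r.right.π).flip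
      (by simp [ofSum_snd]) (by simp [ofSum_fst]))

/-- The extension of `A₁` by `B₁ ⊞ A₂` formed by the right and the bottom of the frame. -/
noncomputable def pbPair : HallPair A₁ (B₁ ⊞ A₂) r.pb :=
  ⟨r.ofSum, pullback.fst _ _ ≫ r.bottom.π, r.isExt_ofSum⟩

variable {r}

theorem isExt_inl_iff {i : r.po ⟶ E} {p : E ⟶ r.pb} (h : i ≫ p = r.toSum ≫ r.ofSum) :
    IsExt i (p ≫ pullback.fst _ _ ≫ r.bottom.π) ↔
      IsExt (pushout.inl _ _ ≫ i) (p ≫ pullback.fst _ _) := by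
  rw [← Category.assoc p]
  exact r.isExt_inl.comp_iff r.bottom.isExt (by simp [reassoc_of% h, ofSum_fst])

theorem isExt_inr_iff {i : r.po ⟶ E} {p : E ⟶ r.pb} (h : i ≫ p = r.toSum ≫ r.ofSum) :
    IsExt i (p ≫ pullback.fst _ _ ≫ r.bottom.π) ↔
      IsExt (pushout.inr _ _ ≫ i) (p ≫ pullback.snd _ _) := by
  rw [pullback.condition, ← Category.assoc p]
  exact r.isExt_inr.comp_iff r.right.isExt (by simp [reassoc_of% h, ofSum_snd])

/-- The cross given by a lifting of the extension `pbPair` along `toSum`. -/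
noncomputable def crossOfExtHom (s : Σ z : HallPair A₁ r.po E, ExtHom z r.pbPair r.toSum) :
    Cross A B X D E :=
  have hs : IsExt s.1.ι (s.2.map ≫ pullback.fst _ _ ≫ r.bottom.π) := s.2.map_π.symm ▸ s.1.isExt
  ⟨⟨_, _, (isExt_inl_iff s.2.ι_map).1 hs⟩, ⟨_, _, (isExt_inr_iff s.2.ι_map).1 hs⟩⟩

theorem compat_crossOfExtHom (s : Σ z : HallPair A₁ r.po E, ExtHom z r.pbPair r.toSum) :
    Compat r (crossOfExtHom s) := by
  have ι_map : s.1.ι ≫ s.2.map = r.toSum ≫ r.ofSum := s.2.ι_map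
  refine ⟨pushout.condition_assoc _, ?_, ?_, ?_⟩
  · simp [crossOfExtHom, reassoc_of% ι_map, ofSum_snd, reassoc_of% r.inl_toSum]
  · simp [crossOfExtHom, reassoc_of% ι_map, ofSum_fst, reassoc_of% r.inr_toSum]
  · simp [crossOfExtHom, pullback.condition]

theorem crossOfExtHom_injective : Function.Injective (crossOfExtHom (r := r) (E := E)) := by
  rintro ⟨⟨i, π, hz⟩, ⟨p, hi, hp⟩⟩ ⟨⟨i', π', hz'⟩, ⟨p', hi', hp'⟩⟩ h
  simp only [crossOfExtHom, Cross.mk.injEq, HallPair.mk.injEq] at h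
  obtain ⟨⟨inl_i, p_fst⟩, inr_i, p_snd⟩ := h
  obtain rfl : i = i' := pushout.hom_ext inl_i inr_i
  obtain rfl : p = p' := pullback.hom_ext p_fst p_snd
  obtain rfl : π = π' := hp.symm.trans hp'
  rfl

theorem exists_crossOfExtHom_eq {c : Cross A B X D E} (hc : Compat r c) :
    ∃ s, crossOfExtHom (r := r) s = c := by
  obtain ⟨⟨f, g, hf⟩, ⟨f', g', hf'⟩⟩ := c
  obtain ⟨topLeft, topRight, bottomLeft, bottomRight⟩ := hc
  dsimp only at topLeft topRight bottomLeft bottomRight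
  let i : r.po ⟶ E := pushout.desc f f' topLeft
  let p : E ⟶ r.pb := pullback.lift g g' bottomRight
  have inl_i : pushout.inl _ _ ≫ i = f := pushout.inl_desc _ _ _
  have inr_i : pushout.inr _ _ ≫ i = f' := pushout.inr_desc _ _ _
  have p_fst : p ≫ pullback.fst _ _ = g := pullback.lift_fst _ _ _
  have p_snd : p ≫ pullback.snd _ _ = g' := pullback.lift_snd _ _ _
  have fac : i ≫ p = r.toSum ≫ r.ofSum := by
    refine pushout.hom_ext ?_ ?_ <;> refine pullback.hom_ext ?_ ?_
    · simp [p_fst, reassoc_of% inl_i, hf.zero, ofSum_fst, reassoc_of% r.inl_toSum]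
    · simp [p_snd, reassoc_of% inl_i, topRight, ofSum_snd, reassoc_of% r.inl_toSum]
    · simp [p_fst, reassoc_of% inr_i, bottomLeft, ofSum_fst, reassoc_of% r.inr_toSum]
    · simp [p_snd, reassoc_of% inr_i, hf'.zero, ofSum_snd, reassoc_of% r.inr_toSum]
  have isExt_i : IsExt i (p ≫ pullback.fst _ _ ≫ r.bottom.π) :=
    (isExt_inl_iff fac).2 (by rwa [inl_i, p_fst])
  exact ⟨⟨⟨i, _, isExt_i⟩, ⟨p, fac, rfl⟩⟩, by simp [crossOfExtHom, inl_i, inr_i, p_fst, p_snd]⟩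

variable (r)

/-- The completions of a frame with centre `E` correspond to the liftings of the extension `pbPair`
along `toSum` with middle term `E`. -/
noncomputable def compatEquiv (E : C) : {c : Cross A B X D E // Compat r c} ≃
    Σ z : HallPair A₁ r.po E, ExtHom z r.pbPair r.toSum :=
  (Equiv.ofBijective (fun s => ⟨crossOfExtHom s, compat_crossOfExtHom s⟩)
    ⟨fun _ _ h => crossOfExtHom_injective (congrArg Subtype.val h), fun c =>
      let ⟨s, hs⟩ := exists_crossOfExtHom_eq c.2
      ⟨s, Subtype.ext hs⟩⟩).symm

end Frame

end Frames

/-! ### Cardinalities of extension groups -/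

section CardExact

variable {A₀ A₁ A₂ A₃ A₄ A₅ : Type*} [AddGroup A₀] [AddGroup A₁] [AddGroup A₂] [AddGroup A₃]
  [AddGroup A₄] [AddGroup A₅]

theorem card_ker_mul_card_range (f : A₀ →+ A₁) :
    Nat.card f.ker * Nat.card f.range = Nat.card A₀ := by
  rw [← AddSubgroup.index_ker, AddSubgroup.card_mul_index]

theorem card_mul_card_mul_card_ker_of_exact (f₀ : A₀ →+ A₁) (f₁ : A₁ →+ A₂) (f₂ : A₂ →+ A₃)
    (f₃ : A₃ →+ A₄) (f₄ : A₄ →+ A₅) (h₀ : Function.Injective f₀) (h₁ : f₀.range = f₁.ker)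
    (h₂ : f₁.range = f₂.ker) (h₃ : f₂.range = f₃.ker) (h₄ : f₃.range = f₄.ker) :
    Nat.card A₀ * Nat.card A₂ * Nat.card f₄.ker = Nat.card A₁ * Nat.card A₃ := by
  rw [← card_ker_mul_card_range f₁, ← card_ker_mul_card_range f₂, ← card_ker_mul_card_range f₃,
    ← h₁, ← h₂, ← h₃, ← h₄, Nat.card_congr (AddMonoidHom.ofInjective h₀).toEquiv]
  ring

end CardExact

section CardExt

open Limits Abelian

variable {C : Type u} [Category.{v} C] [Abelian C] [HasExt.{w} C]

namespace IsExt

variable {N E M : C} {f : N ⟶ E} {g : E ⟶ M} (T : C)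

theorem card_hom_mul_card_hom_mul_card_ker_postcomp (h : IsExt f g) :
    Nat.card (T ⟶ N) * Nat.card (T ⟶ M) *
        Nat.card ((Ext.mk₀.{w} g).postcomp T (add_zero 1)).ker =
      Nat.card (T ⟶ E) * Nat.card (Ext.{w} T N 1) := by
  have := h.mono
  have exact := card_mul_card_mul_card_ker_of_exact ((Ext.mk₀.{w} f).postcomp T (add_zero 0))
    ((Ext.mk₀ g).postcomp T (add_zero 0)) (h.shortExact.extClass.postcomp T (zero_add 1))
    ((Ext.mk₀ f).postcomp T (add_zero 1)) ((Ext.mk₀ g).postcomp T (add_zero 1))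
    (Ext.postcomp_mk₀_injective_of_mono T f)
    (ShortComplex.ab_exact_iff_range_eq_ker.1 (Ext.covariant_sequence_exact₂' T h.shortExact 0))
    (ShortComplex.ab_exact_iff_range_eq_ker.1
      (Ext.covariant_sequence_exact₃' T h.shortExact 0 1 rfl))
    (ShortComplex.ab_exact_iff_range_eq_ker.1
      (Ext.covariant_sequence_exact₁' T h.shortExact 0 1 rfl))
    (ShortComplex.ab_exact_iff_range_eq_ker.1 (Ext.covariant_sequence_exact₂' T h.shortExact 1))
  simpa only [Nat.card_congr Ext.homEquiv₀] using exact

theorem card_hom_mul_card_hom_mul_card_ker_precomp (h : IsExt f g) :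
    Nat.card (M ⟶ T) * Nat.card (N ⟶ T) *
        Nat.card ((Ext.mk₀.{w} f).precomp T (zero_add 1)).ker =
      Nat.card (E ⟶ T) * Nat.card (Ext.{w} M T 1) := by
  have := h.epi
  have exact := card_mul_card_mul_card_ker_of_exact ((Ext.mk₀.{w} g).precomp T (zero_add 0))
    ((Ext.mk₀ f).precomp T (zero_add 0)) (h.shortExact.extClass.precomp T (add_zero 1))
    ((Ext.mk₀ g).precomp T (zero_add 1)) ((Ext.mk₀ f).precomp T (zero_add 1))
    (Ext.precomp_mk₀_injective_of_epi T g)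
    (ShortComplex.ab_exact_iff_range_eq_ker.1
      (Ext.contravariant_sequence_exact₂' h.shortExact T 0))
    (ShortComplex.ab_exact_iff_range_eq_ker.1
      (Ext.contravariant_sequence_exact₁' h.shortExact T 0 1 rfl))
    (ShortComplex.ab_exact_iff_range_eq_ker.1
      (Ext.contravariant_sequence_exact₃' h.shortExact T 0 1 rfl))
    (ShortComplex.ab_exact_iff_range_eq_ker.1
      (Ext.contravariant_sequence_exact₂' h.shortExact T 1))
  simpa only [Nat.card_congr Ext.homEquiv₀] using exact

theorem postcomp_surjective (h : IsExt f g) [Subsingleton (Ext.{w} T N 2)] :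
    Function.Surjective ((Ext.mk₀.{w} g).postcomp T (add_zero 1)) := fun x =>
  Ext.covariant_sequence_exact₃ T h.shortExact x (n₁ := 2) rfl (Subsingleton.elim _ _)

theorem precomp_surjective (h : IsExt f g) [Subsingleton (Ext.{w} M T 2)] :
    Function.Surjective ((Ext.mk₀.{w} f).precomp T (zero_add 1)) := fun x =>
  Ext.contravariant_sequence_exact₁ h.shortExact T x (n₁ := 2) rfl (Subsingleton.elim _ _)

theorem card_euler_covariant (h : IsExt f g) [Subsingleton (Ext.{w} T N 2)] :
    Nat.card (T ⟶ N) * Nat.card (T ⟶ M) * Nat.card (Ext.{w} T E 1) =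
      Nat.card (T ⟶ E) * Nat.card (Ext.{w} T N 1) * Nat.card (Ext.{w} T M 1) := by
  rw [← card_ker_mul_card_range ((Ext.mk₀.{w} g).postcomp T (add_zero 1)),
    ← h.card_hom_mul_card_hom_mul_card_ker_postcomp T,
    AddMonoidHom.range_eq_top.2 (h.postcomp_surjective T), AddSubgroup.card_top]
  ring

theorem card_euler_contravariant (h : IsExt f g) [Subsingleton (Ext.{w} M T 2)] :
    Nat.card (M ⟶ T) * Nat.card (N ⟶ T) * Nat.card (Ext.{w} E T 1) =
      Nat.card (E ⟶ T) * Nat.card (Ext.{w} M T 1) * Nat.card (Ext.{w} N T 1) := by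
  rw [← card_ker_mul_card_range ((Ext.mk₀.{w} f).precomp T (zero_add 1)),
    ← h.card_hom_mul_card_hom_mul_card_ker_precomp T,
    AddMonoidHom.range_eq_top.2 (h.precomp_surjective T), AddSubgroup.card_top]
  ring

theorem card_comp_eq (h : IsExt f g) [Subsingleton (Ext.{w} T N 2)] (ξ : Ext.{w} T M 1) :
    Nat.card (T ⟶ N) * Nat.card (T ⟶ M) *
        Nat.card {η : Ext.{w} T E 1 // η.comp (Ext.mk₀ g) (add_zero 1) = ξ} =
      Nat.card (T ⟶ E) * Nat.card (Ext.{w} T N 1) := by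
  rw [← h.card_hom_mul_card_hom_mul_card_ker_postcomp T]
  exact congrArg _ (Nat.card_congr
    (AddMonoidHom.fiberEquivKerOfSurjective (h.postcomp_surjective T) ξ))

end IsExt

end CardExt

/-! ### Green's formula -/

section Green

open Limits Abelian

variable {C : Type u} [Category.{v} C] [Abelian C] [∀ M N : C, Finite (M ⟶ N)]

instance ExtHom.finite {M N N' E E' : C} (z : HallPair M N E) (z' : HallPair M N' E')
    (c : N ⟶ N') : Finite (ExtHom z z' c) :=
  Finite.of_injective ExtHom.map fun _ _ => ExtHom.ext

section Riedtmann

variable [HasExt.{w} C] {M N : C}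

theorem HallPair.card_iso_eq_mul {E : C} (z : HallPair M N E) (E' : C) :
    Nat.card (E ≅ E') =
      Nat.card {z' : HallPair M N E' // z'.extClass = z.extClass} * Nat.card (M ⟶ N) := by
  have := Fintype.ofFinite {z' : HallPair M N E' // z'.extClass = z.extClass}
  have card_extHom (z' : {z' : HallPair M N E' // z'.extClass = z.extClass}) :
      Nat.card (ExtHom z z'.1 (𝟙 N)) = Nat.card (M ⟶ N) :=
    ExtHom.card_eq (ExtHom.nonempty_of_extClass_comp_eq (by rw [Ext.comp_mk₀_id, z'.2]))
  rw [Nat.card_congr (z.isoEquiv E'), Nat.card_sigma]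
  simp [card_extHom]

variable [EnoughInjectives C]

theorem sum_card_extClass_eq (ξ : Ext.{w} M N 1) (Q : Finset (IsoClass C))
    (hQ : ∀ (e : IsoClass C) (z : HallPair M N e.out), z.extClass = ξ → e ∈ Q) :
    ∑ e ∈ Q, (Nat.card {z : HallPair M N e.out // z.extClass = ξ} : ℝ) / autCard e.out =
      1 / Nat.card (M ⟶ N) := by
  obtain ⟨E, z, rfl⟩ := exists_extClass_eq ξ
  have mem : isoClass E ∈ Q := by
    obtain ⟨i⟩ := nonempty_iso_out E
    let s := z.isoEquiv _ i.symm
    exact hQ _ s.1.1 s.1.2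
  rw [eq_div_iff (Nat.cast_ne_zero.2 Nat.card_pos.ne'), Finset.sum_mul,
    ← sum_card_iso_div E Q mem]
  refine Finset.sum_congr rfl fun e _ => ?_
  rw [z.card_iso_eq_mul, Nat.cast_mul, div_mul_eq_mul_div]

/-- Riedtmann's formula. -/
theorem sum_card_extClass_mem [Finite (Ext.{w} M N 1)] (S : Set (Ext.{w} M N 1))
    (Q : Finset (IsoClass C))
    (hQ : ∀ (e : IsoClass C) (z : HallPair M N e.out), z.extClass ∈ S → e ∈ Q) :
    ∑ e ∈ Q, (Nat.card {z : HallPair M N e.out // z.extClass ∈ S} : ℝ) / autCard e.out =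
      Nat.card S / Nat.card (M ⟶ N) := by
  have := Fintype.ofFinite S
  have card_eq_sum (e : IsoClass C) : Nat.card {z : HallPair M N e.out // z.extClass ∈ S} =
      ∑ ξ : S, Nat.card {z : HallPair M N e.out // z.extClass = ξ} := by
    rw [← Nat.card_sigma]
    exact Nat.card_congr (Equiv.sigmaSubtypeFiberEquivSubtype HallPair.extClass
      fun _ => Iff.rfl).symm
  simp only [card_eq_sum, Nat.cast_sum, Finset.sum_div]
  rw [Finset.sum_comm, Finset.sum_congr rfl fun ξ _ => sum_card_extClass_eq ξ.1 Q
    fun e z hz => hQ e z (hz ▸ ξ.2)]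
  simp [div_eq_mul_inv]

end Riedtmann

variable {A B X D : C}

instance Cross.finite {E : C} : Finite (Cross A B X D E) := .of_equiv _ crossEquivProd.symm

instance Frame.finite {A₁ A₂ B₁ B₂ : C} : Finite (Frame A B X D A₁ A₂ B₁ B₂) :=
  .of_equiv _ frameEquivProd.symm

theorem isoClass_mem_of_hallPair {M N E : C} (z : HallPair M N E) (R : Finset (IsoClass C))
    (hR : ∀ m n : IsoClass C, hallP m.out n.out E ≠ 0 → m ∈ R ∧ n ∈ R) :
    isoClass M ∈ R ∧ isoClass N ∈ R := by
  obtain ⟨a⟩ := nonempty_iso_out M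
  obtain ⟨b⟩ := nonempty_iso_out N
  exact hR _ _ (hallP_ne_zero (HallPair.congr a.symm b.symm (Iso.refl E) z))

theorem sum_card_compat_frame {E : C} (c : Cross A B X D E) (R : Finset (IsoClass C))
    (hA : ∀ m n : IsoClass C, hallP m.out n.out A ≠ 0 → m ∈ R ∧ n ∈ R)
    (hB : ∀ m n : IsoClass C, hallP m.out n.out B ≠ 0 → m ∈ R ∧ n ∈ R) :
    ∑ p ∈ (R ×ˢ R) ×ˢ (R ×ˢ R),
      (Nat.card {r : Frame A B X D p.1.1.out p.1.2.out p.2.1.out p.2.2.out // Compat r c} : ℝ) /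
        (autCard p.1.1.out * autCard p.1.2.out * (autCard p.2.1.out * autCard p.2.2.out)) = 1 := by
  obtain ⟨A₁, A₂, B₁, B₂, r, hr⟩ := exists_compat_frame c
  obtain ⟨hA₁, hA₂⟩ := isoClass_mem_of_hallPair r.bottom R hA
  obtain ⟨hB₁, hB₂⟩ := isoClass_mem_of_hallPair r.top R hB
  have term_eq (p : (IsoClass C × IsoClass C) × (IsoClass C × IsoClass C)) :
      (Nat.card {r : Frame A B X D p.1.1.out p.1.2.out p.2.1.out p.2.2.out // Compat r c} : ℝ) /
        (autCard p.1.1.out * autCard p.1.2.out * (autCard p.2.1.out * autCard p.2.2.out)) =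
      ((Nat.card (A₁ ≅ p.1.1.out) : ℝ) / autCard p.1.1.out *
        ((Nat.card (A₂ ≅ p.1.2.out) : ℝ) / autCard p.1.2.out)) *
      ((Nat.card (B₁ ≅ p.2.1.out) : ℝ) / autCard p.2.1.out *
        ((Nat.card (B₂ ≅ p.2.2.out) : ℝ) / autCard p.2.2.out)) := by
    obtain ⟨φ⟩ := Frame.nonempty_compat_equiv (A₁' := p.1.1.out) (A₂' := p.1.2.out)
      (B₁' := p.2.1.out) (B₂' := p.2.2.out) hr
    simp only [Nat.card_congr φ, Nat.card_prod, Nat.cast_mul, div_mul_div_comm]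
  simp only [term_eq, Finset.sum_product, ← Finset.mul_sum, sum_card_iso_div _ _ hA₁,
    sum_card_iso_div _ _ hA₂, sum_card_iso_div _ _ hB₁, sum_card_iso_div _ _ hB₂, mul_one]

variable [HasExt.{w} C]

theorem Frame.card_compat_eq {A₁ A₂ B₁ B₂ : C} (r : Frame A B X D A₁ A₂ B₁ B₂) (E : C) :
    Nat.card {c : Cross A B X D E // Compat r c} =
      Nat.card {z : HallPair A₁ r.po E //
        z.extClass.comp (Ext.mk₀.{w} r.toSum) (add_zero 1) = r.pbPair.extClass} *
        Nat.card (A₁ ⟶ B₁ ⊞ A₂) := by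
  classical
  have := Fintype.ofFinite (HallPair A₁ r.po E)
  rw [Nat.card_congr (r.compatEquiv E), Nat.card_sigma,
    Finset.sum_congr rfl fun z _ => ExtHom.card_eq_ite, ← Finset.sum_filter, Finset.sum_const,
    smul_eq_mul, Nat.card_eq_fintype_card (α := {z : HallPair A₁ r.po E // _}),
    Fintype.card_subtype]

variable [EnoughInjectives C]

theorem sum_card_compat_cross {A₁ A₂ B₁ B₂ : C} [∀ M N : C, Finite (Ext.{w} M N 1)]
    [Subsingleton (Ext.{w} A₁ B₂ 2)] (r : Frame A B X D A₁ A₂ B₁ B₂)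
    (Q : Finset (IsoClass C)) (hQ : ∀ e : IsoClass C, hallP A B e.out ≠ 0 → e ∈ Q) :
    ∑ e ∈ Q, (Nat.card {c : Cross A B X D e.out // Compat r c} : ℝ) / autCard e.out =
      Nat.card (Ext.{w} A₁ B₂ 1) / Nat.card (A₁ ⟶ B₂) := by
  let S : Set (Ext.{w} A₁ r.po 1) :=
    {ξ | ξ.comp (Ext.mk₀ r.toSum) (add_zero 1) = r.pbPair.extClass}
  have mem (e : IsoClass C) (z : HallPair A₁ r.po e.out) (hz : z.extClass ∈ S) : e ∈ Q := by
    obtain ⟨q⟩ := ExtHom.nonempty_of_extClass_comp_eq hz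
    exact hQ e (hallP_ne_zero ((r.compatEquiv e.out).symm ⟨z, q⟩).1.column)
  have card_S : (Nat.card (A₁ ⟶ B₂) * Nat.card (A₁ ⟶ B₁ ⊞ A₂) * Nat.card S : ℝ) =
      Nat.card (A₁ ⟶ r.po) * Nat.card (Ext.{w} A₁ B₂ 1) := by
    exact_mod_cast r.isExt_toSum.card_comp_eq A₁ r.pbPair.extClass
  have hom_ne_zero (M N : C) : (Nat.card (M ⟶ N) : ℝ) ≠ 0 := Nat.cast_ne_zero.2 Nat.card_pos.ne'
  calc
    _ = (∑ e ∈ Q, (Nat.card {z : HallPair A₁ r.po e.out // z.extClass ∈ S} : ℝ) /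
          autCard e.out) * Nat.card (A₁ ⟶ B₁ ⊞ A₂) := by
      rw [Finset.sum_mul]
      refine Finset.sum_congr rfl fun e _ => ?_
      rw [r.card_compat_eq, Nat.cast_mul, div_mul_eq_mul_div]
      rfl
    _ = Nat.card S / Nat.card (A₁ ⟶ r.po) * Nat.card (A₁ ⟶ B₁ ⊞ A₂) := by
      rw [sum_card_extClass_mem S Q mem]
    _ = _ := by
      rw [div_mul_eq_mul_div, div_eq_div_iff (hom_ne_zero _ _) (hom_ne_zero _ _)]
      linear_combination card_S

/-- Green's formula. Both sides count the pairs of a cross and a compatible frame. -/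
theorem hallP_green [∀ M N : C, Finite (Ext.{w} M N 1)] [∀ M N : C, Subsingleton (Ext.{w} M N 2)]
    (A B X D : C) (Q R : Finset (IsoClass C))
    (hQ : ∀ e : IsoClass C, hallP A B e.out ≠ 0 → e ∈ Q)
    (hA : ∀ m n : IsoClass C, hallP m.out n.out A ≠ 0 → m ∈ R ∧ n ∈ R)
    (hB : ∀ m n : IsoClass C, hallP m.out n.out B ≠ 0 → m ∈ R ∧ n ∈ R) :
    ∑ e ∈ Q, (hallP A B e.out * hallP X D e.out : ℝ) / autCard e.out =
      ∑ p ∈ (R ×ˢ R) ×ˢ (R ×ˢ R),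
        (Nat.card (Ext.{w} p.1.1.out p.2.2.out 1) : ℝ) / Nat.card (p.1.1.out ⟶ p.2.2.out) *
        (hallP p.2.1.out p.2.2.out B * hallP p.1.2.out p.2.2.out D *
          (hallP p.1.1.out p.2.1.out X * hallP p.1.1.out p.1.2.out A)) /
        (autCard p.1.1.out * autCard p.1.2.out * (autCard p.2.1.out * autCard p.2.2.out)) := by
  let F (p : (IsoClass C × IsoClass C) × (IsoClass C × IsoClass C)) : Type v :=
    Frame A B X D p.1.1.out p.1.2.out p.2.1.out p.2.2.out
  have := fun e : IsoClass C => Fintype.ofFinite (Cross A B X D e.out)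
  have := fun p => Fintype.ofFinite (F p)
  have cross_eq_sum (e : IsoClass C) : (hallP A B e.out * hallP X D e.out : ℝ) =
      ∑ p ∈ (R ×ˢ R) ×ˢ (R ×ˢ R),
        (Nat.card (Σ c : Cross A B X D e.out, {r : F p // Compat r c}) : ℝ) /
        (autCard p.1.1.out * autCard p.1.2.out * (autCard p.2.1.out * autCard p.2.2.out)) := by
    simp only [Nat.card_sigma, Nat.cast_sum, Finset.sum_div]
    rw [Finset.sum_comm, Finset.sum_congr rfl fun c _ => sum_card_compat_frame c R hA hB]
    rw [← Nat.cast_mul, ← card_cross]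
    simp
  have card_swap (e : IsoClass C) (p) :
      Nat.card (Σ c : Cross A B X D e.out, {r : F p // Compat r c}) =
        ∑ r : F p, Nat.card {c : Cross A B X D e.out // Compat r c} := by
    rw [← Nat.card_sigma]
    exact Nat.card_congr ((Equiv.subtypeProdEquivSigmaSubtype _).symm.trans
      (((Equiv.prodComm _ _).subtypeEquiv fun _ => Iff.rfl).trans
        (Equiv.subtypeProdEquivSigmaSubtype _)))
  simp only [cross_eq_sum, card_swap, Finset.sum_div, Nat.cast_sum]
  rw [Finset.sum_comm]
  refine Finset.sum_congr rfl fun p _ => ?_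
  rw [Finset.sum_comm]
  simp only [div_right_comm, ← Finset.sum_div, fun r => sum_card_compat_cross r Q hQ]
  rw [Finset.sum_const, nsmul_eq_mul, Finset.card_univ, ← Nat.card_eq_fintype_card, card_frame]
  push_cast
  ring

end Green

/-! ### Finiteness and the Euler form -/

theorem card_subobject_lt_of_mono {C : Type u} [Category.{v} C] {X Y : C} (f : X ⟶ Y) [Mono f]
    [Limits.HasPullbacks C] [Finite (Subobject Y)] (hf : ¬IsIso f) :
    Nat.card (Subobject X) < Nat.card (Subobject Y) := by
  have injective := Subobject.map_obj_injective f
  refine (Nat.card_le_card_of_injective _ injective).lt_of_ne fun card_eq => hf ?_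
  obtain ⟨S, hS⟩ := ((Nat.bijective_iff_injective_and_card _).2 ⟨injective, card_eq⟩).2 ⊤
  rw [Subobject.isIso_iff_mk_eq_top, eq_top_iff, ← hS, ← Subobject.map_top]
  exact (Subobject.map f).monotone le_top

section FiniteClasses

open Limits Abelian

variable {C : Type u} [Category.{v} C] [Abelian C]

theorem finite_setOf_hallP_middle_ne_zero [HasExt.{w} C] (M N : C) [Finite (Ext.{w} M N 1)] :
    {e : IsoClass C | hallP M N e.out ≠ 0}.Finite := by
  have z (e : {e : IsoClass C | hallP M N e.out ≠ 0}) : HallPair M N (e.1.out : C) :=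
    (nonempty_hallPair_of_hallP_ne_zero e.2).some
  have extClass_injective : Function.Injective fun e => (z e).extClass := fun e e' h => by
    obtain ⟨p⟩ := ExtHom.nonempty_of_extClass_comp_eq (z := z e) (z' := z e') (c := 𝟙 N)
      (by rwa [Ext.comp_mk₀_id])
    have := p.isIso
    have := isoClass_eq_iff.2 ⟨asIso p.map⟩
    rw [isoClass_out, isoClass_out] at this
    exact Subtype.ext this
  exact Set.finite_coe_iff.1 (Finite.of_injective _ extClass_injective)

theorem finite_setOf_hallP_ends_ne_zero (E : C) [Finite (Subobject E)] :
    {p : IsoClass C × IsoClass C | hallP p.1.out p.2.out E ≠ 0}.Finite := by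
  have z (p : {p : IsoClass C × IsoClass C | hallP p.1.out p.2.out E ≠ 0}) :
      HallPair (p.1.1.out : C) p.1.2.out E := (nonempty_hallPair_of_hallP_ne_zero p.2).some
  have _ (p) : Mono (z p).ι := (z p).isExt.mono
  have subobject_injective : Function.Injective fun p => Subobject.mk (z p).ι := fun p p' h => by
    let a := Subobject.isoOfMkEqMk _ _ h
    have ha : a.hom ≫ (z p').ι = (z p).ι := Subobject.ofMkLEMk_comp _
    obtain ⟨b, -⟩ := (z p).isExt.exists_iso_right (ha ▸ (z p').isExt.iso_left a)
    have h₁ := isoClass_eq_iff.2 ⟨a⟩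
    have h₂ := isoClass_eq_iff.2 ⟨b⟩
    rw [isoClass_out, isoClass_out] at h₁ h₂
    exact Subtype.ext (Prod.ext h₂ h₁)
  exact Set.finite_coe_iff.1 (Finite.of_injective _ subobject_injective)

namespace IsExt

variable {M N E : C} {f : N ⟶ E} {g : E ⟶ M}

theorem card_subobject_left_lt [Finite (Subobject E)] (h : IsExt f g) (hM : ¬IsZero M) :
    Nat.card (Subobject N) < Nat.card (Subobject E) := by
  have := h.mono
  have := h.epi
  refine card_subobject_lt_of_mono f fun _ => hM (IsZero.of_epi_eq_zero g ?_)
  rw [← cancel_epi f, h.zero, comp_zero]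

end IsExt

end FiniteClasses

section FGModuleFunctor

open Limits

variable {k : Type u} [Field k] {J : Type v} [Category.{w} J]

theorem exists_factor_of_range_le {N N' E : J ⥤ FGModuleCat.{u} k} (f : N ⟶ E) (g : N' ⟶ E)
    [Mono g] (h : ∀ x, LinearMap.range (f.app x).hom.hom ≤ LinearMap.range (g.app x).hom.hom) :
    ∃ s : N ⟶ N', s ≫ g = f := by
  refine (IsExt.of_mono g).exists_lift f ?_
  ext x y
  obtain ⟨y', hy'⟩ := h x ⟨y, rfl⟩
  have g_comp_π : g.app x ≫ (cokernel.π g).app x = 0 := by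
    rw [← NatTrans.comp_app, cokernel.condition, zero_app]
  have : ((cokernel.π g).app x).hom.hom ((g.app x).hom.hom y') = 0 :=
    congrArg (fun t => t.hom.hom y') g_comp_π
  rwa [hy'] at this

instance finite_hom_fgModuleFunctor [Finite k] [Finite J] (M N : J ⥤ FGModuleCat.{u} k) :
    Finite (M ⟶ N) := by
  have (W : FGModuleCat.{u} k) : Finite W := Module.finite_of_finite k
  refine Finite.of_injective
    (fun (f : M ⟶ N) (x : J) (y : M.obj x) => (f.app x).hom.hom y) fun f g h => ?_
  ext x y
  exact congrFun (congrFun h x) y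

instance finite_subobject_fgModuleFunctor [Finite k] [Finite J] (E : J ⥤ FGModuleCat.{u} k) :
    Finite (Subobject E) := by
  have (W : FGModuleCat.{u} k) : Finite W := Module.finite_of_finite k
  have (W : FGModuleCat.{u} k) : Finite (Submodule k W) :=
    Finite.of_injective (fun S => (S : Set W)) SetLike.coe_injective
  have le_of_range_eq {S T : Subobject E} (h : ∀ x : J,
      LinearMap.range (S.arrow.app x).hom.hom = LinearMap.range (T.arrow.app x).hom.hom) :
      S ≤ T := by
    obtain ⟨s, hs⟩ := exists_factor_of_range_le S.arrow T.arrow fun x => (h x).le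
    exact Subobject.le_of_comm s hs
  refine Finite.of_injective (fun (S : Subobject E) (x : J) =>
    LinearMap.range (S.arrow.app x).hom.hom) fun S T h => ?_
  exact le_antisymm (le_of_range_eq (congrFun h)) (le_of_range_eq fun x => (congrFun h x).symm)

end FGModuleFunctor

namespace QuiverRep

open Limits Abelian

variable {k : Type u} [Field k] {V : Type u} [Quiver.{u} V] [Finite V]

instance finite_paths : Finite (Paths V) := inferInstanceAs (Finite V)

variable [∀ x y : V, Finite (Quiver.Path x y)]

instance enoughInjectives : EnoughInjectives (QuiverRep k V) :=
  have : ∀ x y : Paths V, Finite (x ⟶ y) := ‹∀ x y : V, Finite (Quiver.Path x y)›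
  have : EnoughInjectives (FGModuleCat k) := ⟨fun W => ⟨⟨W, inferInstance, 𝟙 W, inferInstance⟩⟩⟩
  enoughInjectives_functor

theorem subsingleton_repExt (M N : QuiverRep k V) (i : ℕ) (hi : 2 ≤ i) :
    Subsingleton (repExt M N i) :=
  have := hasInjectiveDimensionLT_two_pathFunctor N
  HasInjectiveDimensionLT.subsingleton N 2 i hi M

instance subsingleton_repExt_two (M N : QuiverRep k V) : Subsingleton (repExt M N 2) :=
  subsingleton_repExt M N 2 le_rfl

theorem eulerForm_eq (M N : QuiverRep k V) : eulerForm M N =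
    (Module.finrank k (repExt M N 0) : ℤ) - Module.finrank k (repExt M N 1) := by
  rw [eulerForm, finsum_eq_sum_of_support_subset (s := Finset.range 2)]
  · simp [Finset.sum_range_succ, sub_eq_add_neg]
  · intro i hi
    by_contra h
    have := subsingleton_repExt M N i (by rw [Finset.coe_range, Set.mem_Iio] at h; lia)
    simp [Module.finrank_zero_of_subsingleton] at hi

variable [Finite k]

instance finite_repExt_one (M N : QuiverRep k V) : Finite (repExt M N 1) := by
  have hS := (IsExt.of_mono (Injective.ι N)).shortExact
  refine Finite.of_surjective
    (fun t : M ⟶ cokernel (Injective.ι N) => (Ext.mk₀ t).comp hS.extClass (zero_add 1)) fun x => ?_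
  obtain ⟨y, hy⟩ :=
    Ext.covariant_sequence_exact₁ _ hS x (Ext.eq_zero_of_injective _) (zero_add 1)
  exact ⟨Ext.homEquiv₀ y, by simpa [Ext.mk₀_homEquiv₀_apply] using hy⟩

theorem finite_repExt (M N : QuiverRep k V) : ∀ i : ℕ, Finite (repExt M N i)
  | 0 => Finite.of_equiv _ Ext.homEquiv₀.symm
  | 1 => finite_repExt_one M N
  | i + 2 => have := subsingleton_repExt M N (i + 2) (by lia); inferInstance

theorem card_repExt (M N : QuiverRep k V) (i : ℕ) :
    Nat.card (repExt M N i) = Nat.card k ^ Module.finrank k (repExt M N i) :=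
  have := finite_repExt M N i
  Module.natCard_eq_pow_finrank

theorem card_hom (M N : QuiverRep k V) :
    Nat.card (M ⟶ N) = Nat.card k ^ Module.finrank k (repExt M N 0) :=
  (Nat.card_congr Ext.homEquiv₀.symm).trans (card_repExt M N 0)

theorem cardUnit_zpow_neg_eulerForm (M N : QuiverRep k V) :
    ((cardUnit k ^ (-eulerForm M N) : ℝˣ) : ℝ) =
      (Nat.card (repExt M N 1) : ℝ) / Nat.card (M ⟶ N) := by
  have h0 : (Nat.card k : ℝ) ≠ 0 := Nat.cast_ne_zero.2 Nat.card_pos.ne'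
  rw [card_hom, card_repExt, Nat.cast_pow, Nat.cast_pow, eulerForm_eq, neg_sub,
    Units.val_zpow_eq_zpow_val, cardUnit, Units.val_mk0, zpow_sub₀ h0, zpow_natCast, zpow_natCast]

theorem eulerForm_add_right (T : QuiverRep k V) {M N E : QuiverRep k V} {f : N ⟶ E} {g : E ⟶ M}
    (h : IsExt f g) : eulerForm T E = eulerForm T N + eulerForm T M := by
  have card_eq := h.card_euler_covariant T
  simp only [card_hom, card_repExt, ← pow_add] at card_eq
  have := Nat.pow_right_injective (Finite.one_lt_card (α := k)) card_eq
  simp only [eulerForm_eq]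
  lia

theorem eulerForm_add_left (T : QuiverRep k V) {M N E : QuiverRep k V} {f : N ⟶ E} {g : E ⟶ M}
    (h : IsExt f g) : eulerForm E T = eulerForm N T + eulerForm M T := by
  have card_eq := h.card_euler_contravariant T
  simp only [card_hom, card_repExt, ← pow_add] at card_eq
  have := Nat.pow_right_injective (Finite.one_lt_card (α := k)) card_eq
  simp only [eulerForm_eq]
  lia

end QuiverRep

namespace K0

open Limits ZeroObject

variable {C : Type w} [Category.{v} C] [Abelian C] {A : Type*} [AddCommGroup A]

theorem eq_of_iso_of_additive {φ : C → A}
    (h : ∀ S : ShortComplex C, S.ShortExact → φ S.X₂ = φ S.X₁ + φ S.X₃) {X Y : C} (e : X ≅ Y) :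
    φ X = φ Y := by
  have eq_add_zero {X Y : C} (e : X ≅ Y) : φ Y = φ X + φ (0 : C) := by
    refine h (ShortComplex.mk e.hom (0 : Y ⟶ 0) comp_zero)
      (ShortComplex.ShortExact.mk' ?_ inferInstance ?_)
    · exact (ShortComplex.exact_iff_epi _ rfl).2 inferInstance
    · exact ⟨fun _ _ _ => (isZero_zero C).eq_of_src _ _⟩
  have zero : φ (0 : C) = 0 := by simpa using eq_add_zero (Iso.refl (0 : C))
  rw [eq_add_zero e, zero, add_zero]

/-- The homomorphism from the Grothendieck group given by a function that is additive on short
exact sequences. -/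
noncomputable def lift (φ : C → A)
    (h : ∀ S : ShortComplex C, S.ShortExact → φ S.X₂ = φ S.X₁ + φ S.X₃) : K0 C →+ A :=
  QuotientAddGroup.lift _
    (FreeAbelianGroup.lift (Quotient.lift φ fun _ _ e => eq_of_iso_of_additive h e.some)) <| by
    rw [AddSubgroup.closure_le]
    rintro _ ⟨S, hS, rfl⟩
    simp [h S hS]

theorem lift_of (φ : C → A)
    (h : ∀ S : ShortComplex C, S.ShortExact → φ S.X₂ = φ S.X₁ + φ S.X₃) (M : C) :
    lift φ h (of M) = φ M := by
  simp [lift, of, ofClass]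

theorem of_add {S : ShortComplex C} (hS : S.ShortExact) : of S.X₂ = of S.X₁ + of S.X₃ := by
  have : (QuotientAddGroup.mk (FreeAbelianGroup.of (isoClass S.X₁) +
      FreeAbelianGroup.of (isoClass S.X₃) - FreeAbelianGroup.of (isoClass S.X₂)) : K0 C) = 0 :=
    (QuotientAddGroup.eq_zero_iff _).2 (AddSubgroup.subset_closure ⟨S, hS, rfl⟩)
  exact (sub_eq_zero.1 this).symm

theorem hom_ext {f g : K0 C →+ A} (h : ∀ M : C, f (of M) = g (of M)) : f = g := by
  refine QuotientAddGroup.addMonoidHom_ext _ (FreeAbelianGroup.lift_ext _ _ fun x => ?_)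
  obtain ⟨M, rfl⟩ := Quotient.exists_rep x
  exact h M

theorem exists_bilinear (φ : C → C → A)
    (hl : ∀ (T : C) (S : ShortComplex C), S.ShortExact → φ S.X₂ T = φ S.X₁ T + φ S.X₃ T)
    (hr : ∀ (T : C) (S : ShortComplex C), S.ShortExact → φ T S.X₂ = φ T S.X₁ + φ T S.X₃) :
    ∃ χ : K0 C →+ K0 C →+ A, ∀ M N : C, χ (of M) (of N) = φ M N :=
  ⟨lift (fun M => lift (φ M) (hr M)) fun S hS => hom_ext fun N => by simp [lift_of, hl N S hS],
    fun M N => by rw [lift_of, lift_of]⟩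

end K0

/-! ### Algebras and coalgebras with Hall structure constants -/

section DualDistrib

variable {R M N M' N' : Type*} [CommSemiring R] [AddCommMonoid M] [Module R M] [AddCommMonoid N]
  [Module R N] [AddCommMonoid M'] [Module R M'] [AddCommMonoid N'] [Module R N']

theorem dualDistrib_map (f : Module.Dual R M') (g : Module.Dual R N') (F : M →ₗ[R] M')
    (G : N →ₗ[R] N') (t : M ⊗[R] N) :
    TensorProduct.dualDistrib R M' N' (f ⊗ₜ g) (TensorProduct.map F G t) =
      TensorProduct.dualDistrib R M N ((f ∘ₗ F) ⊗ₜ (g ∘ₗ G)) t := by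
  induction t with
  | zero => simp
  | add x y hx hy => simp only [map_add, hx, hy]
  | tmul x y => simp

theorem dualDistrib_assoc (f : Module.Dual R M) (g : Module.Dual R N) (h : Module.Dual R M')
    (t : (M ⊗[R] N) ⊗[R] M') :
    TensorProduct.dualDistrib R M (N ⊗[R] M') (f ⊗ₜ TensorProduct.dualDistrib R N M' (g ⊗ₜ h))
        (TensorProduct.assoc R M N M' t) =
      TensorProduct.dualDistrib R (M ⊗[R] N) M'
        (TensorProduct.dualDistrib R M N (f ⊗ₜ g) ⊗ₜ h) t := by
  suffices TensorProduct.dualDistrib R M (N ⊗[R] M')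
      (f ⊗ₜ TensorProduct.dualDistrib R N M' (g ⊗ₜ h)) ∘ₗ
        (TensorProduct.assoc R M N M').toLinearMap =
      TensorProduct.dualDistrib R (M ⊗[R] N) M'
        (TensorProduct.dualDistrib R M N (f ⊗ₜ g) ⊗ₜ h) from LinearMap.congr_fun this t
  exact TensorProduct.ext_threefold fun x y z => by simp [mul_assoc]

variable {ι κ : Type*} (b : Module.Basis ι R M) (c : Module.Basis κ R N)

theorem coord_tensorProduct (i : ι) (j : κ) : (b.tensorProduct c).coord (i, j) =
    TensorProduct.dualDistrib R M N (b.coord i ⊗ₜ c.coord j) :=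
  TensorProduct.ext' fun _ _ => by simp [mul_comm]

theorem ext_dualDistrib_coord {t s : M ⊗[R] N}
    (h : ∀ i j, TensorProduct.dualDistrib R M N (b.coord i ⊗ₜ c.coord j) t =
      TensorProduct.dualDistrib R M N (b.coord i ⊗ₜ c.coord j) s) : t = s :=
  (b.tensorProduct c).ext_elem fun ⟨i, j⟩ => by
    have coord_eq := h i j
    rwa [← coord_tensorProduct] at coord_eq

end DualDistrib

/-- Structure constants `P m n e` of a Hall algebra with basis `ι`. They stand for the number of
short exact sequences `0 ⟶ n ⟶ e ⟶ m ⟶ 0`, with `a m` in the role of the number of automorphisms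
of `m`, and `size` any quantity that drops on passing to a proper subobject. The finite sets `mid`
and `ends` are the ranges of the sums in the multiplication and the comultiplication. -/
structure HallConstants (𝕜 ι : Type*) [Field 𝕜] where
  P : ι → ι → ι → 𝕜
  a : ι → 𝕜
  mid : ι → ι → Finset ι
  ends : ι → Finset (ι × ι)
  zero : ι
  size : ι → ℕ
  a_ne_zero (m : ι) : a m ≠ 0
  a_zero : a zero = 1
  mem_mid {m n e : ι} : P m n e ≠ 0 → e ∈ mid m n
  mem_ends {m n e : ι} : P m n e ≠ 0 → (m, n) ∈ ends e
  P_zero_right (m : ι) : P m zero m = a m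
  P_zero_left (m : ι) : P zero m m = a m
  eq_of_P_zero_right {m e : ι} : P m zero e ≠ 0 → e = m
  eq_of_P_zero_left {m e : ι} : P zero m e ≠ 0 → e = m
  eq_zero_of_P_zero {m n : ι} : P m n zero ≠ 0 → m = zero
  size_lt {m n e : ι} : P m n e ≠ 0 → m ≠ zero → size n < size e
  assoc (m n l f : ι) : ∑ e ∈ mid m n, P m n e * P e l f / a e =
    ∑ e ∈ mid n l, P n l e * P m e f / a e

namespace HallConstants

variable {𝕜 ι : Type*} [Field 𝕜] (d : HallConstants 𝕜 ι)

/-- The Hall multiplication. -/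
noncomputable def mul : (ι →₀ 𝕜) ⊗[𝕜] (ι →₀ 𝕜) →ₗ[𝕜] ι →₀ 𝕜 :=
  TensorProduct.lift <| Finsupp.linearCombination 𝕜 fun m => Finsupp.linearCombination 𝕜 fun n =>
    ∑ e ∈ d.mid m n, (d.P m n e / (d.a m * d.a n)) • Finsupp.single e 1

theorem mul_single (m n : ι) : d.mul (Finsupp.single m 1 ⊗ₜ Finsupp.single n 1) =
    ∑ e ∈ d.mid m n, (d.P m n e / (d.a m * d.a n)) • Finsupp.single e 1 := by
  simp [mul]

theorem mul_single_apply (m n e : ι) :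
    d.mul (Finsupp.single m 1 ⊗ₜ Finsupp.single n 1) e = d.P m n e / (d.a m * d.a n) := by
  classical
  rw [mul_single, Finsupp.finsetSum_apply]
  simp only [Finsupp.smul_apply, Finsupp.single_apply, smul_eq_mul, mul_ite, mul_one, mul_zero,
    Finset.sum_ite_eq', ite_eq_left_iff]
  exact fun h => by rw [not_not.1 (mt d.mem_mid h), zero_div]

protected theorem mul_assoc (x y z : ι →₀ 𝕜) :
    d.mul (d.mul (x ⊗ₜ y) ⊗ₜ z) = d.mul (x ⊗ₜ d.mul (y ⊗ₜ z)) := by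
  suffices d.mul ∘ₗ TensorProduct.map d.mul LinearMap.id = d.mul ∘ₗ
      TensorProduct.map LinearMap.id d.mul ∘ₗ
        (TensorProduct.assoc 𝕜 (ι →₀ 𝕜) (ι →₀ 𝕜) (ι →₀ 𝕜)).toLinearMap from
    LinearMap.congr_fun this ((x ⊗ₜ y) ⊗ₜ z)
  ext m n l f
  simp only [LinearMap.comp_apply, TensorProduct.AlgebraTensorModule.curry_apply,
    TensorProduct.curry_apply, LinearMap.restrictScalars_self, Finsupp.lsingle_apply,
    TensorProduct.map_tmul, LinearMap.id_apply, LinearEquiv.coe_coe, TensorProduct.assoc_tmul,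
    d.mul_single m n, d.mul_single n l, TensorProduct.sum_tmul, TensorProduct.tmul_sum, map_sum,
    Finsupp.finsetSum_apply, TensorProduct.tmul_smul, ← TensorProduct.smul_tmul', map_smul,
    Finsupp.smul_apply, mul_single_apply, smul_eq_mul]
  have assoc := congrArg (· / (d.a m * d.a n * d.a l)) (d.assoc m n l f)
  simp only [Finset.sum_div] at assoc
  convert assoc using 2 <;> ring

theorem P_zero_right_eq [DecidableEq ι] (m e : ι) :
    d.P m d.zero e = if e = m then d.a m else 0 := by
  split_ifs with h
  · rw [h, d.P_zero_right]
  · exact not_not.1 (mt d.eq_of_P_zero_right h)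

theorem P_zero_left_eq [DecidableEq ι] (m e : ι) :
    d.P d.zero m e = if e = m then d.a m else 0 := by
  split_ifs with h
  · rw [h, d.P_zero_left]
  · exact not_not.1 (mt d.eq_of_P_zero_left h)

theorem mul_single_zero (x : ι →₀ 𝕜) : d.mul (x ⊗ₜ Finsupp.single d.zero 1) = x := by
  classical
  suffices d.mul ∘ₗ (TensorProduct.mk 𝕜 _ _).flip (Finsupp.single d.zero 1) = LinearMap.id from
    LinearMap.congr_fun this x
  ext m e
  have := d.a_ne_zero m
  simp only [LinearMap.comp_apply, Finsupp.lsingle_apply, LinearMap.flip_apply,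
    TensorProduct.mk_apply, mul_single_apply, P_zero_right_eq, d.a_zero, LinearMap.id_apply,
    Finsupp.single_apply, eq_comm (a := e)]
  split_ifs <;> simp [this]

theorem mul_zero_single (x : ι →₀ 𝕜) : d.mul (Finsupp.single d.zero 1 ⊗ₜ x) = x := by
  classical
  suffices d.mul ∘ₗ TensorProduct.mk 𝕜 _ _ (Finsupp.single d.zero 1) = LinearMap.id from
    LinearMap.congr_fun this x
  ext m e
  have := d.a_ne_zero m
  simp only [LinearMap.comp_apply, Finsupp.lsingle_apply, TensorProduct.mk_apply,
    mul_single_apply, P_zero_left_eq, d.a_zero, LinearMap.id_apply, Finsupp.single_apply,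
    eq_comm (a := e)]
  split_ifs <;> simp [this]

/-- The Hall comultiplication. -/
noncomputable def comul : (ι →₀ 𝕜) →ₗ[𝕜] (ι →₀ 𝕜) ⊗[𝕜] (ι →₀ 𝕜) :=
  Finsupp.linearCombination 𝕜 fun e => ∑ p ∈ d.ends e,
    (d.P p.1 p.2 e / d.a e) • (Finsupp.single p.2 1 ⊗ₜ[𝕜] Finsupp.single p.1 1)

theorem comul_single (e : ι) : d.comul (Finsupp.single e 1) = ∑ p ∈ d.ends e,
    (d.P p.1 p.2 e / d.a e) • (Finsupp.single p.2 1 ⊗ₜ[𝕜] Finsupp.single p.1 1) := by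
  simp [comul]

theorem sum_ends_ite [DecidableEq ι] (m n e : ι) (r : 𝕜) :
    (∑ p ∈ d.ends e, if p = (m, n) then d.P p.1 p.2 e * r else 0) = d.P m n e * r := by
  rw [Finset.sum_ite_eq', ite_eq_left_iff]
  exact fun h => by rw [not_not.1 (mt d.mem_ends h), zero_mul]

theorem finsuppTensorFinsupp_comul_single (m n e : ι) :
    finsuppTensorFinsupp' 𝕜 ι ι (d.comul (Finsupp.single e 1)) (n, m) = d.P m n e / d.a e := by
  classical
  rw [comul_single, map_sum, Finsupp.finsetSum_apply, div_eq_mul_inv, ← d.sum_ends_ite m n e]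
  refine Finset.sum_congr rfl fun ⟨p₁, p₂⟩ _ => ?_
  rw [map_smul, Finsupp.smul_apply, finsuppTensorFinsupp'_single_tmul_single,
    Finsupp.single_apply, smul_eq_mul, div_eq_mul_inv]
  simp only [Prod.mk.injEq, and_comm (a := p₂ = n)]
  split_ifs <;> simp

/-- The bilinear form for which the basis is orthogonal and `m` has the square length `(a m)⁻¹`.
It makes the comultiplication the transpose of the opposite multiplication. -/
noncomputable def pair : (ι →₀ 𝕜) →ₗ[𝕜] Module.Dual 𝕜 (ι →₀ 𝕜) :=
  Finsupp.linearCombination 𝕜 fun m => (d.a m)⁻¹ • Finsupp.lapply m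

theorem pair_single (m : ι) (x : ι →₀ 𝕜) : d.pair (Finsupp.single m 1) x = (d.a m)⁻¹ * x m := by
  simp [pair]

theorem pair_single_right (m : ι) (x : ι →₀ 𝕜) :
    d.pair x (Finsupp.single m 1) = (d.a m)⁻¹ * x m := by
  classical
  suffices d.pair.flip (Finsupp.single m 1) = (d.a m)⁻¹ • Finsupp.lapply m from
    LinearMap.congr_fun this x
  ext n
  simp only [LinearMap.comp_apply, Finsupp.lsingle_apply, LinearMap.flip_apply, pair_single,
    LinearMap.smul_apply, Finsupp.lapply_apply, Finsupp.single_apply, smul_eq_mul,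
    eq_comm (a := n)]
  split_ifs with h <;> simp [h]

theorem coord_eq_pair (m : ι) : (Finsupp.basisSingleOne (R := 𝕜)).coord m =
    d.a m • d.pair (Finsupp.single m 1) := by
  ext x
  simp [pair_single, d.a_ne_zero m]

theorem ext_pair₂ {t s : (ι →₀ 𝕜) ⊗[𝕜] (ι →₀ 𝕜)}
    (h : ∀ m n, TensorProduct.dualDistrib 𝕜 _ _
      (d.pair (Finsupp.single m 1) ⊗ₜ d.pair (Finsupp.single n 1)) t =
      TensorProduct.dualDistrib 𝕜 _ _
        (d.pair (Finsupp.single m 1) ⊗ₜ d.pair (Finsupp.single n 1)) s) : t = s := by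
  let b : Module.Basis ι 𝕜 (ι →₀ 𝕜) := Finsupp.basisSingleOne
  have coord_eq (m : ι) : b.coord m = d.a m • d.pair (Finsupp.single m 1) := d.coord_eq_pair m
  refine ext_dualDistrib_coord b b fun i j => ?_
  rw [coord_eq, coord_eq, TensorProduct.smul_tmul_smul, map_smul, LinearMap.smul_apply,
    LinearMap.smul_apply, h]

theorem ext_pair₃ {t s : (ι →₀ 𝕜) ⊗[𝕜] ((ι →₀ 𝕜) ⊗[𝕜] (ι →₀ 𝕜))}
    (h : ∀ x y z, TensorProduct.dualDistrib 𝕜 _ _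
      (d.pair x ⊗ₜ TensorProduct.dualDistrib 𝕜 _ _ (d.pair y ⊗ₜ d.pair z)) t =
      TensorProduct.dualDistrib 𝕜 _ _
        (d.pair x ⊗ₜ TensorProduct.dualDistrib 𝕜 _ _ (d.pair y ⊗ₜ d.pair z)) s) : t = s := by
  let b : Module.Basis ι 𝕜 (ι →₀ 𝕜) := Finsupp.basisSingleOne
  have coord_eq (m : ι) : b.coord m = d.pair (d.a m • Finsupp.single m 1) := by
    rw [map_smul, ← coord_eq_pair]
  refine ext_dualDistrib_coord b (b.tensorProduct b) fun i j => ?_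
  obtain ⟨j, l⟩ := j
  simp only [coord_tensorProduct, coord_eq, h]

theorem dualDistrib_pair_comul (x y u : ι →₀ 𝕜) :
    TensorProduct.dualDistrib 𝕜 _ _ (d.pair y ⊗ₜ d.pair x) (d.comul u) =
      d.pair (d.mul (x ⊗ₜ y)) u := by
  classical
  suffices d.comul.dualMap ∘ₗ TensorProduct.dualDistrib 𝕜 _ _ ∘ₗ
      TensorProduct.map d.pair d.pair ∘ₗ (TensorProduct.comm 𝕜 _ _).toLinearMap =
        d.pair ∘ₗ d.mul from
    LinearMap.congr_fun (LinearMap.congr_fun this (x ⊗ₜ y)) u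
  ext m n e
  have sum_eq := d.sum_ends_ite m n e ((d.a e)⁻¹ * (d.a m * d.a n)⁻¹)
  simp only [LinearMap.comp_apply, TensorProduct.AlgebraTensorModule.curry_apply,
    TensorProduct.curry_apply, LinearMap.restrictScalars_self, Finsupp.lsingle_apply,
    LinearEquiv.coe_coe, TensorProduct.comm_tmul, TensorProduct.map_tmul,
    LinearMap.dualMap_apply, pair_single_right, mul_single_apply, comul_single, map_sum, map_smul,
    TensorProduct.dualDistrib_apply, smul_eq_mul]
  refine Eq.trans (Finset.sum_congr rfl fun ⟨p₁, p₂⟩ _ => ?_) (sum_eq.trans (by ring))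
  by_cases h₁ : p₁ = m <;> by_cases h₂ : p₂ = n <;> simp [h₁, h₂, div_eq_mul_inv]
  ring

theorem comul_assoc (u : ι →₀ 𝕜) :
    TensorProduct.map LinearMap.id d.comul (d.comul u) =
      TensorProduct.assoc 𝕜 _ _ _ (TensorProduct.map d.comul LinearMap.id (d.comul u)) := by
  refine d.ext_pair₃ fun x y z => ?_
  have pair_comul (x y : ι →₀ 𝕜) :
      TensorProduct.dualDistrib 𝕜 _ _ (d.pair y ⊗ₜ d.pair x) ∘ₗ d.comul =
        d.pair (d.mul (x ⊗ₜ y)) := LinearMap.ext fun u => d.dualDistrib_pair_comul x y u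
  rw [dualDistrib_assoc, dualDistrib_map, dualDistrib_map, pair_comul, pair_comul,
    LinearMap.comp_id, LinearMap.comp_id, dualDistrib_pair_comul, dualDistrib_pair_comul,
    d.mul_assoc]

theorem pair_single_zero : d.pair (Finsupp.single d.zero 1) = Finsupp.lapply d.zero := by
  ext
  simp [pair_single, d.a_zero]

theorem ext_pair {x y : ι →₀ 𝕜} (h : ∀ z, d.pair z x = d.pair z y) : x = y := by
  ext m
  have pair_eq := h (Finsupp.single m 1)
  rwa [pair_single, pair_single, mul_right_inj' (inv_ne_zero (d.a_ne_zero m))] at pair_eq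

theorem counit_comul (u : ι →₀ 𝕜) :
    TensorProduct.map (Finsupp.lapply d.zero) LinearMap.id (d.comul u) = 1 ⊗ₜ u := by
  refine (TensorProduct.lid 𝕜 _).injective (d.ext_pair fun x => ?_)
  have pair_lid : d.pair x ∘ₗ (TensorProduct.lid 𝕜 _).toLinearMap =
      TensorProduct.dualDistrib 𝕜 _ _ (LinearMap.id ⊗ₜ d.pair x) :=
    TensorProduct.ext' fun r y => by simp
  refine (LinearMap.congr_fun pair_lid _).trans ?_
  rw [dualDistrib_map, LinearMap.id_comp, LinearMap.comp_id, ← pair_single_zero,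
    dualDistrib_pair_comul, mul_single_zero, TensorProduct.lid_tmul, one_smul]

theorem comul_counit (u : ι →₀ 𝕜) :
    TensorProduct.map LinearMap.id (Finsupp.lapply d.zero) (d.comul u) = u ⊗ₜ 1 := by
  refine (TensorProduct.rid 𝕜 _).injective (d.ext_pair fun x => ?_)
  have pair_rid : d.pair x ∘ₗ (TensorProduct.rid 𝕜 _).toLinearMap =
      TensorProduct.dualDistrib 𝕜 _ _ (d.pair x ⊗ₜ LinearMap.id) :=
    TensorProduct.ext' fun y r => by simp [mul_comm]
  refine (LinearMap.congr_fun pair_rid _).trans ?_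
  rw [dualDistrib_map, LinearMap.id_comp, LinearMap.comp_id, ← pair_single_zero,
    dualDistrib_pair_comul, mul_zero_single, TensorProduct.rid_tmul, one_smul]

theorem comul_single_of_zero_or_zero {e : ι} (he : e ≠ d.zero)
    (h : ∀ m n, d.P m n e ≠ 0 → m = d.zero ∨ n = d.zero) :
    d.comul (Finsupp.single e 1) = Finsupp.single e 1 ⊗ₜ Finsupp.single d.zero 1 +
      Finsupp.single d.zero 1 ⊗ₜ Finsupp.single e 1 := by
  have ne : (d.zero, e) ≠ (e, d.zero) := fun h => he (congrArg Prod.fst h).symm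
  rw [comul_single, Finset.sum_eq_add (d.zero, e) (e, d.zero) ne]
  · simp only [d.P_zero_left, d.P_zero_right, div_self (d.a_ne_zero e), one_smul]
  · rintro ⟨m, n⟩ - ⟨h₁, h₂⟩
    suffices d.P m n e = 0 by rw [this, zero_div, zero_smul]
    by_contra hP
    obtain rfl | rfl := h m n hP
    · exact h₁ (by rw [d.eq_of_P_zero_left hP])
    · exact h₂ (by rw [d.eq_of_P_zero_right hP])
  · exact fun h => absurd (d.mem_ends (by rw [d.P_zero_left]; exact d.a_ne_zero e)) h
  · exact fun h => absurd (d.mem_ends (by rw [d.P_zero_right]; exact d.a_ne_zero e)) h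

theorem comul_single_zero :
    d.comul (Finsupp.single d.zero 1) = Finsupp.single d.zero 1 ⊗ₜ Finsupp.single d.zero 1 := by
  rw [comul_single, Finset.sum_eq_single (d.zero, d.zero)]
  · rw [d.P_zero_right, div_self (d.a_ne_zero _), one_smul]
  · rintro ⟨m, n⟩ - ne
    suffices d.P m n d.zero = 0 by rw [this, zero_div, zero_smul]
    by_contra hP
    obtain rfl := d.eq_zero_of_P_zero hP
    exact ne (by rw [d.eq_of_P_zero_left hP])
  · exact fun h => absurd (d.mem_ends (by rw [d.P_zero_right]; exact d.a_ne_zero _)) h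

theorem mul_apply_zero (x y : ι →₀ 𝕜) : d.mul (x ⊗ₜ y) d.zero = x d.zero * y d.zero := by
  have pair_comul := d.dualDistrib_pair_comul x y (Finsupp.single d.zero 1)
  rw [comul_single_zero, TensorProduct.dualDistrib_apply, pair_single_right, pair_single_right,
    pair_single_right, d.a_zero] at pair_comul
  simpa [mul_comm] using pair_comul.symm

/-- Green's formula: up to the twist `κ`, the comultiplication is multiplicative. Compared with the
usual form, the sum runs over the extensions `p` of `A` and `r` of `B`, so that all four objects of
the inner square appear as their end terms. -/
def GreenFormula (κ : ι → ι → 𝕜) : Prop :=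
  ∀ A B X D : ι, ∑ e ∈ d.mid A B, d.P A B e * d.P X D e / d.a e =
    ∑ p ∈ d.ends A, ∑ r ∈ d.ends B, κ p.1 r.2 *
      (d.P r.1 r.2 B * d.P p.2 r.2 D * (d.P p.1 r.1 X * d.P p.1 p.2 A)) /
        (d.a p.1 * d.a p.2 * (d.a r.1 * d.a r.2))

theorem comul_mul_single {κ : ι → ι → 𝕜} (hκ : d.GreenFormula κ) (A B : ι) :
    d.comul (d.mul (Finsupp.single A 1 ⊗ₜ Finsupp.single B 1)) =
      ∑ p ∈ d.ends A, ∑ r ∈ d.ends B,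
        (d.P p.1 p.2 A / d.a A * (d.P r.1 r.2 B / d.a B) * κ p.1 r.2) •
          (d.mul (Finsupp.single p.2 1 ⊗ₜ Finsupp.single r.2 1) ⊗ₜ
            d.mul (Finsupp.single p.1 1 ⊗ₜ Finsupp.single r.1 1)) := by
  refine d.ext_pair₂ fun D X => ?_
  rw [dualDistrib_pair_comul, d.mul_single A B, map_sum, map_sum]
  simp_rw [map_sum, map_smul, TensorProduct.dualDistrib_apply, pair_single, pair_single_right,
    mul_single_apply, smul_eq_mul]
  have green := congrArg (· / (d.a A * d.a B * (d.a X * d.a D))) (hκ A B X D)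
  simp only [Finset.sum_div] at green
  convert green using 2
  · ring
  · refine Finset.sum_congr rfl fun r _ => ?_
    ring

/-- The values on the basis of the left inverse of `g` under convolution, where `g` is supposed to
fix the unit. They are found by recursion on `size`. -/
noncomputable def convInv (g : (ι →₀ 𝕜) →ₗ[𝕜] ι →₀ 𝕜) (e : ι) : ι →₀ 𝕜 :=
  Finsupp.single e (1 : 𝕜) d.zero • Finsupp.single d.zero 1 - ∑ p ∈ d.ends e,
    if _ : d.size p.2 < d.size e then
      (d.P p.1 p.2 e / d.a e) • d.mul (convInv g p.2 ⊗ₜ g (Finsupp.single p.1 1)) else 0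
termination_by d.size e

variable {g : (ι →₀ 𝕜) →ₗ[𝕜] ι →₀ 𝕜}

theorem sum_ends_mul_convInv (hg : g (Finsupp.single d.zero 1) = Finsupp.single d.zero 1) (e : ι) :
    ∑ p ∈ d.ends e,
      (d.P p.1 p.2 e / d.a e) • d.mul (d.convInv g p.2 ⊗ₜ g (Finsupp.single p.1 1)) =
        Finsupp.single e (1 : 𝕜) d.zero • Finsupp.single d.zero 1 := by
  classical
  have mem_ends : (d.zero, e) ∈ d.ends e :=
    d.mem_ends (by rw [d.P_zero_left]; exact d.a_ne_zero e)
  have mul_convInv_eq (p : ι × ι) :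
      (d.P p.1 p.2 e / d.a e) • d.mul (d.convInv g p.2 ⊗ₜ g (Finsupp.single p.1 1)) =
        (if d.size p.2 < d.size e then (d.P p.1 p.2 e / d.a e) •
          d.mul (d.convInv g p.2 ⊗ₜ g (Finsupp.single p.1 1)) else 0) +
        if p = (d.zero, e) then d.convInv g e else 0 := by
    obtain ⟨m, n⟩ := p
    by_cases hmn : (m, n) = (d.zero, e)
    · obtain ⟨rfl, rfl⟩ := Prod.mk.inj hmn
      simp [d.P_zero_left, d.a_ne_zero, hg, mul_single_zero]
    · by_cases hP : d.P m n e = 0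
      · simp [hP, hmn]
      · have hm : m ≠ d.zero := by
          rintro rfl
          exact hmn (by rw [d.eq_of_P_zero_left hP])
        simp [hmn, d.size_lt hP hm]
  rw [Finset.sum_congr rfl fun p _ => mul_convInv_eq p, Finset.sum_add_distrib,
    Finset.sum_ite_eq', if_pos mem_ends, convInv]
  simp only [dite_eq_ite, add_sub_cancel]

theorem mul_map_convInv_comul (hg : g (Finsupp.single d.zero 1) = Finsupp.single d.zero 1)
    (x : ι →₀ 𝕜) :
    d.mul (TensorProduct.map (Finsupp.linearCombination 𝕜 (d.convInv g)) g (d.comul x)) =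
      x d.zero • Finsupp.single d.zero 1 := by
  suffices d.mul ∘ₗ TensorProduct.map (Finsupp.linearCombination 𝕜 (d.convInv g)) g ∘ₗ d.comul =
      LinearMap.toSpanSingleton 𝕜 _ (Finsupp.single d.zero 1) ∘ₗ Finsupp.lapply d.zero from
    LinearMap.congr_fun this x
  refine Finsupp.lhom_ext' fun e => LinearMap.ext_ring ?_
  simp only [LinearMap.comp_apply, Finsupp.lsingle_apply, comul_single, map_sum, map_smul,
    TensorProduct.map_tmul, Finsupp.linearCombination_single, one_smul,
    d.sum_ends_mul_convInv hg, Finsupp.lapply_apply, LinearMap.toSpanSingleton_apply]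

theorem convInv_single_zero (hg : g (Finsupp.single d.zero 1) = Finsupp.single d.zero 1) :
    d.convInv g d.zero = Finsupp.single d.zero 1 := by
  have conv_eq := d.mul_map_convInv_comul hg (Finsupp.single d.zero 1)
  rwa [comul_single_zero, TensorProduct.map_tmul, hg, mul_single_zero,
    Finsupp.linearCombination_single, Finsupp.single_eq_same, one_smul, one_smul] at conv_eq

theorem convInv_mem {W : ι → Submodule 𝕜 (ι →₀ 𝕜)}
    (h_one : Finsupp.single d.zero 1 ∈ W d.zero)
    (h_mul : ∀ {m n e : ι}, d.P m n e ≠ 0 →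
      ∀ x ∈ W n, d.mul (x ⊗ₜ g (Finsupp.single m 1)) ∈ W e) (e : ι) :
    d.convInv g e ∈ W e := by
  classical
  induction h : d.size e using Nat.strong_induction_on generalizing e with
  | _ n ih =>
    rw [convInv]
    refine sub_mem ?_ (sum_mem fun p _ => ?_)
    · by_cases he : e = d.zero
      · rw [he]
        exact Submodule.smul_mem _ _ h_one
      · rw [Finsupp.single_eq_of_ne' he, zero_smul]
        exact zero_mem _
    split_ifs with hp
    · by_cases hP : d.P p.1 p.2 e = 0
      · rw [hP, zero_div, zero_smul]
        exact zero_mem _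
      · exact Submodule.smul_mem _ _ (h_mul hP _ (ih _ (h ▸ hp) _ rfl))
    · exact zero_mem _

theorem map_single_eq_neg {S : (ι →₀ 𝕜) →ₗ[𝕜] ι →₀ 𝕜}
    (hS : ∀ x, d.mul (TensorProduct.map S LinearMap.id (d.comul x)) =
      x d.zero • Finsupp.single d.zero 1)
    {e : ι} (he : e ≠ d.zero) (h : ∀ m n, d.P m n e ≠ 0 → m = d.zero ∨ n = d.zero) :
    S (Finsupp.single e 1) = -Finsupp.single e 1 := by
  have S_zero : S (Finsupp.single d.zero 1) = Finsupp.single d.zero 1 := by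
    simpa only [comul_single_zero, TensorProduct.map_tmul, LinearMap.id_apply, mul_single_zero,
      Finsupp.single_eq_same, one_smul] using hS (Finsupp.single d.zero 1)
  have S_conv := hS (Finsupp.single e 1)
  rw [d.comul_single_of_zero_or_zero he h, map_add, map_add, TensorProduct.map_tmul,
    TensorProduct.map_tmul, S_zero, LinearMap.id_apply, LinearMap.id_apply, mul_single_zero,
    mul_zero_single, Finsupp.single_eq_of_ne' he, zero_smul] at S_conv
  exact eq_neg_of_add_eq_zero_left S_conv

end HallConstants

/-! ### Hall numbers -/

section HallNumbers

open Limits ZeroObject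

variable {C : Type u} [Category.{v} C]

theorem autCard_of_isZero {Z : C} (hZ : IsZero Z) : autCard Z = 1 :=
  Nat.card_eq_one_iff_unique.2 ⟨⟨fun _ _ => Iso.ext (hZ.eq_of_src _ _)⟩, ⟨Iso.refl Z⟩⟩

variable [Abelian C]

theorem isoClass_eq_isoClass_zero_iff {M : C} : isoClass M = isoClass 0 ↔ IsZero M :=
  isoClass_eq_iff.trans
    ⟨fun ⟨e⟩ => (isZero_zero C).of_iso e, fun h => ⟨h.iso (isZero_zero C)⟩⟩

theorem eq_isoClass_zero_iff {m : IsoClass C} : m = isoClass 0 ↔ IsZero m.out := by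
  rw [← isoClass_eq_isoClass_zero_iff, isoClass_out]

theorem isZero_out_isoClass_zero : IsZero (isoClass (0 : C)).out := eq_isoClass_zero_iff.1 rfl

theorem isExt_iff_isIso_right {N E M : C} (hN : IsZero N) {f : N ⟶ E} {g : E ⟶ M} :
    IsExt f g ↔ IsIso g := by
  refine ⟨fun h => h.shortExact.isIso_g_iff.2 hN, fun h => ?_⟩
  have : Mono f := ⟨fun _ _ _ => hN.eq_of_tgt _ _⟩
  refine IsExt.of_exists_lift (hN.eq_of_src _ _) fun T t ht => ⟨0, ?_⟩
  rw [zero_comp, (cancel_mono g).1 (ht.trans zero_comp.symm)]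

theorem isExt_iff_isIso_left {N E M : C} (hM : IsZero M) {f : N ⟶ E} {g : E ⟶ M} :
    IsExt f g ↔ IsIso f := by
  refine ⟨fun h => h.shortExact.isIso_f_iff.2 hM, fun h => ?_⟩
  have : Epi g := ⟨fun _ _ _ => hM.eq_of_src _ _⟩
  refine IsExt.of_exists_desc (hM.eq_of_tgt _ _) fun T t ht => ⟨0, ?_⟩
  rw [comp_zero, (cancel_epi f).1 (ht.trans comp_zero.symm)]

theorem hallP_zero_right {Z : C} (hZ : IsZero Z) (M : C) : hallP M Z M = autCard M :=
  (hallP_eq_card_hallPair M Z M).trans <| Nat.card_congr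
    { toFun := fun z =>
        have : IsIso z.π := (isExt_iff_isIso_right hZ).1 z.isExt
        (asIso z.π : M ≅ M)
      invFun := fun e => ⟨hZ.to_ M, e.hom, (isExt_iff_isIso_right hZ).2 (Iso.isIso_hom e)⟩
      left_inv := fun _ => HallPair.ext (hZ.eq_of_src _ _) rfl
      right_inv := fun _ => Iso.ext rfl }

theorem hallP_zero_left {Z : C} (hZ : IsZero Z) (M : C) : hallP Z M M = autCard M :=
  (hallP_eq_card_hallPair Z M M).trans <| Nat.card_congr
    { toFun := fun z =>
        have : IsIso z.ι := (isExt_iff_isIso_left hZ).1 z.isExt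
        (asIso z.ι : M ≅ M)
      invFun := fun e => ⟨e.hom, hZ.from_ M, (isExt_iff_isIso_left hZ).2 (Iso.isIso_hom e)⟩
      left_inv := fun _ => HallPair.ext rfl (hZ.eq_of_tgt _ _)
      right_inv := fun _ => Iso.ext rfl }

theorem nonempty_iso_of_hallP_zero_right {Z M E : C} (hZ : IsZero Z) (h : hallP M Z E ≠ 0) :
    Nonempty (E ≅ M) := by
  obtain ⟨z⟩ := nonempty_hallPair_of_hallP_ne_zero h
  have : IsIso z.π := (isExt_iff_isIso_right hZ).1 z.isExt
  exact ⟨asIso z.π⟩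

theorem nonempty_iso_of_hallP_zero_left {Z M E : C} (hZ : IsZero Z) (h : hallP Z M E ≠ 0) :
    Nonempty (E ≅ M) := by
  obtain ⟨z⟩ := nonempty_hallPair_of_hallP_ne_zero h
  have : IsIso z.ι := (isExt_iff_isIso_left hZ).1 z.isExt
  exact ⟨(asIso z.ι).symm⟩

theorem isZero_right_of_hallP_ne_zero {M N Z : C} (hZ : IsZero Z) (h : hallP M N Z ≠ 0) :
    IsZero M := by
  obtain ⟨z⟩ := nonempty_hallPair_of_hallP_ne_zero h
  have := z.isExt.epi
  exact IsZero.of_epi z.π hZ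

theorem isZero_or_isZero_of_hallP_simple {M N E : C} [Simple E] (h : hallP M N E ≠ 0) :
    IsZero M ∨ IsZero N := by
  obtain ⟨z⟩ := nonempty_hallPair_of_hallP_ne_zero h
  have := z.isExt.mono
  by_cases hι : z.ι = 0
  · exact Or.inr (IsZero.of_mono_eq_zero z.ι hι)
  · exact Or.inl (z.isExt.shortExact.isIso_f_iff.1 (isIso_of_mono_of_nonzero hι))

theorem card_subobject_lt_of_hallP_ne_zero {M N E : C} [Finite (Subobject E)]
    (hM : ¬IsZero M) (h : hallP M N E ≠ 0) :
    Nat.card (Subobject N) < Nat.card (Subobject E) := by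
  obtain ⟨z⟩ := nonempty_hallPair_of_hallP_ne_zero h
  exact z.isExt.card_subobject_left_lt hM

variable (C) in
/-- Abelian categories in which the structure constants of the Hall algebra are finite and both
Hall products and Hall coproducts of basis elements are finite sums. -/
class HallFinite : Prop where
  finite_hom (M N : C) : Finite (M ⟶ N)
  finite_subobject (E : C) : Finite (Subobject E)
  finite_middle (M N : C) : {e : IsoClass C | hallP M N e.out ≠ 0}.Finite

attribute [instance] HallFinite.finite_hom HallFinite.finite_subobject

variable [HallFinite C]

variable (C) in
/-- The structure constants of the Hall algebra of `C`, in terms of a representative of each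
isomorphism class. -/
noncomputable def hallConstants : HallConstants ℝ (IsoClass C) where
  P m n e := hallP m.out n.out e.out
  a m := autCard m.out
  mid m n := (HallFinite.finite_middle m.out n.out).toFinset
  ends e := (finite_setOf_hallP_ends_ne_zero e.out).toFinset
  zero := isoClass 0
  size m := Nat.card (Subobject m.out)
  a_ne_zero m := autCard_ne_zero _
  a_zero := by rw [autCard_of_isZero isZero_out_isoClass_zero, Nat.cast_one]
  mem_mid h := (Set.Finite.mem_toFinset _).2 (Nat.cast_ne_zero.1 h)
  mem_ends h := (Set.Finite.mem_toFinset _).2 (Nat.cast_ne_zero.1 h)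
  P_zero_right m := by rw [hallP_zero_right isZero_out_isoClass_zero]
  P_zero_left m := by rw [hallP_zero_left isZero_out_isoClass_zero]
  eq_of_P_zero_right h := Quotient.out_equiv_out.1
    (nonempty_iso_of_hallP_zero_right isZero_out_isoClass_zero (Nat.cast_ne_zero.1 h))
  eq_of_P_zero_left h := Quotient.out_equiv_out.1
    (nonempty_iso_of_hallP_zero_left isZero_out_isoClass_zero (Nat.cast_ne_zero.1 h))
  eq_zero_of_P_zero h := eq_isoClass_zero_iff.2
    (isZero_right_of_hallP_ne_zero isZero_out_isoClass_zero (Nat.cast_ne_zero.1 h))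
  size_lt h hm := card_subobject_lt_of_hallP_ne_zero (mt eq_isoClass_zero_iff.2 hm)
    (Nat.cast_ne_zero.1 h)
  assoc m n l f := hallP_assoc _ _ _ _ _ _ (fun _ h => (Set.Finite.mem_toFinset _).2 h)
    fun _ h => (Set.Finite.mem_toFinset _).2 h

theorem hallConstants_P_isoClass (M N E : C) :
    (hallConstants C).P (isoClass M) (isoClass N) (isoClass E) = hallP M N E :=
  congrArg Nat.cast (hallP_congr (nonempty_iso_out M).some (nonempty_iso_out N).some
    (nonempty_iso_out E).some)

theorem hallConstants_a_isoClass (M : C) : (hallConstants C).a (isoClass M) = autCard M :=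
  congrArg Nat.cast (autCard_congr (nonempty_iso_out M).some)

theorem isoClass_eq_hallConstants_zero_iff {M : C} :
    isoClass M = (hallConstants C).zero ↔ IsZero M :=
  isoClass_eq_isoClass_zero_iff

theorem hallConstants_zero_or_zero_of_simple {E : C} [Simple E] {m n : IsoClass C}
    (h : (hallConstants C).P m n (isoClass E) ≠ 0) :
    m = (hallConstants C).zero ∨ n = (hallConstants C).zero := by
  rw [← isoClass_out m, ← isoClass_out n, hallConstants_P_isoClass, Nat.cast_ne_zero] at h
  exact (isZero_or_isZero_of_hallP_simple h).imp eq_isoClass_zero_iff.2 eq_isoClass_zero_iff.2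

theorem hallConstants_greenFormula [HasExt.{w} C] [EnoughInjectives C]
    [∀ M N : C, Finite (Abelian.Ext.{w} M N 1)]
    [∀ M N : C, Subsingleton (Abelian.Ext.{w} M N 2)]
    {κ : IsoClass C → IsoClass C → ℝ} (hκ : ∀ m n : IsoClass C,
      κ m n = Nat.card (Abelian.Ext.{w} m.out n.out 1) / Nat.card (m.out ⟶ n.out)) :
    (hallConstants C).GreenFormula κ := by
  classical
  intro A B X D
  let d := hallConstants C
  have mem_ends {m n e : IsoClass C} (h : hallP m.out n.out e.out ≠ 0) : (m, n) ∈ d.ends e :=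
    d.mem_ends (Nat.cast_ne_zero.2 h)
  let R := (d.ends A ∪ d.ends B).image Prod.fst ∪ (d.ends A ∪ d.ends B).image Prod.snd
  have mem_R {p : IsoClass C × IsoClass C} (hp : p ∈ d.ends A ∪ d.ends B) : p.1 ∈ R ∧ p.2 ∈ R :=
    ⟨Finset.mem_union_left _ (Finset.mem_image_of_mem _ hp),
      Finset.mem_union_right _ (Finset.mem_image_of_mem _ hp)⟩
  have ends_subset : d.ends A ×ˢ d.ends B ⊆ (R ×ˢ R) ×ˢ (R ×ˢ R) :=
    Finset.product_subset_product
      (fun p hp => Finset.mem_product.2 (mem_R (Finset.mem_union_left _ hp)))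
      fun p hp => Finset.mem_product.2 (mem_R (Finset.mem_union_right _ hp))
  have green := hallP_green A.out B.out X.out D.out (d.mid A B) R
    (fun e h => d.mem_mid (Nat.cast_ne_zero.2 h))
    (fun m n h => mem_R (Finset.mem_union_left _ (mem_ends h)))
    (fun m n h => mem_R (Finset.mem_union_right _ (mem_ends h)))
  refine green.trans ?_
  rw [← Finset.sum_product']
  refine (Finset.sum_subset_zero_on_sdiff ends_subset ?_ ?_).symm
  · rintro ⟨p, r⟩ h
    have not_mem := (Finset.mem_sdiff.1 h).2
    rw [Finset.mem_product, not_and_or] at not_mem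
    obtain hp | hr := not_mem
    · simp [not_not.1 (mt mem_ends hp)]
    · simp [not_not.1 (mt mem_ends hr)]
  · rintro ⟨p, r⟩ -
    rw [hκ]
    rfl

end HallNumbers

theorem K0.of_eq_add_of_hallP_ne_zero {C : Type w} [Category.{v} C] [Abelian C] {M N E : C}
    (h : hallP M N E ≠ 0) : K0.of E = K0.of M + K0.of N := by
  obtain ⟨z⟩ := nonempty_hallPair_of_hallP_ne_zero h
  exact (K0.of_add z.isExt.shortExact).trans (add_comm _ _)

theorem K0.of_out {C : Type w} [Category.{v} C] [Abelian C] (e : IsoClass C) :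
    K0.of e.out = K0.ofClass e := by
  rw [K0.of, isoClass_out]

theorem K0.ofClass_eq_add {C : Type w} [Category.{v} C] [Abelian C] [HallFinite C]
    {m n e : IsoClass C} (h : (hallConstants C).P m n e ≠ 0) :
    K0.ofClass e = K0.ofClass m + K0.ofClass n := by
  simpa only [K0.of_out] using K0.of_eq_add_of_hallP_ne_zero (Nat.cast_ne_zero.1 h)

theorem K0.ofClass_hallConstants_zero {C : Type w} [Category.{v} C] [Abelian C] [HallFinite C] :
    K0.ofClass (hallConstants C).zero = 0 := by
  have P_ne_zero : (hallConstants C).P (hallConstants C).zero (hallConstants C).zero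
      (hallConstants C).zero ≠ 0 := by
    rw [(hallConstants C).P_zero_right]
    exact (hallConstants C).a_ne_zero _
  simpa using K0.ofClass_eq_add P_ne_zero

/-! ### The Hopf algebra object -/

theorem KVect.lin_tensorμ_tmul {K : Type w} [AddCommGroup K] {χ : K →+ K →+ ℤ} {q : ℝˣ}
    {X₁ X₂ Y₁ Y₂ : KVect χ q} {n m : K} (x₁ : X₁.carrier) {x₂ : X₂.carrier} {y₁ : Y₁.carrier}
    (y₂ : Y₂.carrier) (hx : x₂ ∈ X₂.piece n) (hy : y₁ ∈ Y₁.piece m) :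
    KVect.lin (tensorμ X₁ X₂ Y₁ Y₂) ((x₁ ⊗ₜ[ℝ] x₂) ⊗ₜ[ℝ] (y₁ ⊗ₜ[ℝ] y₂)) =
      KVect.braidCoeff χ q n m • ((x₁ ⊗ₜ[ℝ] y₁) ⊗ₜ[ℝ] (x₂ ⊗ₜ[ℝ] y₂)) := by
  change (TensorProduct.assoc ℝ X₁.carrier Y₁.carrier (X₂.carrier ⊗[ℝ] Y₂.carrier)).symm
    (x₁ ⊗ₜ TensorProduct.assoc ℝ Y₁.carrier X₂.carrier Y₂.carrier
      (KVect.lin (KVect.braidIso X₂ Y₁).hom (x₂ ⊗ₜ y₁) ⊗ₜ y₂)) = _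
  rw [KVect.braidIso_tmul hx hy, ← TensorProduct.smul_tmul', map_smul, TensorProduct.tmul_smul,
    map_smul]
  rfl

section HopfObject

variable {C : Type w} [Category.{v} C] [Abelian C] {χ : K0 C →+ K0 C →+ ℤ} {q : ℝˣ}

theorem single_mem_hallObj_piece (m : IsoClass C) :
    Finsupp.single m 1 ∈ (hallObj χ q).piece (K0.ofClass m) :=
  Finsupp.single_mem_supported ℝ 1 rfl

theorem map_mem_of_forall_single {M : Type*} [AddCommGroup M] [Module ℝ M]
    (F : (IsoClass C →₀ ℝ) →ₗ[ℝ] M) (W : Submodule ℝ M) (n : K0 C)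
    (h : ∀ m : IsoClass C, K0.ofClass m = n → F (Finsupp.single m 1) ∈ W) (x : IsoClass C →₀ ℝ)
    (hx : x ∈ (hallObj χ q).piece n) : F x ∈ W := by
  suffices Finsupp.supported ℝ ℝ {m : IsoClass C | K0.ofClass m = n} ≤ W.comap F from this hx
  rw [Finsupp.supported_eq_span_single, Submodule.span_le]
  rintro _ ⟨m, hm, rfl⟩
  exact h m hm

variable [HallFinite C]

theorem hallConstants_mul_single_mem (m n : IsoClass C) :
    (hallConstants C).mul (Finsupp.single m 1 ⊗ₜ Finsupp.single n 1) ∈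
      (hallObj χ q).piece (K0.ofClass m + K0.ofClass n) := by
  rw [HallConstants.mul_single]
  refine sum_mem fun e _ => ?_
  by_cases h : (hallConstants C).P m n e = 0
  · rw [h, zero_div, zero_smul]
    exact zero_mem _
  · rw [← K0.ofClass_eq_add h]
    exact Submodule.smul_mem _ _ (single_mem_hallObj_piece e)

theorem hallConstants_comul_single_mem (e : IsoClass C) :
    (hallConstants C).comul (Finsupp.single e 1) ∈
      KVect.tensorPiece (hallObj χ q) (hallObj χ q) (K0.ofClass e) := by
  rw [HallConstants.comul_single]
  refine sum_mem fun p _ => ?_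
  by_cases h : (hallConstants C).P p.1 p.2 e = 0
  · rw [h, zero_div, zero_smul]
    exact zero_mem _
  · rw [K0.ofClass_eq_add h, add_comm]
    exact Submodule.smul_mem _ _ (KVect.tmul_mem_tensorPiece (single_mem_hallObj_piece p.2)
      (single_mem_hallObj_piece p.1))

/-- The Hall multiplication as a morphism of graded vector spaces. -/
noncomputable def hallMul : hallObj χ q ⊗ hallObj χ q ⟶ hallObj χ q where
  lin := (hallConstants C).mul
  map_mem := KVect.mapsTo_of_tmul (V := hallObj χ q) (W := hallObj χ q) (hallConstants C).mul
    (hallObj χ q).piece fun i j x hx y hy => by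
      refine map_mem_of_forall_single
        ((hallConstants C).mul ∘ₗ (TensorProduct.mk ℝ _ _).flip y) _ i ?_ x hx
      rintro m rfl
      refine map_mem_of_forall_single
        ((hallConstants C).mul ∘ₗ TensorProduct.mk ℝ _ _ (Finsupp.single m 1)) _ j ?_ y hy
      rintro n rfl
      exact hallConstants_mul_single_mem m n

/-- The Hall comultiplication as a morphism of graded vector spaces. -/
noncomputable def hallComul : hallObj χ q ⟶ hallObj χ q ⊗ hallObj χ q where
  lin := (hallConstants C).comul
  map_mem i := map_mem_of_forall_single _ (KVect.tensorPiece (hallObj χ q) (hallObj χ q) i) i <| by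
    rintro e rfl
    exact hallConstants_comul_single_mem e

/-- The unit `1 ↦ [0]` of the Hall algebra as a morphism of graded vector spaces. -/
noncomputable def hallOne : 𝟙_ (KVect χ q) ⟶ hallObj χ q where
  lin := LinearMap.toSpanSingleton ℝ _ (Finsupp.single (hallConstants C).zero (1 : ℝ)) ∘ₗ
    ULift.moduleEquiv.toLinearMap
  map_mem i x hx := by
    by_cases h : i = 0
    · rw [h, ← K0.ofClass_hallConstants_zero]
      exact Submodule.smul_mem _ _ (single_mem_hallObj_piece _)
    · replace hx : x ∈ (KVect.unit : KVect χ q).piece i := hx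
      rw [KVect.unit_piece_of_ne h, Submodule.mem_bot] at hx
      rw [hx, map_zero]
      exact zero_mem _

/-- The counit of the Hall algebra as a morphism of graded vector spaces. -/
noncomputable def hallCounit : hallObj χ q ⟶ 𝟙_ (KVect χ q) where
  lin := ULift.moduleEquiv.symm.toLinearMap ∘ₗ Finsupp.lapply (hallConstants C).zero
  map_mem i := map_mem_of_forall_single _ ((KVect.unit : KVect χ q).piece i) i <| by
    rintro m rfl
    by_cases h : m = (hallConstants C).zero
    · rw [h, K0.ofClass_hallConstants_zero]
      exact KVect.mem_unit_piece_zero _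
    · rw [LinearMap.comp_apply, Finsupp.lapply_apply, Finsupp.single_eq_of_ne' h, map_zero]
      exact zero_mem _

/-- The Hall algebra as a monoid object. -/
noncomputable abbrev hallMonObj : MonObj (hallObj χ q) where
  one := hallOne
  mul := hallMul
  one_mul := KVect.hom_ext <| TensorProduct.ext' fun r x => by
    change (hallConstants C).mul
      ((r.down • Finsupp.single (hallConstants C).zero (1 : ℝ)) ⊗ₜ x) = r.down • x
    rw [← TensorProduct.smul_tmul', map_smul, HallConstants.mul_zero_single]
  mul_one := KVect.hom_ext <| TensorProduct.ext' fun x r => by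
    change (hallConstants C).mul
      (x ⊗ₜ (r.down • Finsupp.single (hallConstants C).zero (1 : ℝ))) = r.down • x
    rw [TensorProduct.tmul_smul, map_smul, HallConstants.mul_single_zero]
  mul_assoc := KVect.hom_ext <| TensorProduct.ext_threefold fun x y z =>
    (hallConstants C).mul_assoc x y z

/-- The Hall coalgebra as a comonoid object. -/
noncomputable abbrev hallComonObj : ComonObj (hallObj χ q) where
  counit := hallCounit
  comul := hallComul
  counit_comul := KVect.hom_ext <| LinearMap.ext fun x => by
    have counit_comul := congrArg (TensorProduct.map
      (ULift.moduleEquiv.{0, 0, w} (R := ℝ) (M := ℝ)).symm.toLinearMap LinearMap.id)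
      ((hallConstants C).counit_comul x)
    rwa [← LinearMap.comp_apply, ← TensorProduct.map_comp] at counit_comul
  comul_counit := KVect.hom_ext <| LinearMap.ext fun x => by
    have comul_counit := congrArg (TensorProduct.map LinearMap.id
      (ULift.moduleEquiv.{0, 0, w} (R := ℝ) (M := ℝ)).symm.toLinearMap)
      ((hallConstants C).comul_counit x)
    rwa [← LinearMap.comp_apply, ← TensorProduct.map_comp] at comul_counit
  comul_assoc := KVect.hom_ext <| LinearMap.ext (hallConstants C).comul_assoc

theorem hallConstants_comul_mul_eq_tensorμ
    (green : (hallConstants C).GreenFormula fun m n =>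
      KVect.braidCoeff χ q (K0.ofClass m) (K0.ofClass n)) (A B : IsoClass C) :
    (hallConstants C).comul ((hallConstants C).mul (Finsupp.single A 1 ⊗ₜ Finsupp.single B 1)) =
      TensorProduct.map (hallConstants C).mul (hallConstants C).mul
        (KVect.lin (tensorμ (hallObj χ q) (hallObj χ q) (hallObj χ q) (hallObj χ q))
          ((hallConstants C).comul (Finsupp.single A 1) ⊗ₜ
            (hallConstants C).comul (Finsupp.single B 1))) := by
  rw [HallConstants.comul_mul_single _ green, HallConstants.comul_single _ A,
    HallConstants.comul_single _ B, TensorProduct.sum_tmul, map_sum, map_sum]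
  refine Finset.sum_congr rfl fun p _ => ?_
  rw [TensorProduct.tmul_sum, map_sum, map_sum]
  refine Finset.sum_congr rfl fun r _ => ?_
  have braid := KVect.lin_tensorμ_tmul (X₁ := hallObj χ q) (Y₂ := hallObj χ q)
    (Finsupp.single p.2 1) (Finsupp.single r.1 1) (single_mem_hallObj_piece p.1)
    (single_mem_hallObj_piece r.2)
  rw [TensorProduct.smul_tmul_smul, map_smul, map_smul]
  erw [braid]
  rw [map_smul, smul_smul]
  rfl

/-- The Hall algebra as a bimonoid object, when Green's formula holds with the braiding as the
twist. -/
noncomputable abbrev hallBimonObj (green : (hallConstants C).GreenFormula fun m n =>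
    KVect.braidCoeff χ q (K0.ofClass m) (K0.ofClass n)) : BimonObj (hallObj χ q) where
  __ := hallMonObj
  __ := hallComonObj
  mul_comul := KVect.hom_ext <| TensorProduct.ext <| Finsupp.lhom_ext' fun A =>
    LinearMap.ext_ring <| Finsupp.lhom_ext' fun B => LinearMap.ext_ring <|
      hallConstants_comul_mul_eq_tensorμ green A B
  one_comul := KVect.hom_ext <| LinearMap.ext fun r => by
    change (hallConstants C).comul (r.down • Finsupp.single (hallConstants C).zero (1 : ℝ)) =
      (1 : ℝ) • Finsupp.single (hallConstants C).zero (1 : ℝ) ⊗ₜ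
        (r.down • Finsupp.single (hallConstants C).zero (1 : ℝ))
    rw [map_smul, HallConstants.comul_single_zero, one_smul, TensorProduct.tmul_smul]
  mul_counit := KVect.hom_ext <| TensorProduct.ext' fun x y =>
    congrArg ULift.up ((hallConstants C).mul_apply_zero x y)
  one_counit := KVect.hom_ext <| LinearMap.ext fun r => congrArg ULift.up <| by
    change (r.down • Finsupp.single (hallConstants C).zero (1 : ℝ)) _ = r.down
    rw [Finsupp.smul_apply, Finsupp.single_eq_same, smul_eq_mul, mul_one]

/-- The left inverse of `g` under convolution, where `g` is supposed to fix the unit. -/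
noncomputable def hallConvInv (g : hallObj χ q ⟶ hallObj χ q) : hallObj χ q ⟶ hallObj χ q where
  lin := Finsupp.linearCombination ℝ ((hallConstants C).convInv (KVect.lin g))
  map_mem i := map_mem_of_forall_single _ ((hallObj χ q).piece i) i <| by
    rintro e rfl
    rw [Finsupp.linearCombination_single, one_smul]
    refine (hallConstants C).convInv_mem (W := fun e => (hallObj χ q).piece (K0.ofClass e))
      (single_mem_hallObj_piece _) (fun {m n e} hP x hx => ?_) e
    rw [K0.ofClass_eq_add hP, add_comm]
    exact hallMul.map_mem _ _
      (KVect.tmul_mem_tensorPiece hx (g.map_mem _ _ (single_mem_hallObj_piece m)))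

theorem hallConvInv_comp {g : hallObj χ q ⟶ hallObj χ q}
    (hg : KVect.lin g (Finsupp.single (hallConstants C).zero (1 : ℝ)) =
      Finsupp.single (hallConstants C).zero (1 : ℝ)) :
    hallComul ≫ hallConvInv g ▷ hallObj χ q ≫ hallObj χ q ◁ g ≫ hallMul =
      hallCounit ≫ hallOne :=
  KVect.hom_ext <| LinearMap.ext fun x => by
    have map_eq : TensorProduct.map (KVect.lin (hallConvInv g)) (KVect.lin g) =
        TensorProduct.map LinearMap.id (KVect.lin g) ∘ₗ
          TensorProduct.map (KVect.lin (hallConvInv g)) LinearMap.id := by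
      rw [← TensorProduct.map_comp, LinearMap.id_comp, LinearMap.comp_id]
    exact (congrArg (hallConstants C).mul (LinearMap.congr_fun map_eq _).symm).trans
      ((hallConstants C).mul_map_convInv_comul hg x)

/-- Since every endomorphism fixing the unit has a left inverse under convolution, so does the left
inverse of the identity, which is therefore two-sided. -/
theorem exists_hall_antipode : ∃ S : hallObj χ q ⟶ hallObj χ q,
    hallComul ≫ S ▷ hallObj χ q ≫ hallMul = hallCounit ≫ hallOne ∧
      hallComul ≫ hallObj χ q ◁ S ≫ hallMul = hallCounit ≫ hallOne := by
  let _ : MonObj (hallObj χ q) := hallMonObj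
  let _ : ComonObj (hallObj χ q) := hallComonObj
  let I : Conv (hallObj χ q) (hallObj χ q) := 𝟙 (hallObj χ q)
  let S : Conv (hallObj χ q) (hallObj χ q) := hallConvInv (𝟙 (hallObj χ q))
  let T : Conv (hallObj χ q) (hallObj χ q) := hallConvInv (hallConvInv (𝟙 (hallObj χ q)))
  have S_zero := (Finsupp.linearCombination_single ℝ 1 _).trans <| (one_smul ℝ _).trans <|
    (hallConstants C).convInv_single_zero (g := LinearMap.id) rfl
  have S_mul_I : S * I = 1 := hallConvInv_comp rfl
  have T_mul_S : T * S = 1 := hallConvInv_comp S_zero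
  have I_mul_S : I * S = 1 := left_inv_eq_right_inv T_mul_S S_mul_I ▸ T_mul_S
  rw [Conv.mul_eq, whiskerLeft_id, Category.id_comp] at S_mul_I
  rw [Conv.mul_eq, id_whiskerRight, Category.id_comp] at I_mul_S
  exact ⟨S, S_mul_I, I_mul_S⟩

/-- The Hall algebra as a Hopf algebra object, when Green's formula holds with the braiding as the
twist. -/
noncomputable abbrev hallHopfObj (green : (hallConstants C).GreenFormula fun m n =>
    KVect.braidCoeff χ q (K0.ofClass m) (K0.ofClass n)) : HopfObj (hallObj χ q) where
  __ := hallBimonObj green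
  antipode := exists_hall_antipode.choose
  antipode_left := exists_hall_antipode.choose_spec.1
  antipode_right := exists_hall_antipode.choose_spec.2

theorem hallMul_hallBasis (M N E : C) :
    KVect.lin (hallMul (χ := χ) (q := q)) (hallBasis M ⊗ₜ[ℝ] hallBasis N) (isoClass E) =
      (hallP M N E : ℝ) / (autCard M * autCard N) := by
  rw [← hallConstants_P_isoClass, ← hallConstants_a_isoClass, ← hallConstants_a_isoClass]
  exact HallConstants.mul_single_apply _ _ _ _

theorem hallComul_hallBasis (M N E : C) :
    finsuppTensorFinsupp' ℝ (IsoClass C) (IsoClass C)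
        (KVect.lin (hallComul (χ := χ) (q := q)) (hallBasis E)) (isoClass N, isoClass M) =
      (hallP M N E : ℝ) / autCard E := by
  rw [← hallConstants_P_isoClass, ← hallConstants_a_isoClass]
  exact HallConstants.finsuppTensorFinsupp_comul_single _ _ _ _

theorem hallOne_one {Z : C} (hZ : Limits.IsZero Z) :
    KVect.lin (hallOne (χ := χ) (q := q)) (ULift.up 1) = hallBasis Z := by
  rw [hallBasis, isoClass_eq_hallConstants_zero_iff.2 hZ]
  exact one_smul ℝ _

theorem hallCounit_hallBasis_of_isZero {M : C} (hM : Limits.IsZero M) :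
    KVect.lin (hallCounit (χ := χ) (q := q)) (hallBasis M) = ULift.up 1 := by
  rw [hallBasis, isoClass_eq_hallConstants_zero_iff.2 hM]
  exact congrArg ULift.up Finsupp.single_eq_same

theorem hallCounit_hallBasis_of_not_isZero {M : C} (hM : ¬Limits.IsZero M) :
    KVect.lin (hallCounit (χ := χ) (q := q)) (hallBasis M) = ULift.up 0 :=
  congrArg ULift.up (Finsupp.single_eq_of_ne' (mt isoClass_eq_hallConstants_zero_iff.1 hM))

theorem hall_antipode_simple {S : hallObj χ q ⟶ hallObj χ q}
    (hS : hallComul ≫ S ▷ hallObj χ q ≫ hallMul = hallCounit ≫ hallOne) (M : C) [Simple M] :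
    KVect.lin S (hallBasis M) = -hallBasis M :=
  (hallConstants C).map_single_eq_neg
    (fun x => LinearMap.congr_fun (congrArg KVect.lin hS) x)
    (mt isoClass_eq_hallConstants_zero_iff.1 (Simple.not_isZero M))
    fun _ _ => hallConstants_zero_or_zero_of_simple

end HopfObject

/-! ### Representations of a finite quiver without oriented cycles -/

namespace QuiverRep

variable {k : Type u} [Field k] [Finite k] {V : Type u} [Quiver.{u} V] [Finite V]
  [∀ x y : V, Finite (Quiver.Path x y)]

instance hallFinite : HallFinite (QuiverRep k V) where
  finite_hom _ _ := inferInstance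
  finite_subobject _ := inferInstance
  finite_middle M N := finite_setOf_hallP_middle_ne_zero.{u + 1} M N

variable (k V) in
theorem exists_eulerForm : ∃ χ : K0 (QuiverRep k V) →+ K0 (QuiverRep k V) →+ ℤ,
    ∀ M N : QuiverRep k V, χ (K0.of M) (K0.of N) = eulerForm M N :=
  K0.exists_bilinear eulerForm (fun T S hS => eulerForm_add_left T ⟨S.zero, hS⟩)
    fun T S hS => eulerForm_add_right T ⟨S.zero, hS⟩

theorem hallConstants_greenFormula {χ : K0 (QuiverRep k V) →+ K0 (QuiverRep k V) →+ ℤ}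
    (hχ : ∀ M N : QuiverRep k V, χ (K0.of M) (K0.of N) = eulerForm M N) :
    (hallConstants (QuiverRep k V)).GreenFormula fun m n =>
      KVect.braidCoeff χ (cardUnit k) (K0.ofClass m) (K0.ofClass n) :=
  _root_.hallConstants_greenFormula.{u + 1} fun m n => by
    rw [KVect.braidCoeff, ← K0.of_out m, ← K0.of_out n, hχ, cardUnit_zpow_neg_eulerForm]

end QuiverRep

theorem mainTheorem1_general {k : Type u} [Field k] [Finite k] {V : Type u} [Quiver.{u} V]
    [Finite V] [∀ x y : V, Finite (Quiver.Path x y)] :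
    (∀ (M N : QuiverRep k V) (i : ℕ), Module.Finite k (repExt M N i)) ∧
    (∀ (M N : QuiverRep k V) (i : ℕ), 2 ≤ i → Subsingleton (repExt M N i)) ∧
    ∃ χ : K0 (QuiverRep k V) →+ K0 (QuiverRep k V) →+ ℤ,
      (∀ M N : QuiverRep k V, χ (K0.of M) (K0.of N) = eulerForm M N) ∧
      ∃ _ : HopfObj (hallObj χ (cardUnit k)),
        (∀ M N E : QuiverRep k V,
          KVect.lin (MonObj.mul (X := hallObj χ (cardUnit k)))
              (hallBasis M ⊗ₜ[ℝ] hallBasis N) (isoClass E) =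
            (hallP M N E : ℝ) / (autCard M * autCard N)) ∧
        (∀ M N E : QuiverRep k V,
          finsuppTensorFinsupp' ℝ (IsoClass (QuiverRep k V)) (IsoClass (QuiverRep k V))
              (KVect.lin (ComonObj.comul (X := hallObj χ (cardUnit k))) (hallBasis E))
              (isoClass N, isoClass M) =
            (hallP M N E : ℝ) / autCard E) ∧
        (∀ Z : QuiverRep k V, Limits.IsZero Z →
          KVect.lin (MonObj.one (X := hallObj χ (cardUnit k))) (ULift.up 1) = hallBasis Z) ∧
        (∀ M : QuiverRep k V,
          (Limits.IsZero M →
            KVect.lin (ComonObj.counit (X := hallObj χ (cardUnit k))) (hallBasis M) =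
              ULift.up 1) ∧
          (¬ Limits.IsZero M →
            KVect.lin (ComonObj.counit (X := hallObj χ (cardUnit k))) (hallBasis M) =
              ULift.up 0)) ∧
        (∀ M : QuiverRep k V, Simple M →
          KVect.lin (HopfObj.antipode (X := hallObj χ (cardUnit k))) (hallBasis M) =
            -hallBasis M) := by
  refine ⟨fun M N i => ?_, QuiverRep.subsingleton_repExt, ?_⟩
  · have := QuiverRep.finite_repExt M N i
    exact Module.Finite.of_finite
  obtain ⟨χ, hχ⟩ := QuiverRep.exists_eulerForm k V
  exact ⟨χ, hχ, hallHopfObj (QuiverRep.hallConstants_greenFormula hχ),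
    hallMul_hallBasis, hallComul_hallBasis, fun _ hZ => hallOne_one hZ,
    fun _ => ⟨hallCounit_hallBasis_of_isZero, hallCounit_hallBasis_of_not_isZero⟩,
    fun M _ => hall_antipode_simple exists_hall_antipode.choose_spec.1 M⟩

theorem mainTheorem1 {k : Type u} [Field k] [Finite k] {V : Type u} [Quiver.{u} V]
    (hQ : IsSimplyLacedDynkin V) :
    (∀ (M N : QuiverRep k V) (i : ℕ), Module.Finite k (repExt M N i)) ∧
    (∀ (M N : QuiverRep k V) (i : ℕ), 2 ≤ i → Subsingleton (repExt M N i)) ∧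
    ∃ χ : K0 (QuiverRep k V) →+ K0 (QuiverRep k V) →+ ℤ,
      (∀ M N : QuiverRep k V, χ (K0.of M) (K0.of N) = eulerForm M N) ∧
      ∃ _ : HopfObj (hallObj χ (cardUnit k)),
        (∀ M N E : QuiverRep k V,
          KVect.lin (MonObj.mul (X := hallObj χ (cardUnit k)))
              (hallBasis M ⊗ₜ[ℝ] hallBasis N) (isoClass E) =
            (hallP M N E : ℝ) / (autCard M * autCard N)) ∧
        (∀ M N E : QuiverRep k V,
          finsuppTensorFinsupp' ℝ (IsoClass (QuiverRep k V)) (IsoClass (QuiverRep k V))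
              (KVect.lin (ComonObj.comul (X := hallObj χ (cardUnit k))) (hallBasis E))
              (isoClass N, isoClass M) =
            (hallP M N E : ℝ) / autCard E) ∧
        (∀ Z : QuiverRep k V, Limits.IsZero Z →
          KVect.lin (MonObj.one (X := hallObj χ (cardUnit k))) (ULift.up 1) = hallBasis Z) ∧
        (∀ M : QuiverRep k V,
          (Limits.IsZero M →
            KVect.lin (ComonObj.counit (X := hallObj χ (cardUnit k))) (hallBasis M) =
              ULift.up 1) ∧
          (¬ Limits.IsZero M →
            KVect.lin (ComonObj.counit (X := hallObj χ (cardUnit k))) (hallBasis M) =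
              ULift.up 0)) ∧
        (∀ M : QuiverRep k V, Simple M →
          KVect.lin (HopfObj.antipode (X := hallObj χ (cardUnit k))) (hallBasis M) =
            -hallBasis M) := by
  have := hQ.finite_vertices
  have := hQ.finite_path
  exact mainTheorem1_general
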